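/- Conventions. Let $m\ge 1$, $n\ge 0$ be integers and $\mathbb K$ a field. A Motzkin diagram is a partition of $2n$ boundary points of a rectangle ($n$ on the top edge, $n$ on the bottom edge) into blocks of size one ("stops") or two ("strands") which is planar (no two blocks cross). The Motzkin monoid $Mo_n$ is the set of Motzkin diagrams with multiplication by vertical concatenation, where internal components (connected components of the concatenation which touch neither the top nor the bottom edge, i.e. closed loops and arcs ending in two stops) are discarded. The $m$-cyclic Motzkin monoid $mMo_n$ is the set of pairs $(a,i)$ with $a\in Mo_n$, $i\in\mathbb Z/m$, with $(a,i)(b,j)=(ab,\,i+j+\Phi(a,b))$, where $\Phi(a,b)$ is the number of internal components of the concatenation of $a$ and $b$. A through strand is a strand joining the top and the bottom edge; $mMo_n^{\le k}$ is the submonoid consisting of the identity and all elements with at most $k$ through strands. For a monoid $S$, $a\le_l b\Leftrightarrow b\in Sa$, $a\le_r b\Leftrightarrow b\in aS$, $a\le_{lr}b\Leftrightarrow b\in SaS$; left, right and $J$-cells are the classes of the associated equivalence relations, and $H$-cells are the non-empty intersections of a left cell and a right cell contained in the same $J$-cell. For an idempotent $e$ with left cell $L$ and $H$-cell $H(e)$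 and a simple $H(e)$-representation $K$, put $L_K=\mathrm{Hd}(\mathbb K L\otimes_{\mathbb K H(e)}K)$, where $S$ acts on $\mathbb K L$ by left multiplication with products outside $L$ set to $0$, and $\mathrm{Hd}$ is the quotient by the radical. An apex of a representation is a $\le_{lr}$-maximal idempotent $J$-cell not annihilating it. Let $\mathbb 1_b$ be the one-dimensional representation in which units act by $1$ and non-units by $0$, $\mathbb 1_t$ the one in which every element acts by $1$, and call a simple representation nontrivial if it is isomorphic to neither. The representation gap $\mathrm{gap}_{\mathbb K}(S)$ is the largest $d$ such that every representation of dimension less than $d$ is a direct sum of copies of $\mathbb 1_b$ and $\mathbb 1_t$ (and $0$ by convention if $S$ is trivial or $S\cong\{1,a\mid a^2=a\}$). $S$ is right-connected (left-connected) if the non-units form exactly one class of the equivalence relation generated by $ab\approx a$ ($ab\approx b$) for non-units $a,b$; null-connected if every non-unit is a product of two non-units; well-connected if it is right-, left- and null-connected or a group. The Motzkin algebra $Mo_n^{lin}(\delta)$ has basis the Motzkin diagrams and multiplication $a\cdot b=\delta^{\Phi(a,b)}ab$; its cell module $W(j)$ is the span of the diagrams with $j$ through strands in a fixed left cell of $Mo_n$,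 with products outside the cell set to $0$, and $L(j)$ is the head of $W(j)$. Theorem. (a) For $x=(a,i)$, $y=(b,j)$ in $mMo_n$ one has $x\le_l y\Leftrightarrow a\le_l b$, and likewise for $\le_r$ and $\le_{lr}$. So $mMo_n$ has the cell structure of $Mo_n$; the $H$-cell of $x$ has exactly $m$ times as many elements as that of $a$, namely $m$, and contains an idempotent if and only if that of $a$ does. For each idempotent $e$ the map $i\mapsto(1,i)e$ is an isomorphism $\mathcal C_m=\mathbb Z/m\cong H(e)$. (b) The $J$-cells of $mMo_n$ are the sets of elements with exactly $j$ through strands, $0\le j\le n$; $x\le_{lr}y$ if and only if $y$ has at most as many through strands as $x$; every $J$-cell contains an idempotent. For an idempotent $e$ with $j$ through strands and a simple $\mathcal C_m$-representation $K$, the representation $L(j,K):=L_K$ is simple with unique apex the $J$-cell of $e$; up to isomorphism it depends only on $(j,K)$; $L(j,K)\cong L(j',K')$ if and only if $j=j'$ and $K\cong K'$; and each simple $mMo_n$-representation is isomorphic to some $L(j,K)$, $0\le j\le n$. (c) Suppose $\mathrm{char}\,\mathbb K\nmid m$ and $0\le k\le n$. If $n\le 1$, or $n\ge 3$ and $k\ge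 2$, then $mMo_n^{\le k}$ is well-connected. If $n\le 1$ and $m\ge 2$, or $n=2$ and $k\ge 1$, or $n\ge3$ and $k\ge2$, then nontrivial simple $mMo_n^{\le k}$-representations exist and $$\mathrm{gap}_{\mathbb K}(mMo_n^{\le k})=\min\{\dim_{\mathbb K}L\mid L\text{ a nontrivial simple } mMo_n^{\le k}\text{-representation}\}.$$ (d) $\mathbb K[mMo_n]$ is an involutive sandwich cellular algebra, with sandwich cellular basis $mMo_n$ and the following involutive cell datum. The middle poset $\mathcal P$ is the set of $J$-cells ordered by $\le_{lr}$; the top set $\mathcal T(\lambda)$, equal to the bottom set, is the set of right cells in $\lambda$; ${}^*$ is induced by reflecting diagrams in the horizontal middle line. One can choose in each $\lambda$ an idempotent $e=e^*$, and in each right cell $T$ in $\lambda$ an element $t_T$ in the left cell of $e$; for every such choice $\mathscr H_\lambda=\mathbb K H(e)$ with basis $B_\lambda=H(e)$, $c^\lambda_{T,h,B}=t_T\,h\,t_B^*$, and the cell representations $\Delta(\lambda)=\mathbb K L$, $\nabla(\lambda)=\mathbb K R$ for the left cell $L$ and the right cell $R$ of $e$ form such a datum. Explicitly: the sets $\mathcal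 T(\lambda)$ are finite; the $c^\lambda_{T,h,B}$ are a $\mathbb K$-basis, equal as a set to $mMo_n$; with $\mathscr A=\mathbb K[mMo_n]$, $\mathscr A^{>\lambda}$, $\mathscr A^{\ge\lambda}$ the spans of the $c^\mu_{T,h,B}$ with $\mu>\lambda$, $\mu\ge\lambda$, and $c_{T,h,B}^\lambda$ extended linearly to $h\in\mathscr H_\lambda$, one has $x\,c^\lambda_{T,h,B}\equiv\sum_{U}c^\lambda_{U,\,r^x_{T,U}h,\,B}\pmod{\mathscr A^{>\lambda}}$ with $r^x_{T,U}\in\mathscr H_\lambda$ independent of $h$ and $B$, and an analogous formula for right multiplication; $\Delta(\lambda)$ is an $\mathscr A$-$\mathscr H_\lambda$-bimodule, $\nabla(\lambda)$ is an $\mathscr H_\lambda$-$\mathscr A$-bimodule, both are free over $\mathscr H_\lambda$, and $\mathscr A^{\ge\lambda}/\mathscr A^{>\lambda}\cong\Delta(\lambda)\otimes_{\mathscr H_\lambda}\nabla(\lambda)$ as $\mathscr A$-bimodules; ${}^*$ is an anti-involution of $\mathscr A$ which restricts to an involution of $B_\lambda$, and $(c^\lambda_{T,h,B})^*\equiv c^\lambda_{B,h^*,T}\pmod{\mathscr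 A^{>\lambda}}$. (e) Suppose $\mathbb K$ contains a primitive $m$-th root of unity. Let $\zeta_m\in\mathbb K$ be any $m$-th root of unity and $K$ the one-dimensional $\mathcal C_m$-representation in which $1\in\mathbb Z/m$ acts by $\zeta_m$. Then for $0\le j\le n$ the module $L(j)$ over $Mo_n^{lin}(\zeta_m)$ is simple and $\dim_{\mathbb K}L(j,K)=\dim_{\mathbb K}L(j)$. -/

import Mathlib

universe u

namespace Motz

/-! ### Planar diagrams -/

/-- The `2n` boundary points: `inl i` is the `i`-th top point, `inr i` the `i`-th bottom point. -/
abbrev Vert (n : ℕ) := Fin n ⊕ Fin n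

/-- Position of a boundary point when one walks once around the boundary of the rectangle:
along the top from left to right, then along the bottom from right to left. -/
def circ {n : ℕ} : Vert n → ℕ
  | .inl i => i
  | .inr i => 2 * n - 1 - i

/-- A Motzkin diagram (without internal components): a partition of the `2n` boundary points into
blocks with at most two elements such that no two distinct blocks cross. -/
@[ext] structure Diagram (n : ℕ) where
  rel : Setoid (Vert n)
  size_le_two : ∀ x y z, rel x y → rel x z → x = y ∨ x = z ∨ y = z
  planar : ∀ x y z w, circ x < circ y → circ y < circ z → circ z < circ w →
    rel x z → rel y w → rel x y

/-- The boundary of a diagram placed with its top points in row `i` and its bottom points in row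
`j` of a family of rows of `n` points. -/
def row {ι : Type} {n : ℕ} (i j : ι) : Vert n → ι × Fin n :=
  Sum.elim (Prod.mk i) (Prod.mk j)

/-- `a` stacked on top of `b`: the partition of three rows of `n` points into the connected
components of the concatenation. -/
def stack {n : ℕ} (a b : Setoid (Vert n)) : Setoid (Fin 3 × Fin n) :=
  a.map (row 0 1) ⊔ b.map (row 1 2)

/-- The partition of the outer points induced by concatenation. -/
def glue {n : ℕ} (a b : Setoid (Vert n)) : Setoid (Vert n) :=
  (stack a b).comap (row 0 2)

/-- The number of classes of `s` that do not meet the range of `f`. -/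
noncomputable def avoid {X Y : Type} (s : Setoid X) (f : Y → X) : ℕ :=
  Nat.card {q : Quotient s // ∀ y, Quotient.mk s (f y) ≠ q}

/-- The number of internal components of the concatenation of `a` and `b`, that is, of connected
components (closed loops or arcs ending in two stops) that meet neither the top nor the bottom
row. -/
noncomputable def internal {n : ℕ} (a b : Setoid (Vert n)) : ℕ :=
  avoid (stack a b) (row 0 2)

section Gluing

theorem map_le_iff {X Y : Type} (r : Setoid X) (f : X → Y) (t : Setoid Y) :
    r.map f ≤ t ↔ ∀ x y, r x y → t (f x) (f y) := by
  constructor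
  · intro h x y hxy
    exact h (Relation.EqvGen.rel _ _ ⟨x, y, hxy, rfl, rfl⟩)
  · intro h
    refine Setoid.eqvGen_le ?_
    rintro _ _ ⟨x, y, hxy, rfl, rfl⟩
    exact h x y hxy

theorem map_rel {X Y : Type} (r : Setoid X) (f : X → Y) {x y : X} (h : r x y) :
    r.map f (f x) (f y) :=
  Relation.EqvGen.rel _ _ ⟨x, y, h, rfl, rfl⟩

theorem map_map' {X Y Z : Type} (r : Setoid X) (f : X → Y) (g : Y → Z) :
    (r.map f).map g = r.map (g ∘ f) := by
  refine eq_of_forall_ge_iff fun t => ?_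
  rw [map_le_iff, map_le_iff]
  exact map_le_iff r f (t.comap g)

theorem map_sup {X Y : Type} (r s : Setoid X) (f : X → Y) :
    (r ⊔ s).map f = r.map f ⊔ s.map f := by
  refine eq_of_forall_ge_iff fun t => ?_
  rw [sup_le_iff, map_le_iff, map_le_iff, map_le_iff]
  exact sup_le_iff (a := r) (b := s) (c := t.comap f)

theorem map_cases {X Y : Type} (r : Setoid X) (f : X → Y) (hf : Function.Injective f) {x y : Y}
    (h : r.map f x y) : x = y ∨ ∃ z w, x = f z ∧ y = f w ∧ r z w := by
  have : Setoid.ker f ≤ r := by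
    intro a b hab
    obtain rfl := hf hab
    exact Setoid.refl' r _
  have h' := (congrFun (congrFun (Setoid.coe_map_of_ker_le r f this) x) y).mp h
  rcases h' with ⟨z, w, h1, h2, h3⟩ | h'
  · exact Or.inr ⟨z, w, h2.symm, h3.symm, h1⟩
  · exact Or.inl h'

theorem avoid_comp {X Y Z : Type} [Finite X] (s : Setoid X) (f : Y → X) (g : Z → Y) :
    avoid s (f ∘ g) = avoid s f + avoid (s.comap f) g := by
  classical
  have hfin : Finite (Quotient (s.comap f)) := by
    refine Finite.of_injective
      (Quotient.map' (s₁ := s.comap f) (s₂ := s) f (fun _ _ h => h)) ?_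
    intro p q
    induction p using Quotient.inductionOn
    induction q using Quotient.inductionOn
    rename_i a b
    intro h
    have h' : Quotient.mk s (f a) = Quotient.mk s (f b) := h
    exact Quotient.sound (s := s.comap f) (Quotient.exact h' : s _ _)
  unfold avoid
  rw [← Nat.card_sum]
  symm
  refine Nat.card_congr (Equiv.ofBijective (Sum.elim (fun q => ⟨q.1, fun z => q.2 (g z)⟩)
    (fun p => ⟨Quotient.map' (s₁ := s.comap f) (s₂ := s) f (fun _ _ h => h) p.1, ?_⟩)) ⟨?_, ?_⟩)
  · obtain ⟨p, hp⟩ := p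
    induction p using Quotient.inductionOn with | _ y
    intro z h
    have h' : Quotient.mk s (f (g z)) = Quotient.mk s (f y) := h
    exact hp z (Quotient.sound (s := s.comap f) (Quotient.exact h' : s _ _))
  · rintro (⟨q, hq⟩ | ⟨p, hp⟩) (⟨q', hq'⟩ | ⟨p', hp'⟩) h
    · simpa using h
    · induction p' using Quotient.inductionOn with | _ y
      exact absurd (congrArg Subtype.val h).symm (hq y)
    · induction p using Quotient.inductionOn with | _ y
      exact absurd (congrArg Subtype.val h) (hq' y)
    · induction p using Quotient.inductionOn with | _ y
      induction p' using Quotient.inductionOn with | _ y'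
      have h1 := Quotient.exact (congrArg Subtype.val h)
      have h2 : Quotient.mk (s.comap f) y = Quotient.mk (s.comap f) y' := Quotient.sound h1
      simp only [h2]
  · rintro ⟨q, hq⟩
    by_cases h : ∀ y, Quotient.mk s (f y) ≠ q
    · exact ⟨Sum.inl ⟨q, h⟩, rfl⟩
    · push Not at h
      obtain ⟨y, rfl⟩ := h
      refine ⟨Sum.inr ⟨Quotient.mk _ y, fun z hz => hq z ?_⟩, rfl⟩
      have h' : (s.comap f) (g z) y := Quotient.exact hz
      exact Quotient.sound (h' : s _ _)

theorem amalgam_key {W X Y Z : Type} (r : Setoid Z) (t : Setoid Y) (i : Z → X) (f : Y → X)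
    (h : W → Z) (g : W → Y) (hi : Function.Injective i) (hf : Function.Injective f)
    (pb : ∀ z y, i z = f y → ∃ w, h w = z ∧ g w = y) {p q : Y}
    (hpq : r.map i (f p) (f q)) : ((r.comap h).map g ⊔ t) p q := by
  rcases map_cases r i hi hpq with h0 | ⟨z, w, h1, h2, h3⟩
  · obtain rfl := hf h0
    exact Setoid.refl' _ _
  · obtain ⟨a, ha, ha'⟩ := pb z p h1.symm
    obtain ⟨b, hb, hb'⟩ := pb w q h2.symm
    subst ha ha' hb hb'
    exact (le_sup_left : (r.comap h).map g ≤ _) (map_rel (r.comap h) g h3)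

theorem amalgam_cases {W X Y Z : Type} (r : Setoid Z) (t : Setoid Y) (i : Z → X) (f : Y → X)
    (h : W → Z) (g : W → Y) (hi : Function.Injective i) (hf : Function.Injective f)
    (pb : ∀ z y, i z = f y → ∃ w, h w = z ∧ g w = y)
    {x y : X} (hxy : (r.map i ⊔ t.map f) x y) :
    r.map i x y ∨ ∃ p q, r.map i x (f p) ∧ ((r.comap h).map g ⊔ t) p q ∧ r.map i (f q) y := by
  have key := fun p q => amalgam_key r t i f h g hi hf pb (p := p) (q := q)
  let w : Setoid X :=
    { r := fun x y => r.map i x y ∨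
        ∃ p q, r.map i x (f p) ∧ ((r.comap h).map g ⊔ t) p q ∧ r.map i (f q) y
      iseqv :=
        { refl := fun x => Or.inl (Setoid.refl' _ _)
          symm := by
            rintro x y (h1 | ⟨p, q, h1, h2, h3⟩)
            · exact Or.inl (Setoid.symm' _ h1)
            · exact Or.inr ⟨q, p, Setoid.symm' _ h3, Setoid.symm' _ h2, Setoid.symm' _ h1⟩
          trans := by
            rintro x y z (h1 | ⟨p, q, h1, h2, h3⟩) (h4 | ⟨p', q', h4, h5, h6⟩)
            · exact Or.inl (Setoid.trans' _ h1 h4)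
            · exact Or.inr ⟨p', q', Setoid.trans' _ h1 h4, h5, h6⟩
            · exact Or.inr ⟨p, q, h1, h2, Setoid.trans' _ h3 h4⟩
            · exact Or.inr ⟨p, q', h1, Setoid.trans' _ (Setoid.trans' _ h2
                (key _ _ (Setoid.trans' _ h3 h4))) h5, h6⟩ } }
  have hw : r.map i ⊔ t.map f ≤ w := by
    refine sup_le (fun _ _ h1 => Or.inl h1) ?_
    rw [map_le_iff]
    intro a b hab
    exact Or.inr ⟨a, b, Setoid.refl' _ _, (le_sup_right : t ≤ (r.comap h).map g ⊔ t) hab,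
      Setoid.refl' _ _⟩
  exact hw hxy

theorem amalgam_comap {W X Y Z : Type} (r : Setoid Z) (t : Setoid Y) (i : Z → X) (f : Y → X)
    (h : W → Z) (g : W → Y) (hi : Function.Injective i) (hf : Function.Injective f)
    (comm : ∀ w, i (h w) = f (g w))
    (pb : ∀ z y, i z = f y → ∃ w, h w = z ∧ g w = y) :
    (r.map i ⊔ t.map f).comap f = (r.comap h).map g ⊔ t := by
  apply le_antisymm
  · intro p q hpq
    rcases amalgam_cases r t i f h g hi hf pb hpq with h1 | ⟨p', q', h1, h2, h3⟩
    · exact amalgam_key r t i f h g hi hf pb h1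
    · exact Setoid.trans' _ (Setoid.trans' _ (amalgam_key r t i f h g hi hf pb h1) h2)
        (amalgam_key r t i f h g hi hf pb h3)
  · refine sup_le ?_ ?_
    · rw [map_le_iff]
      intro a b hab
      change (r.map i ⊔ t.map f) (f (g a)) (f (g b))
      rw [← comm, ← comm]
      exact (le_sup_left : r.map i ≤ _) (map_rel r i hab)
    · intro a b hab
      exact (le_sup_right : t.map f ≤ r.map i ⊔ t.map f) (map_rel t f hab)

theorem amalgam_avoid {W X Y Z : Type} (r : Setoid Z) (t : Setoid Y) (i : Z → X) (f : Y → X)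
    (h : W → Z) (g : W → Y) (hi : Function.Injective i) (hf : Function.Injective f)
    (comm : ∀ w, i (h w) = f (g w))
    (pb : ∀ z y, i z = f y → ∃ w, h w = z ∧ g w = y)
    (cover : ∀ x, (∃ z, i z = x) ∨ ∃ y, f y = x) :
    avoid (r.map i ⊔ t.map f) f = avoid r h := by
  have key : ∀ z y, r.map i (i z) (f y) → ∃ w, r (h w) z := by
    intro z y hzy
    rcases map_cases r i hi hzy with h0 | ⟨z1, z2, h1, h2, h3⟩
    · obtain ⟨w, hw, -⟩ := pb z y h0
      exact ⟨w, hw ▸ Setoid.refl' r _⟩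
    · obtain ⟨w, hw, -⟩ := pb z2 y h2.symm
      rw [hi h1]
      exact ⟨w, by rw [hw]; exact Setoid.symm' r h3⟩
  have key2 : ∀ z y, (r.map i ⊔ t.map f) (i z) (f y) → ∃ w, r (h w) z := by
    intro z y hzy
    rcases amalgam_cases r t i f h g hi hf pb hzy with h1 | ⟨p', q', h1, h2, h3⟩
    · exact key z y h1
    · exact key z _ h1
  unfold avoid
  symm
  have hmap : ∀ a b, r a b → (r.map i ⊔ t.map f) (i a) (i b) := fun a b hab =>
    (le_sup_left : r.map i ≤ _) (map_rel r i hab)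
  refine Nat.card_congr (Equiv.ofBijective
    (fun q => ⟨Quotient.map' (s₁ := r) (s₂ := r.map i ⊔ t.map f) i hmap q.1, ?_⟩) ⟨?_, ?_⟩)
  · obtain ⟨q, hq⟩ := q
    induction q using Quotient.inductionOn with | _ z
    intro y hy
    obtain ⟨w, hw⟩ := key2 z y (Setoid.symm' _ (Quotient.exact hy))
    exact hq w (Quotient.sound hw)
  · rintro ⟨q, hq⟩ ⟨q', hq'⟩ hqq
    induction q using Quotient.inductionOn with | _ z
    induction q' using Quotient.inductionOn with | _ z'
    have h1 : (r.map i ⊔ t.map f) (i z) (i z') := Quotient.exact (congrArg Subtype.val hqq)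
    rcases amalgam_cases r t i f h g hi hf pb h1 with h1 | ⟨p', q', h1, h2, h3⟩
    · have : r z z' := by
        rcases map_cases r i hi h1 with h0 | ⟨z1, z2, h1, h2, h3⟩
        · obtain rfl := hi h0; exact Setoid.refl' r _
        · rw [hi h1, hi h2]; exact h3
      exact Subtype.ext (Quotient.sound this)
    · obtain ⟨w, hw⟩ := key _ _ h1
      exact absurd (Quotient.sound hw) (hq w)
  · rintro ⟨q, hq⟩
    induction q using Quotient.inductionOn with | _ x
    rcases cover x with ⟨z, rfl⟩ | ⟨y, rfl⟩
    · refine ⟨⟨Quotient.mk _ z, fun w hw => hq (g w) ?_⟩, rfl⟩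
      rw [← comm]
      exact Quotient.sound (hmap _ _ (Quotient.exact hw))
    · exact absurd rfl (hq y)

variable {n : ℕ}

theorem row_injective {ι : Type} {i j : ι} (hij : i ≠ j) :
    Function.Injective (row i j : Vert n → ι × Fin n) := by
  rintro (x | x) (y | y) h <;> simp [row, hij, hij.symm] at h ⊢ <;> exact h

/-- Reindexing of rows. -/
def rows {ι κ : Type} (f : ι → κ) : ι × Fin n → κ × Fin n := Prod.map f id

theorem rows_comp_row {ι κ : Type} (f : ι → κ) (i j : ι) :
    (rows f ∘ row i j : Vert n → κ × Fin n) = row (f i) (f j) := by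
  funext x
  rcases x with x | x <;> rfl

def stack4 (a b c : Setoid (Vert n)) : Setoid (Fin 4 × Fin n) :=
  a.map (row 0 1) ⊔ b.map (row 1 2) ⊔ c.map (row 2 3)

theorem rows_injective {ι κ : Type} {f : ι → κ} (hf : Function.Injective f) :
    Function.Injective (rows f : ι × Fin n → κ × Fin n) :=
  hf.prodMap Function.injective_id

theorem stack4_left (a b c : Setoid (Vert n)) :
    (stack a b).map (rows ![0, 1, 2]) ⊔ (c.map (row 1 2)).map (rows ![0, 2, 3]) =
      stack4 a b c := by
  simp only [stack, stack4, map_sup, map_map', rows_comp_row]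
  rfl

theorem stack4_right (a b c : Setoid (Vert n)) :
    (stack b c).map (rows ![1, 2, 3]) ⊔ (a.map (row 0 1)).map (rows ![0, 1, 3]) =
      stack4 a b c := by
  simp only [stack, stack4, map_sup, map_map', rows_comp_row]
  rw [sup_comm, sup_assoc]
  rfl

theorem pb_left : ∀ (z y : Fin 3 × Fin n),
    rows (![0, 1, 2] : Fin 3 → Fin 4) z = rows ![0, 2, 3] y →
      ∃ w : Vert n, row 0 2 w = z ∧ row 0 1 w = y := by
  rintro ⟨i, z⟩ ⟨j, y⟩ h
  simp only [rows, Prod.map_apply, id, Prod.mk.injEq] at h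
  obtain ⟨h1, rfl⟩ := h
  fin_cases i <;> fin_cases j <;> simp at h1
  · exact ⟨.inl z, rfl, rfl⟩
  · exact ⟨.inr z, rfl, rfl⟩

theorem pb_right : ∀ (z y : Fin 3 × Fin n),
    rows (![1, 2, 3] : Fin 3 → Fin 4) z = rows ![0, 1, 3] y →
      ∃ w : Vert n, row 0 2 w = z ∧ row 1 2 w = y := by
  rintro ⟨i, z⟩ ⟨j, y⟩ h
  simp only [rows, Prod.map_apply, id, Prod.mk.injEq] at h
  obtain ⟨h1, rfl⟩ := h
  fin_cases i <;> fin_cases j <;> simp at h1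
  · exact ⟨.inl z, rfl, rfl⟩
  · exact ⟨.inr z, rfl, rfl⟩

theorem comm_left (w : Vert n) : rows (![0, 1, 2] : Fin 3 → Fin 4) (row 0 2 w) =
    rows ![0, 2, 3] (row 0 1 w) := by
  rcases w with w | w <;> rfl

theorem comm_right (w : Vert n) : rows (![1, 2, 3] : Fin 3 → Fin 4) (row 0 2 w) =
    rows ![0, 1, 3] (row 1 2 w) := by
  rcases w with w | w <;> rfl

theorem stack_glue_left (a b c : Setoid (Vert n)) :
    (stack4 a b c).comap (rows ![0, 2, 3]) = stack (glue a b) c := by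
  rw [← stack4_left, amalgam_comap (stack a b) _ _ _ (row 0 2) (row 0 1)
    (rows_injective (by decide)) (rows_injective (by decide)) comm_left pb_left]
  rfl

theorem stack_glue_right (a b c : Setoid (Vert n)) :
    (stack4 a b c).comap (rows ![0, 1, 3]) = stack a (glue b c) := by
  rw [← stack4_right, amalgam_comap (stack b c) _ _ _ (row 0 2) (row 1 2)
    (rows_injective (by decide)) (rows_injective (by decide)) comm_right pb_right, sup_comm]
  rfl

theorem avoid_left (a b c : Setoid (Vert n)) :
    avoid (stack4 a b c) (rows ![0, 2, 3]) = internal a b := by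
  rw [← stack4_left, amalgam_avoid (stack a b) _ _ _ (row 0 2) (row 0 1)
    (rows_injective (by decide)) (rows_injective (by decide)) comm_left pb_left]
  · rfl
  · rintro ⟨i, x⟩
    fin_cases i
    · exact Or.inl ⟨(0, x), rfl⟩
    · exact Or.inl ⟨(1, x), rfl⟩
    · exact Or.inl ⟨(2, x), rfl⟩
    · exact Or.inr ⟨(2, x), rfl⟩

theorem avoid_right (a b c : Setoid (Vert n)) :
    avoid (stack4 a b c) (rows ![0, 1, 3]) = internal b c := by
  rw [← stack4_right, amalgam_avoid (stack b c) _ _ _ (row 0 2) (row 1 2)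
    (rows_injective (by decide)) (rows_injective (by decide)) comm_right pb_right]
  · rfl
  · rintro ⟨i, x⟩
    fin_cases i
    · exact Or.inr ⟨(0, x), rfl⟩
    · exact Or.inl ⟨(0, x), rfl⟩
    · exact Or.inl ⟨(1, x), rfl⟩
    · exact Or.inl ⟨(2, x), rfl⟩

theorem glue_assoc (a b c : Setoid (Vert n)) :
    glue (glue a b) c = glue a (glue b c) := by
  have h1 : glue (glue a b) c = (stack4 a b c).comap (rows ![0, 2, 3] ∘ row 0 2) := by
    rw [glue, ← stack_glue_left, Setoid.comap_comp]
  have h2 : glue a (glue b c) = (stack4 a b c).comap (rows ![0, 1, 3] ∘ row 0 2) := by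
    rw [glue, ← stack_glue_right, Setoid.comap_comp]
  rw [h1, h2, rows_comp_row, rows_comp_row]
  rfl

theorem internal_cocycle (a b c : Setoid (Vert n)) :
    internal a b + internal (glue a b) c = internal b c + internal a (glue b c) := by
  rw [← avoid_left a b c, ← avoid_right a b c, internal, ← stack_glue_left, ← avoid_comp,
    internal, ← stack_glue_right, ← avoid_comp, rows_comp_row, rows_comp_row]
  rfl

end Gluing

section Units

variable {n : ℕ}

/-- The partition of the identity diagram. -/
def idRel (n : ℕ) : Setoid (Vert n) := Setoid.ker (Sum.elim id id)

/-- Collapse of the two upper rows. -/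
def collapseTop : Fin 3 × Fin n → Vert n := fun v => if v.1 = 2 then .inr v.2 else .inl v.2

/-- Collapse of the two lower rows. -/
def collapseBot : Fin 3 × Fin n → Vert n := fun v => if v.1 = 0 then .inl v.2 else .inr v.2

theorem stack_id_left (a : Setoid (Vert n)) : stack (idRel n) a = a.comap collapseTop := by
  apply le_antisymm
  · refine sup_le ?_ ?_
    · rw [map_le_iff]
      rintro (x | x) (y | y) h <;> obtain rfl : x = y := h <;> exact Setoid.refl' a _
    · rw [map_le_iff]
      rintro (x | x) (y | y) h <;> exact h
  · have key : ∀ v : Fin 3 × Fin n, stack (idRel n) a v (row 1 2 (collapseTop v)) := by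
      rintro ⟨i, x⟩
      fin_cases i
      · exact (le_sup_left : (idRel n).map (row 0 1) ≤ stack (idRel n) a)
          (map_rel (idRel n) (row 0 1) (x := .inl x) (y := .inr x) rfl)
      · exact Setoid.refl' _ _
      · exact Setoid.refl' _ _
    intro v w h
    exact Setoid.trans' _ (key v) (Setoid.trans' _
      ((le_sup_right : a.map (row 1 2) ≤ stack (idRel n) a) (map_rel a (row 1 2) h))
      (Setoid.symm' _ (key w)))

theorem stack_id_right (a : Setoid (Vert n)) : stack a (idRel n) = a.comap collapseBot := by
  apply le_antisymm
  · refine sup_le ?_ ?_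
    · rw [map_le_iff]
      rintro (x | x) (y | y) h <;> exact h
    · rw [map_le_iff]
      rintro (x | x) (y | y) h <;> obtain rfl : x = y := h <;> exact Setoid.refl' a _
  · have key : ∀ v : Fin 3 × Fin n, stack a (idRel n) v (row 0 1 (collapseBot v)) := by
      rintro ⟨i, x⟩
      fin_cases i
      · exact Setoid.refl' _ _
      · exact Setoid.refl' _ _
      · exact (le_sup_right : (idRel n).map (row 1 2) ≤ stack a (idRel n))
          (map_rel (idRel n) (row 1 2) (x := .inr x) (y := .inl x) rfl)
    intro v w h
    exact Setoid.trans' _ (key v) (Setoid.trans' _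
      ((le_sup_left : a.map (row 0 1) ≤ stack a (idRel n)) (map_rel a (row 0 1) h))
      (Setoid.symm' _ (key w)))

theorem glue_id_left (a : Setoid (Vert n)) : glue (idRel n) a = a := by
  rw [glue, stack_id_left]
  ext v w
  rcases v with v | v <;> rcases w with w | w <;> rfl

theorem glue_id_right (a : Setoid (Vert n)) : glue a (idRel n) = a := by
  rw [glue, stack_id_right]
  ext v w
  rcases v with v | v <;> rcases w with w | w <;> rfl

theorem avoid_eq_zero {X Y : Type} (s : Setoid X) (f : Y → X) (h : ∀ x, ∃ y, s (f y) x) :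
    avoid s f = 0 := by
  unfold avoid
  have : IsEmpty {q : Quotient s // ∀ y, Quotient.mk s (f y) ≠ q} := by
    refine ⟨fun ⟨q, hq⟩ => ?_⟩
    induction q using Quotient.inductionOn with | _ x
    obtain ⟨y, hy⟩ := h x
    exact hq y (Quotient.sound hy)
  exact Nat.card_of_isEmpty

theorem internal_id_left (a : Setoid (Vert n)) : internal (idRel n) a = 0 := by
  refine avoid_eq_zero _ _ ?_
  rw [stack_id_left]
  rintro ⟨i, x⟩
  fin_cases i
  · exact ⟨.inl x, Setoid.refl' a _⟩
  · exact ⟨.inl x, Setoid.refl' a _⟩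
  · exact ⟨.inr x, Setoid.refl' a _⟩

theorem internal_id_right (a : Setoid (Vert n)) : internal a (idRel n) = 0 := by
  refine avoid_eq_zero _ _ ?_
  rw [stack_id_right]
  rintro ⟨i, x⟩
  fin_cases i
  · exact ⟨.inl x, Setoid.refl' a _⟩
  · exact ⟨.inr x, Setoid.refl' a _⟩
  · exact ⟨.inr x, Setoid.refl' a _⟩

end Units

section Closure

variable {n : ℕ}

theorem circ_injective : Function.Injective (circ : Vert n → ℕ) := by
  rintro (x | x) (y | y) h <;> simp only [circ] at h <;> congr 1 <;> first | (ext; omega) | omega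

theorem even_of_matched (d : Diagram n) (D : Finset (Vert n))
    (hD : ∀ c ∈ D, ∃ c' ∈ D, c' ≠ c ∧ d.rel c c') : (D.card : ZMod 2) = 0 := by
  choose! g hg using hD
  have : ∑ _c ∈ D, (1 : ZMod 2) = 0 := by
    refine Finset.sum_involution (fun a _ => g a) (fun _ _ => by decide)
      (fun a ha _ => (hg a ha).2.1) (fun a ha => (hg a ha).1) (fun a ha => ?_)
    have h1 := hg a ha
    have h2 := hg _ h1.1
    rcases d.size_le_two (g a) a (g (g a)) (d.rel.symm h1.2.2) h2.2.2 with h | h | h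
    · exact absurd h h1.2.1
    · exact absurd h.symm h2.2.1
    · exact h.symm
  simpa using this

open Classical in
/-- Number of points of `C` in the row of `v` to the left of `v`. -/
noncomputable def leftOf (C : Set (Vert n)) : Vert n → ℕ
  | .inl k => (Finset.univ.filter fun m : Fin n => m < k ∧ Sum.inl m ∈ C).card
  | .inr k => (Finset.univ.filter fun m : Fin n => m < k ∧ Sum.inr m ∈ C).card

open Classical in
theorem leftOf_eq (C : Set (Vert n)) (hC : ((Finset.univ.filter (· ∈ C)).card : ZMod 2) = 0)
    (v : Vert n) (hv : v ∉ C) :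
    (leftOf C v : ZMod 2) = (Finset.univ.filter fun c => c ∈ C ∧ circ c < circ v).card := by
  rcases v with k | k
  · congr 1
    refine Finset.card_bij (fun m _ => Sum.inl m) ?_ ?_ ?_
    · intro m hm
      have hm' := (Finset.mem_filter.mp hm).2
      exact Finset.mem_filter.mpr ⟨Finset.mem_univ _, hm'.2, hm'.1⟩
    · intro a _ b _ h
      exact Sum.inl_injective h
    · rintro (c | c) hc
      · have hc' := (Finset.mem_filter.mp hc).2
        exact ⟨c, Finset.mem_filter.mpr ⟨Finset.mem_univ _, hc'.2, hc'.1⟩, rfl⟩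
      · have hc' := (Finset.mem_filter.mp hc).2.2
        simp only [circ] at hc'
        omega
  · have h1 : leftOf C (.inr k) =
        (Finset.univ.filter fun c => c ∈ C ∧ ¬ circ c < circ (Sum.inr k : Vert n)).card := by
      refine Finset.card_bij (fun m _ => Sum.inr m) ?_ ?_ ?_
      · intro m hm
        have hm' := (Finset.mem_filter.mp hm).2
        refine Finset.mem_filter.mpr ⟨Finset.mem_univ _, hm'.2, ?_⟩
        have := hm'.1
        simp only [circ]
        omega
      · intro a _ b _ h
        exact Sum.inr_injective h
      · rintro (c | c) hc
        · have hc' := (Finset.mem_filter.mp hc).2.2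
          simp only [circ] at hc'
          omega
        · have hc' := (Finset.mem_filter.mp hc).2
          have h0 := hc'.2
          simp only [circ] at h0
          have hne : c ≠ k := fun h => hv (h ▸ hc'.1)
          have hne' : (c : ℕ) ≠ k := fun h => hne (Fin.ext h)
          refine ⟨c, Finset.mem_filter.mpr ⟨Finset.mem_univ _, ?_, hc'.1⟩, rfl⟩
          rw [Fin.lt_def]
          omega
    have h2 := Finset.card_filter_add_card_filter_not (s := Finset.univ.filter (· ∈ C))
      (fun c => circ c < circ (Sum.inr k : Vert n))
    rw [Finset.filter_filter, Finset.filter_filter] at h2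
    rw [h1]
    have h3 := congrArg (Nat.cast : ℕ → ZMod 2) h2
    rw [hC] at h3
    push_cast at h3
    have h4 : ∀ x y : ZMod 2, x + y = 0 → y = x := by decide
    exact h4 _ _ h3

open Classical in
theorem leftOf_rel (d : Diagram n) (C : Set (Vert n))
    (hC : ∀ c ∈ C, ∃ c' ∈ C, c' ≠ c ∧ d.rel c c') (x y : Vert n) (hx : x ∉ C) (hy : y ∉ C)
    (hxy : d.rel x y) : (leftOf C x : ZMod 2) = leftOf C y := by
  have hev : ((Finset.univ.filter (· ∈ C)).card : ZMod 2) = 0 := by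
    refine even_of_matched d _ fun c hc => ?_
    obtain ⟨c', h1, h2⟩ := hC c (by simpa using hc)
    exact ⟨c', by simpa using h1, h2⟩
  rw [leftOf_eq C hev x hx, leftOf_eq C hev y hy]
  wlog hlt : circ x < circ y generalizing x y
  · rcases lt_or_eq_of_le (not_lt.mp hlt) with h | h
    · exact (this y x hy hx (d.rel.symm hxy) h).symm
    · rw [circ_injective h]
  have h1 := Finset.card_filter_add_card_filter_not
    (s := Finset.univ.filter fun c => c ∈ C ∧ circ c < circ y) (fun c => circ c < circ x)
  rw [Finset.filter_filter, Finset.filter_filter] at h1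
  have h2 : (Finset.univ.filter fun c => (c ∈ C ∧ circ c < circ y) ∧ circ c < circ x) =
      Finset.univ.filter fun c => c ∈ C ∧ circ c < circ x := by
    ext c
    simp only [Finset.mem_filter, Finset.mem_univ, true_and]
    constructor
    · exact fun h => ⟨h.1.1, h.2⟩
    · exact fun h => ⟨⟨h.1, h.2.trans hlt⟩, h.2⟩
  have h3 : ((Finset.univ.filter fun c => (c ∈ C ∧ circ c < circ y) ∧ ¬ circ c < circ x).card :
      ZMod 2) = 0 := by
    refine even_of_matched d _ fun c hc => ?_
    simp only [Finset.mem_filter, Finset.mem_univ, true_and, not_lt] at hc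
    obtain ⟨⟨hcC, hcy⟩, hcx⟩ := hc
    have hcx' : circ x < circ c :=
      lt_of_le_of_ne hcx fun h => hx (circ_injective h ▸ hcC)
    obtain ⟨c', hc', hne, hr⟩ := hC c hcC
    refine ⟨c', ?_, hne, hr⟩
    simp only [Finset.mem_filter, Finset.mem_univ, true_and, not_lt]
    refine ⟨⟨hc', ?_⟩, ?_⟩
    · by_contra hlt'
      have h5 : circ y < circ c' :=
        lt_of_le_of_ne (not_lt.mp hlt') fun h => hy (circ_injective h ▸ hc')
      have h6 := d.planar x c y c' hcx' hcy h5 hxy hr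
      rcases d.size_le_two x y c hxy h6 with h | h | h
      · exact absurd (congrArg circ h) hlt.ne
      · exact hx (h ▸ hcC)
      · exact hy (h ▸ hcC)
    · by_contra hlt'
      have h6 := d.planar c' x c y (not_le.mp hlt') hcx' hcy (d.rel.symm hr) hxy
      rcases d.size_le_two c' c x (d.rel.symm hr) h6 with h | h | h
      · exact hne h
      · exact hx (h ▸ hc')
      · exact hx (h ▸ hcC)
  rw [h2] at h1
  rw [← h1]
  push_cast
  rw [h3, add_zero]

end Closure
section Components

variable {n : ℕ}

open Classical in
/-- `1` if `v` has a partner different from itself in the upper diagram, `0` otherwise. -/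
noncomputable def partner {i j : Fin 3} (a : Diagram n) (_ : i ≠ j) (v : Fin 3 × Fin n) : ℕ :=
  if ∃ x y, row i j x = v ∧ y ≠ x ∧ a.rel x y then 1 else 0

/-- The graph on three rows of points whose edges are the strands of `a` and of `b`. -/
def strandGraph (a b : Diagram n) : SimpleGraph (Fin 3 × Fin n) where
  Adj u v := u ≠ v ∧ ((∃ x y, a.rel x y ∧ row 0 1 x = u ∧ row 0 1 y = v) ∨
    (∃ x y, b.rel x y ∧ row 1 2 x = u ∧ row 1 2 y = v))
  symm := ⟨by
    rintro u v ⟨h, ⟨x, y, h1, h2, h3⟩ | ⟨x, y, h1, h2, h3⟩⟩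
    · exact ⟨h.symm, Or.inl ⟨y, x, a.rel.symm h1, h3, h2⟩⟩
    · exact ⟨h.symm, Or.inr ⟨y, x, b.rel.symm h1, h3, h2⟩⟩⟩
  loopless := ⟨fun v h => h.1 rfl⟩

theorem stack_reachable (a b : Diagram n) {u v : Fin 3 × Fin n} (h : stack a.rel b.rel u v) :
    (strandGraph a b).Reachable u v := by
  have : stack a.rel b.rel ≤ (strandGraph a b).reachableSetoid := by
    refine sup_le ?_ ?_
    · rw [map_le_iff]
      intro x y hxy
      by_cases hne : row (ι := Fin 3) 0 1 x = row 0 1 y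
      · rw [hne]
      · exact SimpleGraph.Adj.reachable ⟨hne, Or.inl ⟨x, y, hxy, rfl, rfl⟩⟩
    · rw [map_le_iff]
      intro x y hxy
      by_cases hne : row (ι := Fin 3) 1 2 x = row 1 2 y
      · rw [hne]
      · exact SimpleGraph.Adj.reachable ⟨hne, Or.inr ⟨x, y, hxy, rfl, rfl⟩⟩
  exact this h

theorem adj_stack (a b : Diagram n) {u v : Fin 3 × Fin n} (h : (strandGraph a b).Adj u v) :
    stack a.rel b.rel u v := by
  rcases h with ⟨-, ⟨x, y, h1, rfl, rfl⟩ | ⟨x, y, h1, rfl, rfl⟩⟩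
  · exact (le_sup_left : a.rel.map (row 0 1) ≤ stack a.rel b.rel) (map_rel _ _ h1)
  · exact (le_sup_right : b.rel.map (row 1 2) ≤ stack a.rel b.rel) (map_rel _ _ h1)

theorem component_connected (a b : Diagram n) (p : Fin 3 × Fin n) :
    ((strandGraph a b).induce {v | stack a.rel b.rel p v}).Connected := by
  rw [SimpleGraph.connected_iff_exists_forall_reachable]
  refine ⟨⟨p, Setoid.refl' (stack a.rel b.rel) p⟩, ?_⟩
  rintro ⟨v, hv⟩
  obtain ⟨w⟩ := stack_reachable a b hv
  have hv' : stack a.rel b.rel p v := hv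
  have hp : stack a.rel b.rel p p := Setoid.refl' _ _
  suffices ∀ (u v : Fin 3 × Fin n) (_ : (strandGraph a b).Walk u v)
      (hu : stack a.rel b.rel p u) (hv : stack a.rel b.rel p v),
      ((strandGraph a b).induce {v | stack a.rel b.rel p v}).Reachable ⟨u, hu⟩ ⟨v, hv⟩ from
    this p v w hp hv
  intro u v w
  induction w with
  | nil => intro _ _; exact SimpleGraph.Reachable.refl _
  | cons h _ ih =>
    intro hu hv
    have hx := Setoid.trans' _ hu (adj_stack a b h)
    exact (SimpleGraph.Adj.reachable (G := (strandGraph a b).induce _)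
      (u := ⟨_, hu⟩) (v := ⟨_, hx⟩) h).trans (ih hx hv)

open Classical in
theorem partner_card {i j : Fin 3} (hij : i ≠ j) (a : Diagram n) (v : Fin 3 × Fin n) :
    (Finset.univ.filter fun u => v ≠ u ∧ ∃ x y, a.rel x y ∧ row i j x = v ∧ row i j y = u).card ≤
      partner a hij v := by
  unfold partner
  split_ifs with h
  · rw [Finset.card_le_one]
    intro u hu u' hu'
    obtain ⟨h1, x, y, h2, rfl, rfl⟩ := (Finset.mem_filter.mp hu).2
    obtain ⟨h1', x', y', h2', h3', rfl⟩ := (Finset.mem_filter.mp hu').2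
    obtain rfl := row_injective hij h3'
    rcases a.size_le_two x' y y' h2 h2' with h | h | h
    · exact absurd (congrArg _ h) h1
    · exact absurd (congrArg _ h) h1'
    · exact congrArg _ h
  · rw [Nat.le_zero, Finset.card_eq_zero, Finset.filter_eq_empty_iff]
    rintro u - ⟨h1, x, y, h2, rfl, rfl⟩
    exact h ⟨x, y, rfl, fun h' => h1 (congrArg _ h'.symm), h2⟩

open Classical in
theorem component_count (a b : Diagram n) (p : Fin 3 × Fin n) :
    ∑ v ∈ Finset.univ.filter (fun v => stack a.rel b.rel p v),
      (2 - (partner a (zero_ne_one (α := Fin 3)) v +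
        partner b (by decide : (1 : Fin 3) ≠ 2) v)) ≤ 2 := by
  set α := partner a (zero_ne_one (α := Fin 3))
  set β := partner b (by decide : (1 : Fin 3) ≠ 2)
  set G := (strandGraph a b).induce {v | stack a.rel b.rel p v} with hG
  have h1 : Nat.card {v | stack a.rel b.rel p v} ≤ Nat.card G.edgeSet + 1 :=
    (component_connected a b p).card_vert_le_card_edgeSet_add_one
  have h2 := G.sum_degrees_eq_twice_card_edges
  have h3 : ∀ v : {v | stack a.rel b.rel p v}, G.degree v ≤ α v + β v := by
    intro v
    refine le_trans ?_ (add_le_add (partner_card _ a v) (partner_card _ b v))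
    refine le_trans ?_ (Finset.card_union_le _ _)
    rw [← SimpleGraph.card_neighborFinset_eq_degree]
    refine Finset.card_le_card_of_injOn Subtype.val ?_ Subtype.val_injective.injOn
    intro u hu
    have hu' : (strandGraph a b).Adj v u := by
      simpa [hG] using hu
    rcases hu' with ⟨h, h' | h'⟩
    · exact Finset.mem_coe.mpr (Finset.mem_union_left _
        (Finset.mem_filter.mpr ⟨Finset.mem_univ _, h, h'⟩))
    · exact Finset.mem_coe.mpr (Finset.mem_union_right _
        (Finset.mem_filter.mpr ⟨Finset.mem_univ _, h, h'⟩))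
  have h4 : ∀ v, α v + β v ≤ 2 := by
    intro v
    have ha : α v ≤ 1 := by
      simp only [α, partner]; split_ifs <;> simp
    have hb : β v ≤ 1 := by
      simp only [β, partner]; split_ifs <;> simp
    omega
  have h5 : ∑ v ∈ Finset.univ.filter (fun v => stack a.rel b.rel p v), (2 - (α v + β v)) =
      ∑ v : {v | stack a.rel b.rel p v}, (2 - (α v + β v)) := by
    exact Finset.sum_subtype _ (fun v => by simp) _
  rw [h5]
  have h6 : ∑ v : {v | stack a.rel b.rel p v}, (2 - (α v + β v)) +
      ∑ v : {v | stack a.rel b.rel p v}, (α v + β v) =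
        2 * Fintype.card {v | stack a.rel b.rel p v} := by
    rw [← Finset.sum_add_distrib, Finset.sum_congr rfl (g := fun _ => 2)]
    · simp [mul_comm]
    · intro v _
      have := h4 v
      omega
  have h7 := Finset.sum_le_sum (s := Finset.univ) fun v _ => h3 v
  rw [h2] at h7
  rw [Nat.card_eq_fintype_card, Nat.card_eq_fintype_card] at h1
  have h8 : Fintype.card G.edgeSet = G.edgeFinset.card := by
    rw [SimpleGraph.edgeFinset_card]
  omega

theorem partner_outer_top (b : Diagram n) (x : Fin n) :
    partner b (by decide : (1 : Fin 3) ≠ 2) (row 0 2 (.inl x)) = 0 := by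
  unfold partner
  rw [if_neg]
  rintro ⟨y | y, z, h, -⟩ <;> simp [row] at h

theorem partner_outer_bot (a : Diagram n) (x : Fin n) :
    partner a (zero_ne_one (α := Fin 3)) (row 0 2 (.inr x)) = 0 := by
  unfold partner
  rw [if_neg]
  rintro ⟨y | y, z, h, -⟩ <;> simp [row] at h

theorem partner_le_one {i j : Fin 3} (hij : i ≠ j) (a : Diagram n) (v : Fin 3 × Fin n) :
    partner a hij v ≤ 1 := by
  unfold partner
  split_ifs <;> simp

/-- The number of missing strands at a point. -/
noncomputable def defect (a b : Diagram n) (v : Fin 3 × Fin n) : ℕ :=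
  2 - (partner a (zero_ne_one (α := Fin 3)) v + partner b (by decide : (1 : Fin 3) ≠ 2) v)

theorem one_le_defect (a b : Diagram n) (x : Vert n) : 1 ≤ defect a b (row 0 2 x) := by
  unfold defect
  rcases x with x | x
  · rw [partner_outer_top b]
    have := partner_le_one (zero_ne_one (α := Fin 3)) a (row 0 2 (.inl x))
    omega
  · rw [partner_outer_bot a]
    have := partner_le_one (by decide : (1 : Fin 3) ≠ 2) b (row 0 2 (.inr x))
    omega

open Classical in
theorem defect_sum (a b : Diagram n) (p : Fin 3 × Fin n) (D : Finset (Fin 3 × Fin n))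
    (hD : ∀ v ∈ D, stack a.rel b.rel p v) : ∑ v ∈ D, defect a b v ≤ 2 := by
  refine le_trans ?_ (component_count a b p)
  refine Finset.sum_le_sum_of_subset fun v hv => ?_
  exact Finset.mem_filter.mpr ⟨Finset.mem_univ _, hD v hv⟩

theorem glue_size (a b : Diagram n) (x y z : Vert n) (hxy : glue a.rel b.rel x y)
    (hxz : glue a.rel b.rel x z) : x = y ∨ x = z ∨ y = z := by
  classical
  by_contra! h
  obtain ⟨h1, h2, h3⟩ := h
  have hinj := row_injective (n := n) (by decide : (0 : Fin 3) ≠ 2)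
  have := defect_sum a b (row 0 2 x) {row 0 2 x, row 0 2 y, row 0 2 z} (by
    intro v hv
    simp only [Finset.mem_insert, Finset.mem_singleton] at hv
    rcases hv with rfl | rfl | rfl
    · exact Setoid.refl' _ _
    · exact hxy
    · exact hxz)
  rw [Finset.sum_insert (by simp [hinj.eq_iff, h1, h2]),
    Finset.sum_insert (by simp [hinj.eq_iff, h3]), Finset.sum_singleton] at this
  have h4 := one_le_defect a b x
  have h5 := one_le_defect a b y
  have h6 := one_le_defect a b z
  omega

theorem defect_eq (a b : Diagram n) {x z : Vert n} (hne : x ≠ z) (hxz : glue a.rel b.rel x z)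
    (v : Fin 3 × Fin n) (hv : stack a.rel b.rel (row 0 2 x) v) :
    (v.1 = 1 → defect a b v = 0) ∧ defect a b v ≤ 1 := by
  classical
  have hinj := row_injective (n := n) (by decide : (0 : Fin 3) ≠ 2)
  have h4 := one_le_defect a b x
  have h5 := one_le_defect a b z
  by_cases hvx : v = row 0 2 x ∨ v = row 0 2 z
  · have := defect_sum a b (row 0 2 x) {row 0 2 x, row 0 2 z} (by
      intro v hv
      simp only [Finset.mem_insert, Finset.mem_singleton] at hv
      rcases hv with rfl | rfl
      · exact Setoid.refl' _ _
      · exact hxz)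
    rw [Finset.sum_insert (by simp [hinj.eq_iff, hne]), Finset.sum_singleton] at this
    rcases hvx with rfl | rfl
    · refine ⟨?_, by omega⟩
      rcases x with x | x <;> simp [row]
    · refine ⟨?_, by omega⟩
      rcases z with x | x <;> simp [row]
  · push Not at hvx
    have := defect_sum a b (row 0 2 x) {row 0 2 x, row 0 2 z, v} (by
      intro v hv
      simp only [Finset.mem_insert, Finset.mem_singleton] at hv
      rcases hv with rfl | rfl | rfl
      · exact Setoid.refl' _ _
      · exact hxz
      · exact hv)
    rw [Finset.sum_insert (by simp [hinj.eq_iff, hne, hvx.1.symm]),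
      Finset.sum_insert (by simp [hvx.2.symm]), Finset.sum_singleton] at this
    exact ⟨fun _ => by omega, by omega⟩

theorem matched_top (a b : Diagram n) {x z : Vert n} (hne : x ≠ z)
    (hxz : glue a.rel b.rel x z) (v : Vert n) (hv : stack a.rel b.rel (row 0 2 x) (row 0 1 v)) :
    ∃ w, w ≠ v ∧ a.rel v w := by
  obtain ⟨h1, h2⟩ := defect_eq a b hne hxz _ hv
  have h3 : partner a (zero_ne_one (α := Fin 3)) (row 0 1 v) ≠ 0 := by
    have hb := partner_le_one (by decide : (1 : Fin 3) ≠ 2) b (row 0 1 v)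
    unfold defect at h1 h2
    rcases v with v | v
    · have h4 := partner_outer_top b v
      have h5 : (row 0 2 (Sum.inl v) : Fin 3 × Fin n) = row 0 1 (Sum.inl v) := rfl
      rw [h5] at h4
      omega
    · have := h1 rfl
      omega
  unfold partner at h3
  split_ifs at h3 with h
  · obtain ⟨v', w, h4, h5, h6⟩ := h
    obtain rfl := row_injective (zero_ne_one (α := Fin 3)) h4
    exact ⟨w, h5, h6⟩
  · exact absurd rfl h3

theorem matched_bot (a b : Diagram n) {x z : Vert n} (hne : x ≠ z)
    (hxz : glue a.rel b.rel x z) (v : Vert n) (hv : stack a.rel b.rel (row 0 2 x) (row 1 2 v)) :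
    ∃ w, w ≠ v ∧ b.rel v w := by
  obtain ⟨h1, h2⟩ := defect_eq a b hne hxz _ hv
  have h3 : partner b (by decide : (1 : Fin 3) ≠ 2) (row 1 2 v) ≠ 0 := by
    have ha := partner_le_one (zero_ne_one (α := Fin 3)) a (row 1 2 v)
    unfold defect at h1 h2
    rcases v with v | v
    · have := h1 rfl
      omega
    · have h4 := partner_outer_bot a v
      have h5 : (row 0 2 (Sum.inr v) : Fin 3 × Fin n) = row 1 2 (Sum.inr v) := rfl
      rw [h5] at h4
      omega
  unfold partner at h3
  split_ifs at h3 with h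
  · obtain ⟨v', w, h4, h5, h6⟩ := h
    obtain rfl := row_injective (by decide : (1 : Fin 3) ≠ 2) h4
    exact ⟨w, h5, h6⟩
  · exact absurd rfl h3

open Classical in
/-- Number of points of `C` in the row of `v` to the left of `v`. -/
noncomputable def leftOf3 (C : Set (Fin 3 × Fin n)) (v : Fin 3 × Fin n) : ℕ :=
  (Finset.univ.filter fun m : Fin n => m < v.2 ∧ (v.1, m) ∈ C).card

theorem leftOf3_row (C : Set (Fin 3 × Fin n)) (i j : Fin 3) (v : Vert n) :
    leftOf3 C (row i j v) = leftOf (row i j ⁻¹' C) v := by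
  rcases v with v | v <;> rfl

theorem glue_planar (a b : Diagram n) (x y z w : Vert n) (hxy : circ x < circ y)
    (hyz : circ y < circ z) (hzw : circ z < circ w) (hxz : glue a.rel b.rel x z)
    (hyw : glue a.rel b.rel y w) : glue a.rel b.rel x y := by
  classical
  by_contra hcon
  have hne : x ≠ z := fun h => by rw [h] at hxy; omega
  set C : Set (Fin 3 × Fin n) := {v | stack a.rel b.rel (row 0 2 x) v} with hC
  have hstep : ∀ u v, stack a.rel b.rel u v → (u ∈ C ↔ v ∈ C) := fun u v h =>
    ⟨fun h1 => Setoid.trans' _ h1 h, fun h1 => Setoid.trans' _ h1 (Setoid.symm' _ h)⟩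
  let ω : Setoid (Fin 3 × Fin n) :=
    { r := fun u v => (u ∈ C ↔ v ∈ C) ∧
        (u ∉ C → (leftOf3 C u : ZMod 2) = leftOf3 C v)
      iseqv :=
        { refl := fun _ => ⟨Iff.rfl, fun _ => rfl⟩
          symm := fun h => ⟨h.1.symm, fun hv => (h.2 fun hu => hv (h.1.mp hu)).symm⟩
          trans := fun h h' => ⟨h.1.trans h'.1, fun hu => (h.2 hu).trans
            (h'.2 fun hv => hu (h.1.mpr hv))⟩ } }
  have hω : stack a.rel b.rel ≤ ω := by
    refine sup_le ?_ ?_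
    · rw [map_le_iff]
      intro u v huv
      have hst : ∀ u v, a.rel u v → stack a.rel b.rel (row 0 1 u) (row 0 1 v) := fun u v h =>
        (le_sup_left : a.rel.map (row 0 1) ≤ stack a.rel b.rel) (map_rel _ _ h)
      refine ⟨hstep _ _ (hst u v huv), fun hu => ?_⟩
      rw [leftOf3_row, leftOf3_row]
      refine leftOf_rel a _ ?_ u v hu (fun hv => hu ((hstep _ _ (hst u v huv)).mpr hv)) huv
      intro c hc
      obtain ⟨c', h1, h2⟩ := matched_top a b hne hxz c hc
      exact ⟨c', (hstep _ _ (hst c c' h2)).mp hc, h1, h2⟩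
    · rw [map_le_iff]
      intro u v huv
      have hst : ∀ u v, b.rel u v → stack a.rel b.rel (row 1 2 u) (row 1 2 v) := fun u v h =>
        (le_sup_right : b.rel.map (row 1 2) ≤ stack a.rel b.rel) (map_rel _ _ h)
      refine ⟨hstep _ _ (hst u v huv), fun hu => ?_⟩
      rw [leftOf3_row, leftOf3_row]
      refine leftOf_rel b _ ?_ u v hu (fun hv => hu ((hstep _ _ (hst u v huv)).mpr hv)) huv
      intro c hc
      obtain ⟨c', h1, h2⟩ := matched_bot a b hne hxz c hc
      exact ⟨c', (hstep _ _ (hst c c' h2)).mp hc, h1, h2⟩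
  have hy : y ∉ row 0 2 ⁻¹' C := hcon
  have hw : w ∉ row 0 2 ⁻¹' C := fun h => hcon (Setoid.trans' _ h (Setoid.symm' _ hyw))
  have hmem : ∀ c, c ∈ (row 0 2 ⁻¹' C : Set (Vert n)) ↔ c = x ∨ c = z := by
    intro c
    constructor
    · intro hc
      rcases glue_size a b x c z hc hxz with h | h | h
      · exact Or.inl h.symm
      · exact absurd h hne
      · exact Or.inr h
    · rintro (rfl | rfl)
      · exact Setoid.refl' (stack a.rel b.rel) _
      · exact hxz
  have hkey := (hω hyw).2 hy
  rw [leftOf3_row, leftOf3_row] at hkey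
  have hcard : (Finset.univ.filter (· ∈ (row 0 2 ⁻¹' C : Set (Vert n)))) = {x, z} := by
    ext c
    rw [Finset.mem_filter, hmem]
    simp
  have hev : ((Finset.univ.filter (· ∈ (row 0 2 ⁻¹' C : Set (Vert n)))).card : ZMod 2) = 0 := by
    rw [hcard, Finset.card_pair hne]
    rfl
  rw [leftOf_eq _ hev y hy, leftOf_eq _ hev w hw] at hkey
  have h1 : (Finset.univ.filter fun c => c ∈ (row 0 2 ⁻¹' C : Set (Vert n)) ∧
      circ c < circ y) = {x} := by
    ext c
    rw [Finset.mem_filter, hmem, Finset.mem_singleton]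
    constructor
    · rintro ⟨-, rfl | rfl, h⟩
      · rfl
      · omega
    · rintro rfl
      exact ⟨Finset.mem_univ _, Or.inl rfl, hxy⟩
  have h2 : (Finset.univ.filter fun c => c ∈ (row 0 2 ⁻¹' C : Set (Vert n)) ∧
      circ c < circ w) = {x, z} := by
    ext c
    rw [Finset.mem_filter, hmem, Finset.mem_insert, Finset.mem_singleton]
    constructor
    · exact fun h => h.2.1
    · intro h
      refine ⟨Finset.mem_univ _, h, ?_⟩
      rcases h with rfl | rfl <;> omega
  rw [h1, h2, Finset.card_singleton, Finset.card_pair hne] at hkey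
  exact absurd hkey (by decide)

end Components
/-! ### The (cyclic) Motzkin monoids -/

section Monoids

variable {n : ℕ}

theorem Diagram.rel_injective {a b : Diagram n} (h : a.rel = b.rel) : a = b := by
  cases a; cases b; cases h; rfl

/-- The identity diagram: `n` vertical strands. -/
instance : One (Diagram n) where
  one :=
    { rel := idRel n
      size_le_two := by
        rintro (x | x) (y | y) (z | z) h h' <;> obtain rfl : x = y := h <;>
          obtain rfl : x = z := h' <;> simp
      planar := by
        rintro (x | x) (y | y) (z | z) (w | w) h1 h2 h3 h4 h5 <;> obtain rfl : x = z := h4 <;>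
          obtain rfl : y = w := h5 <;> simp only [circ] at h1 h2 h3 <;> omega }

/-- Concatenation, `a` on top of `b`, with all internal components removed. -/
instance : Mul (Diagram n) where
  mul a b :=
    { rel := glue a.rel b.rel
      size_le_two := glue_size a b
      planar := glue_planar a b }

theorem Diagram.mul_rel (a b : Diagram n) : (a * b).rel = glue a.rel b.rel := rfl

theorem Diagram.one_rel : (1 : Diagram n).rel = idRel n := rfl

/-- The Motzkin monoid `Mo_n`. -/
instance : Monoid (Diagram n) where
  mul_assoc a b c := Diagram.rel_injective (glue_assoc a.rel b.rel c.rel)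
  one_mul a := Diagram.rel_injective (glue_id_left a.rel)
  mul_one a := Diagram.rel_injective (glue_id_right a.rel)

/-- Reflection of a diagram in the horizontal middle line. -/
def Diagram.flip (a : Diagram n) : Diagram n where
  rel := a.rel.comap Sum.swap
  size_le_two x y z h h' := by
    rcases a.size_le_two _ _ _ h h' with h | h | h
    · exact Or.inl (Sum.swap_leftInverse.injective h)
    · exact Or.inr (Or.inl (Sum.swap_leftInverse.injective h))
    · exact Or.inr (Or.inr (Sum.swap_leftInverse.injective h))
  planar x y z w h1 h2 h3 h4 h5 := by
    have hc : ∀ v : Vert n, circ v.swap = 2 * n - 1 - circ v ∧ circ v < 2 * n := by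
      rintro (v | v)
      · change 2 * n - 1 - (v : ℕ) = 2 * n - 1 - (v : ℕ) ∧ (v : ℕ) < 2 * n
        omega
      · change (v : ℕ) = 2 * n - 1 - (2 * n - 1 - (v : ℕ)) ∧ 2 * n - 1 - (v : ℕ) < 2 * n
        omega
    have hx := hc x
    have hy := hc y
    have hz := hc z
    have hw := hc w
    have := a.planar w.swap z.swap y.swap x.swap (by omega) (by omega) (by omega)
      (a.rel.symm h5) (a.rel.symm h4)
    exact a.rel.trans (a.rel.trans h4 (a.rel.symm this)) (a.rel.symm h5)

/-- The number of through strands. -/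
noncomputable def Diagram.through (a : Diagram n) : ℕ :=
  Nat.card {i : Fin n // ∃ j, a.rel (.inl i) (.inr j)}

theorem Diagram.through_mul_le (a b : Diagram n) : (a * b).through ≤ a.through := by
  refine Nat.card_le_card_of_injective
    (fun i : {i : Fin n // ∃ j, (a * b).rel (.inl i) (.inr j)} => (⟨i.1, ?_⟩ :
      {i : Fin n // ∃ j, a.rel (.inl i) (.inr j)})) ?_
  · obtain ⟨i, j, hij⟩ := i
    by_contra! hcon
    let ω : Setoid (Fin 3 × Fin n) := Setoid.ker fun v => ∃ k, v = (0, k) ∧ a.rel (.inl i) (.inl k)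
    have hω : stack a.rel b.rel ≤ ω := by
      refine sup_le ?_ ?_
      · rw [map_le_iff]
        have key : ∀ x y, a.rel x y →
            (∃ k, (row 0 1 x : Fin 3 × Fin n) = (0, k) ∧ a.rel (.inl i) (.inl k)) →
            ∃ k, (row 0 1 y : Fin 3 × Fin n) = (0, k) ∧ a.rel (.inl i) (.inl k) := by
          rintro (x | x) (y | y) hxy ⟨k, h1, h2⟩
          · obtain rfl : x = k := congrArg Prod.snd h1
            exact ⟨y, rfl, a.rel.trans h2 hxy⟩
          · obtain rfl : x = k := congrArg Prod.snd h1
            exact absurd (a.rel.trans h2 hxy) (hcon y)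
          · exact absurd (congrArg Prod.fst h1) (by simp [row])
          · exact absurd (congrArg Prod.fst h1) (by simp [row])
        intro x y hxy
        exact propext ⟨key x y hxy, key y x (a.rel.symm hxy)⟩
      · rw [map_le_iff]
        have key : ∀ x, ¬ ∃ k, (row 1 2 x : Fin 3 × Fin n) = (0, k) ∧ a.rel (.inl i) (.inl k) := by
          rintro (x | x) ⟨k, h1, -⟩ <;> exact absurd (congrArg Prod.fst h1) (by simp [row])
        intro x y _
        exact propext ⟨fun h => absurd h (key x), fun h => absurd h (key y)⟩
    have h : (∃ k, ((0, i) : Fin 3 × Fin n) = (0, k) ∧ a.rel (.inl i) (.inl k)) =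
      ∃ k, ((2, j) : Fin 3 × Fin n) = (0, k) ∧ a.rel (.inl i) (.inl k) := hω hij
    obtain ⟨k, h1, -⟩ := h.mp ⟨i, rfl, a.rel.refl _⟩
    exact absurd (congrArg Prod.fst h1) (by simp)
  · intro i i' h
    simpa [Subtype.ext_iff] using h

/-- Motzkin diagrams (`skeleton`) together with a number of internal components with values
in `R`. -/
@[ext] structure CDiagram (R : Type) (n : ℕ) where
  skeleton : Diagram n
  count : R

variable {R : Type} [AddCommMonoidWithOne R]

instance : One (CDiagram R n) := ⟨⟨1, 0⟩⟩

/-- Concatenation: the internal components of the factors and those which are created by the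
concatenation are all counted. -/
noncomputable instance : Mul (CDiagram R n) where
  mul a b := ⟨a.skeleton * b.skeleton,
    a.count + b.count + (internal a.skeleton.rel b.skeleton.rel : R)⟩

theorem CDiagram.mul_skeleton (a b : CDiagram R n) :
    (a * b).skeleton = a.skeleton * b.skeleton := rfl

theorem CDiagram.mul_count (a b : CDiagram R n) : (a * b).count =
    a.count + b.count + (internal a.skeleton.rel b.skeleton.rel : R) := rfl

theorem CDiagram.one_skeleton : (1 : CDiagram R n).skeleton = 1 := rfl

theorem CDiagram.one_count : (1 : CDiagram R n).count = 0 := rfl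

noncomputable instance : Monoid (CDiagram R n) where
  mul_assoc a b c := by
    ext1
    · simp only [CDiagram.mul_skeleton, mul_assoc]
    · have h := congrArg (Nat.cast : ℕ → R)
        (internal_cocycle a.skeleton.rel b.skeleton.rel c.skeleton.rel)
      push_cast at h
      simp only [CDiagram.mul_skeleton, CDiagram.mul_count, Diagram.mul_rel]
      calc a.count + b.count + (internal a.skeleton.rel b.skeleton.rel : R) + c.count +
            (internal (glue a.skeleton.rel b.skeleton.rel) c.skeleton.rel : R)
          = a.count + b.count + c.count + ((internal a.skeleton.rel b.skeleton.rel : R) +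
            (internal (glue a.skeleton.rel b.skeleton.rel) c.skeleton.rel : R)) := by abel
        _ = _ := by rw [h]; abel
  one_mul a := by
    ext1
    · simp only [CDiagram.mul_skeleton, CDiagram.one_skeleton, one_mul]
    · simp only [CDiagram.mul_count, CDiagram.one_skeleton, CDiagram.one_count, Diagram.one_rel,
        internal_id_left, Nat.cast_zero, add_zero, zero_add]
  mul_one a := by
    ext1
    · simp only [CDiagram.mul_skeleton, CDiagram.one_skeleton, mul_one]
    · simp only [CDiagram.mul_count, CDiagram.one_skeleton, CDiagram.one_count, Diagram.one_rel,
        internal_id_right, Nat.cast_zero, add_zero]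

/-- The diagrammatic anti-involution: reflection in the horizontal middle line. -/
def CDiagram.flip (a : CDiagram R n) : CDiagram R n := ⟨a.skeleton.flip, a.count⟩

/-- The number of through strands. -/
noncomputable def CDiagram.through (a : CDiagram R n) : ℕ := a.skeleton.through

/-- The `m`-cyclic Motzkin monoid `mMo_n`: internal components are counted modulo `m`. -/
abbrev CyclicMotzkin (m n : ℕ) : Type := CDiagram (ZMod m) n

/-- The truncation of `mMo_n` to at most `k` through strands. -/
noncomputable def truncation (m n k : ℕ) : Submonoid (CyclicMotzkin m n) where
  carrier := {x | x = 1 ∨ x.through ≤ k}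
  one_mem' := Or.inl rfl
  mul_mem' := by
    rintro x y (rfl | hx) hy
    · rwa [one_mul]
    · exact Or.inr ((Diagram.through_mul_le x.skeleton y.skeleton).trans hx)

end Monoids

/-! ### Green's relations -/

section Green

variable {S : Type} [Monoid S]

def leL (a b : S) : Prop := ∃ c, b = c * a

def leR (a b : S) : Prop := ∃ c, b = a * c

def leJ (a b : S) : Prop := ∃ c d, b = c * a * d

def simL (a b : S) : Prop := leL a b ∧ leL b a

def simR (a b : S) : Prop := leR a b ∧ leR b a

def simJ (a b : S) : Prop := leJ a b ∧ leJ b a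

/-- Two elements lie in the same `H`-cell. -/
def simH (a b : S) : Prop := simL a b ∧ simR a b

theorem leL_trans {a b c : S} (h : leL a b) (h' : leL b c) : leL a c := by
  obtain ⟨x, rfl⟩ := h
  obtain ⟨y, rfl⟩ := h'
  exact ⟨y * x, (mul_assoc _ _ _).symm⟩

theorem leL_mul (a b : S) : leL b (a * b) := ⟨a, rfl⟩

theorem simL_refl (a : S) : simL a a := ⟨⟨1, (one_mul a).symm⟩, ⟨1, (one_mul a).symm⟩⟩

theorem simR_refl (a : S) : simR a a := ⟨⟨1, (mul_one a).symm⟩, ⟨1, (mul_one a).symm⟩⟩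

variable (S) in
/-- The underlying type of `S` with the two-sided cell order as preorder. -/
def JOrder : Type := S

theorem leJ_refl (a : S) : leJ a a := ⟨1, 1, by rw [one_mul, mul_one]⟩

theorem leJ_trans {a b c : S} (h : leJ a b) (h' : leJ b c) : leJ a c := by
  obtain ⟨x, y, rfl⟩ := h
  obtain ⟨z, w, rfl⟩ := h'
  exact ⟨z * x, y * w, by simp only [mul_assoc]⟩

instance : Preorder (JOrder S) where
  le := leJ (S := S)
  le_refl := leJ_refl (S := S)
  le_trans _ _ _ := leJ_trans (S := S)

variable (S) in
/-- The poset of `J`-cells. -/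
abbrev JCell : Type := Antisymmetrization (JOrder S) (· ≤ ·)

/-- The `J`-cell of an element. -/
def jcell (a : S) : JCell S := toAntisymmetrization (α := JOrder S) (· ≤ ·) a

/-- The left cell of `x`. -/
abbrev LCell (x : S) : Type := {y : S // simL y x}

/-- The right cell of `x`. -/
abbrev RCell (x : S) : Type := {y : S // simR y x}

variable (S) in
/-- The idempotents of `S`. -/
abbrev Idem : Type := {e : S // IsIdempotentElem e}

/-- The `H`-cell `H(e)` of an idempotent. -/
abbrev HCell (e : Idem S) : Type := {y : S // simH y e.1}

theorem HCell.mul_left {e : Idem S} (h : HCell e) : e.1 * h.1 = h.1 := by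
  obtain ⟨c, hc⟩ := h.2.2.2
  rw [hc, ← mul_assoc, e.2]

theorem HCell.mul_right {e : Idem S} (h : HCell e) : h.1 * e.1 = h.1 := by
  obtain ⟨c, hc⟩ := h.2.1.2
  rw [hc, mul_assoc, e.2]

theorem LCell.mul_right {e : Idem S} (l : LCell e.1) : l.1 * e.1 = l.1 := by
  obtain ⟨c, hc⟩ := l.2.2
  rw [hc, mul_assoc, e.2]

theorem RCell.mul_left {e : Idem S} (l : RCell e.1) : e.1 * l.1 = l.1 := by
  obtain ⟨c, hc⟩ := l.2.2
  rw [hc, ← mul_assoc, e.2]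

theorem simL_mul {e : Idem S} {l : S} (hl : simL l e.1) (h : HCell e) : simL (l * h.1) e.1 := by
  obtain ⟨⟨c, hc⟩, -⟩ := hl
  obtain ⟨⟨c', hc'⟩, ⟨d, hd⟩⟩ := h.2.1
  refine ⟨⟨c' * c, ?_⟩, ⟨l * d, ?_⟩⟩
  · rw [mul_assoc, ← mul_assoc c, ← hc, h.mul_left, ← hc']
  · rw [mul_assoc, ← hd]

theorem simR_mul {e : Idem S} {r : S} (hr : simR r e.1) (h : HCell e) : simR (h.1 * r) e.1 := by
  obtain ⟨⟨c, hc⟩, -⟩ := hr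
  obtain ⟨⟨c', hc'⟩, ⟨d, hd⟩⟩ := h.2.2
  refine ⟨⟨c * c', ?_⟩, ⟨d * r, ?_⟩⟩
  · rw [mul_assoc, ← mul_assoc r, ← hc, ← mul_assoc, h.mul_right, ← hc']
  · rw [← mul_assoc, ← hd]

instance (e : Idem S) : Monoid (HCell e) where
  mul x y := ⟨x.1 * y.1, simL_mul x.2.1 y, simR_mul y.2.2 x⟩
  one := ⟨e.1, simL_refl _, simR_refl _⟩
  mul_assoc x y z := Subtype.ext (mul_assoc x.1 y.1 z.1)
  one_mul x := Subtype.ext x.mul_left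
  mul_one x := Subtype.ext x.mul_right

theorem HCell.coe_mul {e : Idem S} (x y : HCell e) : ((x * y : HCell e) : S) = x.1 * y.1 := rfl

/-- Right multiplication by `H(e)` preserves membership of `s * l` in the left cell of `e`. -/
theorem simL_mul_iff {e : Idem S} (s : S) (l : LCell e.1) (h : HCell e) :
    simL (s * (l.1 * h.1)) e.1 ↔ simL (s * l.1) e.1 := by
  constructor
  · rintro ⟨⟨c, hc⟩, -⟩
    obtain ⟨⟨d, hd⟩, -⟩ := h.2.2
    have h1 : c * (s * l.1) = e.1 * d := by
      calc c * (s * l.1) = c * (s * (l.1 * e.1)) := by rw [l.mul_right]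
        _ = c * (s * (l.1 * (h.1 * d))) := congrArg (fun z => c * (s * (l.1 * z))) hd
        _ = c * (s * (l.1 * h.1)) * d := by simp only [mul_assoc]
        _ = e.1 * d := by rw [← hc]
    refine ⟨⟨h.1 * c, ?_⟩, ⟨s * l.1, ?_⟩⟩
    · rw [mul_assoc, h1, ← mul_assoc, h.mul_right, ← hd]
    · rw [mul_assoc, l.mul_right]
  · intro hs
    rw [← mul_assoc]
    exact simL_mul hs h

end Green
/-! ### Representations -/

section Representations

open scoped TensorProduct Classical

variable (K : Type u) [Field K]

section

variable {S : Type} [Monoid S]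

/-- The Schützenberger representation `Δ_L = K L` of the left cell `L` of `x`: `s • l` is `s l` if
this is in `L`, and `0` otherwise. -/
noncomputable def schutz (x : S) : Representation K S (LCell x →₀ K) where
  toFun s := Finsupp.linearCombination K fun l : LCell x =>
    if h : simL (s * l.1) x then Finsupp.single ⟨s * l.1, h⟩ 1 else 0
  map_one' := by
    ext1 l
    ext1
    simp only [LinearMap.comp_apply, Finsupp.lsingle_apply, Finsupp.linearCombination_single,
      one_smul, one_mul, l.2, dif_pos, Module.End.one_apply]
  map_mul' s t := by
    ext1 l
    ext1
    simp only [LinearMap.comp_apply, Finsupp.lsingle_apply, Finsupp.linearCombination_single,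
      one_smul, Module.End.mul_apply]
    by_cases h : simL (t * l.1) x
    · rw [dif_pos h, Finsupp.linearCombination_single, one_smul]
      simp only [mul_assoc]
    · rw [dif_neg h, map_zero, dif_neg]
      intro h'
      rw [mul_assoc] at h'
      exact h ⟨leL_trans (leL_mul s (t * l.1)) h'.1, leL_trans l.2.2 (leL_mul t l.1)⟩

variable {e : Idem S}

/-- Right multiplication with an element of `H(e)` on `Δ_L`, where `L` is the left cell of `e`. -/
noncomputable def rightMul (h : HCell e) : (LCell e.1 →₀ K) →ₗ[K] (LCell e.1 →₀ K) :=
  Finsupp.lmapDomain K K fun l => ⟨l.1 * h.1, simL_mul l.2 h⟩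

theorem schutz_rightMul (s : S) (h : HCell e) (d : LCell e.1 →₀ K) :
    schutz K e.1 s (rightMul K h d) = rightMul K h (schutz K e.1 s d) := by
  have : (schutz K e.1 s) ∘ₗ (rightMul K h) = (rightMul K h) ∘ₗ (schutz K e.1 s) := by
    ext1 l
    ext1
    simp only [LinearMap.comp_apply, Finsupp.lsingle_apply, rightMul, schutz, MonoidHom.coe_mk,
      OneHom.coe_mk, Finsupp.lmapDomain_apply, Finsupp.mapDomain_single,
      Finsupp.linearCombination_single, one_smul]
    by_cases hl : simL (s * l.1) e.1
    · rw [dif_pos hl, dif_pos ((simL_mul_iff s l h).mpr hl), Finsupp.mapDomain_single]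
      simp only [mul_assoc]
    · rw [dif_neg hl, dif_neg (fun h' => hl ((simL_mul_iff s l h).mp h')), Finsupp.mapDomain_zero]
  exact LinearMap.congr_fun this d

/-- The space `Δ_L = K L` with its structure of an abelian group and a `K`-module. -/
def Delta (x : S) : Type u := LCell x →₀ K

noncomputable instance (x : S) : AddCommGroup (Delta K x) :=
  inferInstanceAs (AddCommGroup (LCell x →₀ K))

noncomputable instance (x : S) : Module K (Delta K x) :=
  inferInstanceAs (Module K (LCell x →₀ K))

/-- The left action on `Δ_L`. -/
noncomputable def deltaLeft (x : S) : Representation K S (Delta K x) := schutz K x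

/-- The right action on `Δ_L`. -/
noncomputable def deltaRight (h : HCell e) : Delta K e.1 →ₗ[K] Delta K e.1 := rightMul K h

theorem deltaLeft_deltaRight (s : S) (h : HCell e) (d : Delta K e.1) :
    deltaLeft K e.1 s (deltaRight K h d) = deltaRight K h (deltaLeft K e.1 s d) :=
  schutz_rightMul K s h d

variable {G : Type} [Monoid G] {W : Type u} [AddCommGroup W] [Module K W]

/-- The relations `d h ⊗ w = d ⊗ h w` defining the tensor product over `H(e)`; here `H(e)` is
identified with `G` through `φ`. -/
noncomputable def indRel (φ : G ≃* HCell e) (σ : Representation K G W) :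
    Submodule K (Delta K e.1 ⊗[K] W) :=
  Submodule.span K {t | ∃ d g w, t = deltaRight K (φ g) d ⊗ₜ[K] w - d ⊗ₜ[K] σ g w}

/-- The induced representation `Δ_L ⊗_{H(e)} W` of `S`. -/
noncomputable def ind (φ : G ≃* HCell e) (σ : Representation K G W) :
    Representation K S ((Delta K e.1 ⊗[K] W) ⧸ indRel K φ σ) :=
  ((deltaLeft K e.1).tprod (Representation.trivial K S W)).quotient (indRel K φ σ) (by
    intro s
    refine Submodule.span_le.mpr ?_
    rintro _ ⟨d, g, w, rfl⟩
    refine Submodule.subset_span ⟨deltaLeft K e.1 s d, g, w, ?_⟩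
    simp [deltaLeft_deltaRight])

/-- The head of a module: the quotient by its radical. -/
abbrev Head (A : Type*) [Ring A] (M : Type*) [AddCommGroup M] [Module A M] : Type _ :=
  M ⧸ Module.jacobson A M

/-- The representation `L_W`, the head of the representation induced from `W`. -/
abbrev simpleRep (φ : G ≃* HCell e) (σ : Representation K G W) : Type u :=
  Head (MonoidAlgebra K S) (ind K φ σ).asModule

/-- `J` is an apex of `M`: a maximal idempotent `J`-cell that does not annihilate `M`. -/
def IsApex (M : Type u) [AddCommGroup M] [Module (MonoidAlgebra K S) M] (J : JCell S) : Prop :=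
  Maximal (fun J : JCell S => (∃ f : Idem S, jcell f.1 = J) ∧
    ∃ (s : S) (v : M), jcell s = J ∧ MonoidAlgebra.of K S s • v ≠ 0) J

end

/-! ### Representation gap -/

section Gap

variable {S : Type} [Monoid S] {V : Type u} [AddCommGroup V] [Module K V]

/-- `v` spans a copy of `1_b` (units act by `1`, all other elements by `0`). -/
def ActsBot (ρ : Representation K S V) (v : V) : Prop :=
  ∀ s, ρ s v = if IsUnit s then v else 0

/-- `v` spans a copy of `1_t` (all elements act by `1`). -/
def ActsTop (ρ : Representation K S V) (v : V) : Prop :=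
  ∀ s, ρ s v = v

/-- The representation is isomorphic to a direct sum of copies of `1_b` and `1_t`. -/
def IsTrivialSum (ρ : Representation K S V) : Prop :=
  ∃ b : Module.Basis (Fin (Module.finrank K V)) K V, ∀ i, ActsBot K ρ (b i) ∨ ActsTop K ρ (b i)

variable (S)

/-- All representations of dimension less than `d` are direct sums of trivial representations. -/
def TrivialBelow (d : ℕ) : Prop :=
  ∀ (V : Type u) [AddCommGroup V] [Module K V] [FiniteDimensional K V] (ρ : Representation K S V),
    Module.finrank K V < d → IsTrivialSum K ρ

/-- The representation gap. It is `0` by convention for the trivial monoid and for the monoid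
`{1, a}` with `a² = a`. -/
noncomputable def gap : ℕ :=
  if Nonempty (S ≃* Unit) ∨ Nonempty (S ≃* WithZero Unit) then 0 else sSup {d | TrivialBelow K S d}

/-- Dimensions of the simple representations that are not isomorphic to `1_b` or `1_t`. -/
def nontrivialSimpleDims : Set ℕ :=
  {d | ∃ (V : Type u) (_ : AddCommGroup V) (_ : Module K V) (ρ : Representation K S V),
    ρ.IsIrreducible ∧ ¬ (Module.finrank K V = 1 ∧ ∀ v, ActsBot K ρ v) ∧
      ¬ (Module.finrank K V = 1 ∧ ∀ v, ActsTop K ρ v) ∧ Module.finrank K V = d}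

/-- `a b ≈_r a` for non-invertible `a`, `b`. -/
def stepR (x y : S) : Prop := ∃ b, ¬ IsUnit y ∧ ¬ IsUnit b ∧ x = y * b

/-- `a b ≈_l b` for non-invertible `a`, `b`. -/
def stepL (x y : S) : Prop := ∃ a, ¬ IsUnit a ∧ ¬ IsUnit y ∧ x = a * y

/-- The non-units form a single class of `≈_r`. -/
def RightConnected : Prop :=
  (∃ a : S, ¬ IsUnit a) ∧ ∀ a b : S, ¬ IsUnit a → ¬ IsUnit b → Relation.EqvGen (stepR S) a b

/-- The non-units form a single class of `≈_l`. -/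
def LeftConnected : Prop :=
  (∃ a : S, ¬ IsUnit a) ∧ ∀ a b : S, ¬ IsUnit a → ¬ IsUnit b → Relation.EqvGen (stepL S) a b

/-- Every non-unit is a product of two non-units. -/
def NullConnected : Prop := ∀ a : S, ¬ IsUnit a → ∃ b c : S, ¬ IsUnit b ∧ ¬ IsUnit c ∧ a = b * c

/-- Well-connected monoids. -/
def WellConnected : Prop :=
  (RightConnected S ∧ LeftConnected S ∧ NullConnected S) ∨ ∀ a : S, IsUnit a

end Gap

/-! ### The Motzkin algebra -/

section Algebra

variable {n : ℕ} (δ : K)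

/-- The relation identifying the identity diagram with one internal component with `δ · 1`. -/
def bubbleRel (n : ℕ) (x y : MonoidAlgebra K (CDiagram ℕ n)) : Prop :=
  x = MonoidAlgebra.of K _ ⟨1, 1⟩ ∧ y = algebraMap K _ δ

/-- The Motzkin algebra: the algebra of the monoid of all Motzkin diagrams with internal components
counted in `ℕ`, in which each internal component is identified with the scalar `δ`. -/
abbrev MotzkinAlgebra (n : ℕ) : Type u := RingQuot (bubbleRel K δ n)

/-- Action of diagrams on the left cell `L` of `x` with weights: `a • l` is
`δ ^ (number of internal components of a and of the concatenation of a and l)` times `a l` if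
`a l` is in `L`, and `0` otherwise. -/
noncomputable def cellRep (x : Diagram n) :
    Representation K (CDiagram ℕ n) (LCell x →₀ K) where
  toFun a := Finsupp.linearCombination K fun l : LCell x =>
    if h : simL (a.skeleton * l.1) x then
      Finsupp.single ⟨a.skeleton * l.1, h⟩ (δ ^ (a.count + internal a.skeleton.rel l.1.rel))
    else 0
  map_one' := by
    ext1 l
    ext1
    simp only [LinearMap.comp_apply, Finsupp.lsingle_apply, Finsupp.linearCombination_single,
      one_smul, CDiagram.one_skeleton, CDiagram.one_count, Diagram.one_rel, internal_id_left,
      one_mul, l.2, dif_pos, Module.End.one_apply, add_zero, pow_zero]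
  map_mul' a b := by
    ext1 l
    ext1
    simp only [LinearMap.comp_apply, Finsupp.lsingle_apply, Finsupp.linearCombination_single,
      one_smul, Module.End.mul_apply, CDiagram.mul_skeleton]
    by_cases h : simL (b.skeleton * l.1) x
    · have hc := internal_cocycle a.skeleton.rel b.skeleton.rel l.1.rel
      rw [dif_pos h, Finsupp.linearCombination_single]
      simp only [mul_assoc]
      split_ifs with h'
      · rw [Finsupp.smul_single, smul_eq_mul, ← pow_add]
        congr 2
        simp only [CDiagram.mul_count, Diagram.mul_rel, Nat.cast_id]
        omega
      · rw [smul_zero]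
    · rw [dif_neg h, map_zero, dif_neg]
      intro h'
      rw [mul_assoc] at h'
      exact h ⟨leL_trans (leL_mul a.skeleton (b.skeleton * l.1)) h'.1,
        leL_trans l.2.2 (leL_mul b.skeleton l.1)⟩

/-- The action of the Motzkin algebra on the left cell of `x`. -/
noncomputable def cellAction (x : Diagram n) :
    MotzkinAlgebra K δ n →ₐ[K] Module.End K (LCell x →₀ K) :=
  RingQuot.liftAlgHom K ⟨(cellRep K δ x).asAlgebraHom, by
    rintro _ _ ⟨rfl, rfl⟩
    rw [Representation.asAlgebraHom_of, AlgHom.commutes]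
    ext1 l
    ext1
    simp only [cellRep, MonoidHom.coe_mk, OneHom.coe_mk, LinearMap.comp_apply,
      Finsupp.lsingle_apply, Finsupp.linearCombination_single, one_smul, one_mul, l.2, dif_pos,
      Diagram.one_rel, internal_id_left, add_zero, pow_one, Module.algebraMap_end_apply,
      Finsupp.smul_single, smul_eq_mul, mul_one]⟩

/-- The cell module `W(j)` of the Motzkin algebra, where `j` is the number of through strands
of `x`: the span of the diagrams in the left cell of `x`, that is, of the diagrams with `j` through
strands and with the same bottom half as `x`. -/
def CellModule (_ : K) (x : Diagram n) : Type u := LCell x →₀ K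

noncomputable instance (x : Diagram n) : AddCommGroup (CellModule K δ x) :=
  inferInstanceAs (AddCommGroup (LCell x →₀ K))

noncomputable instance (x : Diagram n) : Module K (CellModule K δ x) :=
  inferInstanceAs (Module K (LCell x →₀ K))

noncomputable instance (x : Diagram n) : Module (MotzkinAlgebra K δ n) (CellModule K δ x) where
  smul a v := cellAction K δ x a v
  one_smul v := LinearMap.congr_fun (map_one (cellAction K δ x)) v
  mul_smul a b v := LinearMap.congr_fun (map_mul (cellAction K δ x) a b) v
  smul_zero a := map_zero (cellAction K δ x a)
  smul_add a := map_add (cellAction K δ x a)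
  add_smul a b v := LinearMap.congr_fun (map_add (cellAction K δ x) a b) v
  zero_smul v := LinearMap.congr_fun (map_zero (cellAction K δ x)) v

instance (x : Diagram n) : IsScalarTower K (MotzkinAlgebra K δ n) (CellModule K δ x) where
  smul_assoc c a v := LinearMap.congr_fun (map_smul (cellAction K δ x) c a) v

/-- The simple representation `L(j)` of the Motzkin algebra, the head of the cell module `W(j)`,
where `j` is the number of through strands of `x`. -/
abbrev MotzkinSimple (x : Diagram n) : Type u :=
  Head (MotzkinAlgebra K δ n) (CellModule K δ x)

end Algebra

end Representations
/-! ### Involutive sandwich cellular algebras -/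

section Sandwich

open scoped TensorProduct Classical

variable (K : Type u) [Field K]

/-- The raw data of an involutive sandwich cell datum with its left and right cell representations;
the bottom sets are equal to the top sets. The axioms are in `IsInvolutiveSandwichCellular`. -/
structure CellDatum (A : Type u) [Ring A] [Algebra K A] where
  /-- the middle poset -/
  P : Type
  [order : PartialOrder P]
  /-- the top sets, which are also the bottom sets -/
  T : P → Type
  /-- the sandwiched algebras -/
  H : P → Type u
  [ring : ∀ l, Ring (H l)]
  [algebra : ∀ l, Algebra K (H l)]
  /-- the index set of the basis `B_λ` of the sandwiched algebra -/
  I : P → Type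
  b : ∀ l, Module.Basis (I l) K (H l)
  /-- `C l T m B` is the basis element `c_{T,m,B}^λ` -/
  C : ∀ l, T l → I l → T l → A
  /-- the left cell representations with their left and right actions -/
  Δ : P → Type u
  [addΔ : ∀ l, AddCommGroup (Δ l)]
  [modΔ : ∀ l, Module K (Δ l)]
  ΔL : ∀ l, A →ₗ[K] Module.End K (Δ l)
  ΔR : ∀ l, H l →ₗ[K] Module.End K (Δ l)
  /-- the right cell representations with their left and right actions -/
  N : P → Type u
  [addN : ∀ l, AddCommGroup (N l)]
  [modN : ∀ l, Module K (N l)]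
  NL : ∀ l, H l →ₗ[K] Module.End K (N l)
  NR : ∀ l, A →ₗ[K] Module.End K (N l)
  /-- the anti-involution of the algebra -/
  starA : A →ₗ[K] A
  /-- the involutions of the bases `B_λ` -/
  starI : ∀ l, I l → I l

attribute [instance] CellDatum.order CellDatum.ring CellDatum.algebra CellDatum.addΔ
  CellDatum.modΔ CellDatum.addN CellDatum.modN

namespace CellDatum

variable {K} {A : Type u} [Ring A] [Algebra K A] (D : CellDatum K A)

/-- `c_{T,h,B}` for `h` in the sandwiched algebra, by linear extension. -/
noncomputable def c (l : D.P) (T B : D.T l) : D.H l →ₗ[K] A :=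
  (D.b l).constr K fun m => D.C l T m B

/-- The family of all `c_{T,m,B}^λ`. -/
def basisElt (i : Σ l, D.T l × D.I l × D.T l) : A := D.C i.1 i.2.1 i.2.2.1 i.2.2.2

/-- `A^{>λ}`, the span of all `c_{T,m,B}^μ` with `μ > λ`. -/
def gtIdeal (l : D.P) : Submodule K A :=
  Submodule.span K {a | ∃ p, l < p ∧ ∃ T m B, a = D.C p T m B}

/-- `A^{≥λ}`. -/
def geIdeal (l : D.P) : Submodule K A :=
  Submodule.span K {a | ∃ p, l ≤ p ∧ ∃ T m B, a = D.C p T m B}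

/-- The cell algebra `A_λ = A^{≥λ} / A^{>λ}`, as a subspace of `A / A^{>λ}`. -/
abbrev cellAlgebra (l : D.P) : Submodule K (A ⧸ D.gtIdeal l) :=
  (D.geIdeal l).map (D.gtIdeal l).mkQ

/-- The relations of the tensor product over the sandwiched algebra. -/
def balance (l : D.P) : Submodule K (D.Δ l ⊗[K] D.N l) :=
  Submodule.span K {t | ∃ h d v, t = D.ΔR l h d ⊗ₜ[K] v - d ⊗ₜ[K] D.NL l h v}

/-- The axioms of an involutive sandwich cell datum. -/
structure IsInvolutiveSandwichCellular : Prop where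
  finite_T : ∀ l, Finite (D.T l)
  linearIndependent : LinearIndependent K D.basisElt
  span_eq_top : Submodule.span K (Set.range D.basisElt) = ⊤
  /-- `x c_{T,m,B} ≡ ∑_U c_{U, r_U m, B}` modulo `A^{>λ}`, with `r` independent of `m` and `B` -/
  left_mul : ∀ (l : D.P) (T : D.T l) (x : A), ∃ r : D.T l →₀ D.H l, ∀ (m : D.I l) (B : D.T l),
    x * D.C l T m B - r.sum (fun U h => D.c l U B (h * D.b l m)) ∈ D.gtIdeal l
  /-- `c_{T,m,B} x ≡ ∑_U c_{T, m r_U, U}` modulo `A^{>λ}`, with `r` independent of `m` and `T` -/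
  right_mul : ∀ (l : D.P) (B : D.T l) (x : A), ∃ r : D.T l →₀ D.H l, ∀ (m : D.I l) (T : D.T l),
    D.C l T m B * x - r.sum (fun U h => D.c l T U (D.b l m * h)) ∈ D.gtIdeal l
  /-- `Δ(λ)` is an `A`-`H_λ`-bimodule. -/
  ΔL_one : ∀ l, D.ΔL l 1 = 1
  ΔL_mul : ∀ l x y, D.ΔL l (x * y) = D.ΔL l x * D.ΔL l y
  ΔR_one : ∀ l, D.ΔR l 1 = 1
  ΔR_mul : ∀ l h k, D.ΔR l (h * k) = D.ΔR l k * D.ΔR l h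
  Δ_comm : ∀ l x h, D.ΔL l x * D.ΔR l h = D.ΔR l h * D.ΔL l x
  /-- `∇(λ)` is an `H_λ`-`A`-bimodule. -/
  NL_one : ∀ l, D.NL l 1 = 1
  NL_mul : ∀ l h k, D.NL l (h * k) = D.NL l h * D.NL l k
  NR_one : ∀ l, D.NR l 1 = 1
  NR_mul : ∀ l x y, D.NR l (x * y) = D.NR l y * D.NR l x
  N_comm : ∀ l x h, D.NR l x * D.NL l h = D.NL l h * D.NR l x
  /-- `Δ(λ)` is free as a right `H_λ`-module. -/
  Δ_free : ∀ l, ∃ (ι : Type) (v : ι → D.Δ l),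
    Function.Bijective fun f : ι →₀ D.H l => f.sum fun i h => D.ΔR l h (v i)
  /-- `∇(λ)` is free as a left `H_λ`-module. -/
  N_free : ∀ l, ∃ (ι : Type) (v : ι → D.N l),
    Function.Bijective fun f : ι →₀ D.H l => f.sum fun i h => D.NL l h (v i)
  /-- `Δ(λ) ⊗_{H_λ} ∇(λ)` is isomorphic to `A_λ` as a bimodule. -/
  cell_iso : ∀ l, ∃ ψ : ((D.Δ l ⊗[K] D.N l) ⧸ D.balance l) ≃ₗ[K] D.cellAlgebra l,
    ∀ (d : D.Δ l) (v : D.N l) (x y : A),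
      (D.gtIdeal l).mkQ y = ψ ((D.balance l).mkQ (d ⊗ₜ[K] v)) →
        (D.gtIdeal l).mkQ (x * y) = ψ ((D.balance l).mkQ (D.ΔL l x d ⊗ₜ[K] v)) ∧
        (D.gtIdeal l).mkQ (y * x) = ψ ((D.balance l).mkQ (d ⊗ₜ[K] D.NR l x v))
  starA_one : D.starA 1 = 1
  starA_mul : ∀ x y, D.starA (x * y) = D.starA y * D.starA x
  starA_starA : ∀ x, D.starA (D.starA x) = x
  starI_starI : ∀ l m, D.starI l (D.starI l m) = m
  /-- `(c_{T,m,B})^* ≡ c_{B,m^*,T}` modulo `A^{>λ}` -/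
  starA_basis : ∀ l T m B, D.starA (D.C l T m B) - D.C l B (D.starI l m) T ∈ D.gtIdeal l

end CellDatum

section MonoidDatum

variable {S : Type} [Monoid S]

/-- The right cells contained in the `J`-cell `l`. -/
abbrev RightCells (l : JCell S) : Type := {R : Set S // ∃ x, jcell x = l ∧ R = {y | simR y x}}

variable (S) in
/-- The choices in the construction of the cell datum of a monoid with anti-involution `star`: in
each `J`-cell an idempotent `e` fixed by `star`, and in each right cell an element of the left cell
of `e`. -/
structure CellReps (star : S → S) where
  e : JCell S → Idem S
  jcell_e : ∀ l, jcell (e l).1 = l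
  /-- the restriction of `star` to `H(e)` -/
  starH : ∀ l, HCell (e l) → HCell (e l)
  coe_starH : ∀ l h, (starH l h : S) = star h.1
  star_e : ∀ l, star (e l).1 = (e l).1
  t : ∀ l : JCell S, RightCells l → S
  t_mem : ∀ l R, t l R ∈ R.1
  t_simL : ∀ l R, simL (t l R) (e l).1

/-- The space `∇_R = K R` of the right cell `R` of `x`. -/
def Nabla (x : S) : Type u := RCell x →₀ K

noncomputable instance (x : S) : AddCommGroup (Nabla K x) :=
  inferInstanceAs (AddCommGroup (RCell x →₀ K))

noncomputable instance (x : S) : Module K (Nabla K x) :=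
  inferInstanceAs (Module K (RCell x →₀ K))

/-- The right action on `∇_R`: `r • s` is `r s` if this is in `R`, and `0` otherwise. -/
noncomputable def nablaRight (x s : S) : Nabla K x →ₗ[K] Nabla K x :=
  Finsupp.linearCombination K fun r : RCell x =>
    if h : simR (r.1 * s) x then Finsupp.single ⟨r.1 * s, h⟩ (1 : K) else (0 : RCell x →₀ K)

/-- Left multiplication with an element of `H(e)` on `∇_R`, where `R` is the right cell of `e`. -/
noncomputable def nablaLeft {e : Idem S} (h : HCell e) : Nabla K e.1 →ₗ[K] Nabla K e.1 :=
  Finsupp.lmapDomain K K fun r : RCell e.1 => (⟨h.1 * r.1, simR_mul r.2 h⟩ : RCell e.1)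

variable {K} in
/-- Linear extension of a map on a monoid to its monoid algebra. -/
noncomputable def linExt {M : Type} {V : Type u} [AddCommGroup V] [Module K V] (f : M → V) :
    MonoidAlgebra K M →ₗ[K] V :=
  (MonoidAlgebra.basis M K).constr K f

/-- The cell datum of the algebra of a monoid with anti-involution `star`: the middle poset is the
poset of `J`-cells, the top sets consist of the right cells, the sandwiched algebras are the
algebras of the groups `H(e)` with the basis `H(e)`, `c_{T,h,B} = t_T h t_B^*`, and the cell
representations are `K L` and `K R` for the left cell `L` and the right cell `R` of `e`. -/
noncomputable def monoidDatum (star : S → S) (r : CellReps S star) :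
    CellDatum K (MonoidAlgebra K S) where
  P := JCell S
  T := RightCells
  H l := MonoidAlgebra K (HCell (r.e l))
  I l := HCell (r.e l)
  b l := MonoidAlgebra.basis (HCell (r.e l)) K
  C l T h B := MonoidAlgebra.of K S (r.t l T * h.1 * star (r.t l B))
  Δ l := Delta K (r.e l).1
  ΔL l := linExt fun s => deltaLeft K (r.e l).1 s
  ΔR l := linExt fun h => deltaRight K (e := r.e l) h
  N l := Nabla K (r.e l).1
  NL l := linExt fun h => nablaLeft K (e := r.e l) h
  NR l := linExt fun s => nablaRight K (r.e l).1 s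
  starA := linExt fun s => MonoidAlgebra.of K S (star s)
  starI := r.starH

end MonoidDatum

end Sandwich

end Motz

open Motz

/-! Everything is read off from the two halves of a diagram. Planarity forces the through strands to
match the through points of the two edges in order, so a diagram is the same as a pair of halves
with equally many through points (`Diagram.ext_halves`, `Half.join`). If the lower half of `a`
mirrors the upper half of `b`, then `a * b` has the upper half of `a` and the lower half of `b`
(`Diagram.mul_eq_join`). Hence the right cells of `Mo_n` are the upper halves, the left cells the
lower halves, the `J`-cells the numbers of through strands, all `H`-cells are singletons, and `a *
a.flip` is always idempotent. In the cyclic monoid two elements over one diagram differ by a central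
unit `shift g` (`eq_shift_mul`), so all cell orders pull back from `Mo_n`, and `H(e)` consists of
the `m` shifts of `e`.

The classification is Clifford–Munn–Ponizovskii theory. The idempotent `e` maps the induced module
onto `e ⊗ W`, which generates it and is irreducible under compressions (`ind_isLocal`); such a
module has exactly one maximal submodule (`IsLocal`). A simple module with the right apex is
recovered from its image under `e` (`nonempty_simpleRep_equiv`). Idempotents with equally many
through strands are isomorphic, and since shifts are central the isomorphism respects the action of
`ℤ/m`.

For the gap, a representation of dimension below all nontrivial simples has only trivial composition
factors, and it has to be shown that extensions among these split. An extension is a cocycle `f`;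
null-, right- and left-connectedness settle the extensions involving `1_b`, and self-extensions of
`1_t` vanish because powers become periodic with period `m`, which is invertible in `K`
(`exists_coboundary`). Well-connectedness for `n ≥ 3`, `k ≥ 2` comes from opening an outermost cap
into two through strands, which can be closed again or cut (`wellConnected_of_three_le`). For `n =
2` the cell module with one through strand has dimension at most two, so only representations of
dimension at most one have to be inspected.

The sandwich cellular structure holds for every finite monoid with an anti-involution and a choice
of representatives: `t_T h`, `h t_B^*` and `t_T h t_B^*` enumerate the left cell, the right cell and
the monoid without repetition, and a product that leaves a cell lies in a strictly higher `J`-cell.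

For the comparison with the Motzkin algebra, both algebras act on the span of the same left cell by
the same operators, because powers of `ζ` depend only on the exponent modulo `m`. The idempotent
projects this space to a line, so both heads are quotients by the same subspace `cellRadical`. -/

namespace Motz

/-! ### Halves of diagrams -/

section Halves

variable {n : ℕ}

/-- One half of a Motzkin diagram: the blocks of the points on one edge, together with the set of
those points that belong to a through strand. -/
@[ext] structure Half (n : ℕ) where
  rel : Setoid (Fin n)
  thru : Finset (Fin n)
  size_le_two : ∀ x y z, rel x y → rel x z → x = y ∨ x = z ∨ y = z
  planar : ∀ x y z w, x < y → y < z → z < w → rel x z → rel y w → rel x y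
  single : ∀ x ∈ thru, ∀ y, rel x y → x = y
  exposed : ∀ x y z, x < y → y < z → rel x z → y ∉ thru

theorem Diagram.rel_symm_iff (a : Diagram n) {x y : Vert n} : a.rel x y ↔ a.rel y x :=
  ⟨a.rel.symm, a.rel.symm⟩

theorem circ_inr_lt {i j : Fin n} : circ (.inr i : Vert n) < circ (.inr j) ↔ j < i := by
  simp only [circ, Fin.lt_def]; omega

theorem circ_inl_lt_inr (i j : Fin n) : circ (.inl i : Vert n) < circ (.inr j) := by
  simp only [circ]; omega

theorem not_circ_inr_lt_inl (i j : Fin n) : ¬ circ (.inr i : Vert n) < circ (.inl j) := by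
  simp only [circ]; omega

open Classical in
/-- The upper half of a diagram. -/
noncomputable def Diagram.upper (a : Diagram n) : Half n where
  rel := a.rel.comap Sum.inl
  thru := Finset.univ.filter fun i => ∃ j, a.rel (.inl i) (.inr j)
  size_le_two x y z h h' := by
    simpa using a.size_le_two _ _ _ h h'
  planar x y z w h1 h2 h3 h4 h5 :=
    a.planar (.inl x) (.inl y) (.inl z) (.inl w) h1 h2 h3 h4 h5
  single x hx y h := by
    obtain ⟨j, hj⟩ := (Finset.mem_filter.mp hx).2
    simpa using a.size_le_two _ _ _ h hj
  exposed x y z h1 h2 h hy := by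
    obtain ⟨j, hj⟩ := (Finset.mem_filter.mp hy).2
    have := a.planar (.inl x) (.inl y) (.inl z) (.inr j) h1 h2 (circ_inl_lt_inr _ _) h hj
    rcases a.size_le_two _ _ _ h this with h | h | h <;> simp at h <;> omega

/-- The lower half of a diagram. -/
noncomputable def Diagram.lower (a : Diagram n) : Half n := a.flip.upper

theorem Diagram.flip_flip (a : Diagram n) : a.flip.flip = a := by
  refine Diagram.rel_injective ?_
  ext x y
  rcases x with x | x <;> rcases y with y | y <;> rfl

theorem Diagram.upper_flip (a : Diagram n) : a.flip.upper = a.lower := rfl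

theorem Diagram.lower_flip (a : Diagram n) : a.flip.lower = a.upper := by
  rw [Diagram.lower, Diagram.flip_flip]

theorem Diagram.upper_rel (a : Diagram n) (i j : Fin n) :
    a.upper.rel i j ↔ a.rel (.inl i) (.inl j) := Iff.rfl

theorem Diagram.lower_rel (a : Diagram n) (i j : Fin n) :
    a.lower.rel i j ↔ a.rel (.inr i) (.inr j) := Iff.rfl

theorem Diagram.mem_upper (a : Diagram n) (i : Fin n) :
    i ∈ a.upper.thru ↔ ∃ j, a.rel (.inl i) (.inr j) := by
  simp [Diagram.upper]

theorem Diagram.mem_lower (a : Diagram n) (j : Fin n) :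
    j ∈ a.lower.thru ↔ ∃ i, a.rel (.inl i) (.inr j) := by
  rw [← Diagram.upper_flip, Diagram.mem_upper]
  exact exists_congr fun i => a.rel_symm_iff

theorem Diagram.through_eq (a : Diagram n) : a.through = a.upper.thru.card := by
  classical
  rw [Diagram.through, Nat.card_eq_fintype_card, Fintype.card_subtype]
  simp only [Diagram.upper]

/-- Two through strands in the wrong order would cross, and planarity would then merge them into one
block with too many points. -/
theorem Diagram.thru_lt (a : Diagram n) {i j i' j' : Fin n} (h : a.rel (.inl i) (.inr j))
    (h' : a.rel (.inl i') (.inr j')) (hi : i < i') : j < j' := by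
  by_contra! hj
  rcases hj.eq_or_lt with rfl | hj
  · have := a.size_le_two _ _ _ (a.rel.symm h) (a.rel.symm h')
    simp at this; omega
  · have := a.planar (.inl i) (.inl i') (.inr j) (.inr j') hi (circ_inl_lt_inr _ _)
      (circ_inr_lt.mpr hj) h h'
    rcases a.size_le_two _ _ _ h this with h | h | h <;> simp at h
    omega

theorem Diagram.thru_unique (a : Diagram n) {i j j' : Fin n} (h : a.rel (.inl i) (.inr j))
    (h' : a.rel (.inl i) (.inr j')) : j = j' := by
  simpa using a.size_le_two _ _ _ h h'

theorem Diagram.thru_unique' (a : Diagram n) {i i' j : Fin n} (h : a.rel (.inl i) (.inr j))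
    (h' : a.rel (.inl i') (.inr j)) : i = i' := by
  simpa using a.size_le_two _ _ _ (a.rel.symm h) (a.rel.symm h')

theorem Diagram.card_lower (a : Diagram n) : a.lower.thru.card = a.through := by
  rw [Diagram.through_eq]
  symm
  refine Finset.card_bij (fun i hi => ((a.mem_upper i).mp hi).choose) ?_ ?_ ?_
  · intro i hi
    exact (a.mem_lower _).mpr ⟨i, ((a.mem_upper i).mp hi).choose_spec⟩
  · intro i hi i' hi' h
    have h1 := ((a.mem_upper i).mp hi).choose_spec
    have h2 := ((a.mem_upper i').mp hi').choose_spec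
    rw [h] at h1
    exact a.thru_unique' h1 h2
  · intro j hj
    obtain ⟨i, hi⟩ := (a.mem_lower j).mp hj
    refine ⟨i, (a.mem_upper i).mpr ⟨j, hi⟩, ?_⟩
    exact a.thru_unique ((a.mem_upper i).mp ((a.mem_upper i).mpr ⟨j, hi⟩)).choose_spec hi

theorem Diagram.through_flip (a : Diagram n) : a.flip.through = a.through := by
  rw [Diagram.through_eq, Diagram.upper_flip, Diagram.card_lower]

theorem Diagram.through_le (a : Diagram n) : a.through ≤ n := by
  rw [Diagram.through_eq]
  exact (Finset.card_le_univ _).trans (by simp)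

/-- The through strands are determined by their end points. -/
theorem Diagram.thru_le_of_halves {a b : Diagram n} (h : a.upper.thru = b.upper.thru)
    (h' : a.lower.thru = b.lower.thru) (i j : Fin n) :
    a.rel (.inl i) (.inr j) ↔ b.rel (.inl i) (.inr j) := by
  induction i using WellFoundedLT.induction generalizing j with
  | _ i ih =>
    have key : ∀ (a b : Diagram n), a.upper.thru = b.upper.thru → a.lower.thru = b.lower.thru →
        (∀ i' < i, ∀ j, a.rel (.inl i') (.inr j) ↔ b.rel (.inl i') (.inr j)) →
        ∀ j j', a.rel (.inl i) (.inr j) → b.rel (.inl i) (.inr j') → ¬ j < j' := by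
      intro a b h h' ih j j' ha hb hlt
      -- In `b` the point `j` ends a strand from some `i'`. If `i' < i`, induction makes it a strand
      -- of `a` as well, against uniqueness in `a`; if `i' = i`, then `j = j'`; if `i' > i`,
      -- monotonicity in `b` gives `j' < j`.
      obtain ⟨i', hi'⟩ := (b.mem_lower j).mp (h' ▸ (a.mem_lower j).mpr ⟨i, ha⟩)
      rcases lt_trichotomy i' i with h1 | rfl | h1
      · exact h1.ne (a.thru_unique' ((ih i' h1 j).mpr hi') ha)
      · exact hlt.ne (b.thru_unique hi' hb)
      · exact (b.thru_lt hb hi' h1).not_gt hlt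
    have key2 : ∀ (a b : Diagram n), a.upper.thru = b.upper.thru → a.lower.thru = b.lower.thru →
        (∀ i' < i, ∀ j, a.rel (.inl i') (.inr j) ↔ b.rel (.inl i') (.inr j)) →
        ∀ j, a.rel (.inl i) (.inr j) → b.rel (.inl i) (.inr j) := by
      intro a b h h' ih j ha
      obtain ⟨j', hb⟩ := (b.mem_upper i).mp (h ▸ (a.mem_upper i).mpr ⟨j, ha⟩)
      have h1 := key a b h h' ih j j' ha hb
      have h2 := key b a h.symm h'.symm (fun i' hi j => (ih i' hi j).symm) j' j hb ha
      obtain rfl : j = j' := le_antisymm (not_lt.mp h2) (not_lt.mp h1)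
      exact hb
    exact ⟨key2 a b h h' ih j, key2 b a h.symm h'.symm (fun i' hi j => (ih i' hi j).symm) j⟩

/-- A diagram is determined by its two halves. -/
theorem Diagram.ext_halves {a b : Diagram n} (h : a.upper = b.upper) (h' : a.lower = b.lower) :
    a = b := by
  have key := Diagram.thru_le_of_halves (congrArg Half.thru h) (congrArg Half.thru h')
  refine Diagram.rel_injective ?_
  ext x y
  rcases x with x | x <;> rcases y with y | y
  · rw [← Diagram.upper_rel, h]; rfl
  · exact key x y
  · rw [a.rel_symm_iff, b.rel_symm_iff]; exact key y x
  · rw [← Diagram.lower_rel, h']; rfl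

/-- The order-preserving bijection between two finite sets of the same size. -/
noncomputable def matching (T B : Finset (Fin n)) (h : T.card = B.card) : T ≃o B :=
  (T.orderIsoOfFin rfl).symm.trans (B.orderIsoOfFin h.symm)

/-- The graph of `matching`. -/
def Matched (T B : Finset (Fin n)) (h : T.card = B.card) (i j : Fin n) : Prop :=
  ∃ hi : i ∈ T, (matching T B h ⟨i, hi⟩ : Fin n) = j

section
variable {T B : Finset (Fin n)} {h : T.card = B.card}

theorem Matched.mem_left {i j : Fin n} (hij : Matched T B h i j) : i ∈ T := hij.1

theorem Matched.mem_right {i j : Fin n} (hij : Matched T B h i j) : j ∈ B := by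
  obtain ⟨hi, rfl⟩ := hij
  exact (matching T B h ⟨i, hi⟩).2

theorem Matched.exists_right (h : T.card = B.card) {i : Fin n} (hi : i ∈ T) :
    ∃ j, Matched T B h i j := ⟨_, hi, rfl⟩

theorem Matched.exists_left (h : T.card = B.card) {j : Fin n} (hj : j ∈ B) :
    ∃ i, Matched T B h i j :=
  ⟨(matching T B h).symm ⟨j, hj⟩, Subtype.coe_prop _, by simp⟩

theorem Matched.lt {i j i' j' : Fin n} (hij : Matched T B h i j) (hij' : Matched T B h i' j')
    (hi : i < i') : j < j' := by
  obtain ⟨h1, rfl⟩ := hij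
  obtain ⟨h2, rfl⟩ := hij'
  exact (matching T B h).strictMono hi

theorem Matched.right_unique {i j j' : Fin n} (hij : Matched T B h i j)
    (hij' : Matched T B h i j') : j = j' := by
  obtain ⟨h1, rfl⟩ := hij
  obtain ⟨h2, rfl⟩ := hij'
  rfl

theorem Matched.left_unique {i j i' : Fin n} (hij : Matched T B h i j)
    (hij' : Matched T B h i' j) : i = i' := by
  rcases lt_trichotomy i i' with h1 | h1 | h1
  · exact absurd (hij.lt hij' h1) (lt_irrefl _)
  · exact h1
  · exact absurd (hij'.lt hij h1) (lt_irrefl _)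

end

/-- The relation underlying `Half.join`. -/
def Half.joinRel (u v : Half n) (h : u.thru.card = v.thru.card) : Vert n → Vert n → Prop
  | .inl i, .inl i' => u.rel i i'
  | .inr j, .inr j' => v.rel j j'
  | .inl i, .inr j => Matched u.thru v.thru h i j
  | .inr j, .inl i => Matched u.thru v.thru h i j

/-- The diagram with given halves. -/
def Half.join (u v : Half n) (h : u.thru.card = v.thru.card) : Diagram n where
  rel :=
    { r := u.joinRel v h
      iseqv :=
        { refl := by rintro (x | x) <;> exact Setoid.refl' _ _
          symm := by
            rintro (x | x) (y | y) h
            · exact Setoid.symm' _ h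
            · exact h
            · exact h
            · exact Setoid.symm' _ h
          trans := by
            rintro (x | x) (y | y) (z | z) h h'
            · exact Setoid.trans' _ h h'
            · obtain rfl := u.single y h'.mem_left x (Setoid.symm' _ h)
              exact h'
            · obtain rfl := Matched.left_unique h h'
              exact Setoid.refl' _ _
            · obtain rfl := v.single y h.mem_right z h'
              exact h
            · obtain rfl := u.single y h.mem_left z h'
              exact h
            · obtain rfl := Matched.right_unique h h'
              exact Setoid.refl' _ _
            · obtain rfl := v.single y h'.mem_right x (Setoid.symm' _ h)
              exact h'
            · exact Setoid.trans' _ h h' } }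
  size_le_two := by
    rintro (x | x) (y | y) (z | z) h h'
    · simpa using u.size_le_two x y z h h'
    · exact Or.inl (congrArg _ (u.single x h'.mem_left y h))
    · exact Or.inr (Or.inl (congrArg _ (u.single x h.mem_left z h')))
    · exact Or.inr (Or.inr (congrArg _ (Matched.right_unique h h')))
    · exact Or.inr (Or.inr (congrArg _ (Matched.left_unique h h')))
    · exact Or.inr (Or.inl (congrArg _ (v.single x h.mem_right z h')))
    · exact Or.inl (congrArg _ (v.single x h'.mem_right y h))
    · simpa using v.size_le_two x y z h h'
  planar := by
    -- Top points precede bottom points on the boundary walk, so only five of the sixteen cases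
    -- survive. The mixed ones contradict that through points are exposed or that the matching
    -- preserves order.
    rintro (x | x) (y | y) (z | z) (w | w) h1 h2 h3 h4 h5 <;>
      first
      | exact absurd h1 (not_circ_inr_lt_inl _ _)
      | exact absurd h2 (not_circ_inr_lt_inl _ _)
      | exact absurd h3 (not_circ_inr_lt_inl _ _)
      | skip
    · exact u.planar x y z w h1 h2 h3 h4 h5
    · exact absurd (Matched.mem_left h5) (u.exposed x y z h1 h2 h4)
    · exact absurd (Matched.lt h4 h5 h1) (circ_inr_lt.mp h3).not_gt
    · exact absurd (Matched.mem_right h4)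
        (v.exposed w z y (circ_inr_lt.mp h3) (circ_inr_lt.mp h2) (Setoid.symm' _ h5))
    · have := v.planar w z y x (circ_inr_lt.mp h3) (circ_inr_lt.mp h2) (circ_inr_lt.mp h1)
        (Setoid.symm' _ h5) (Setoid.symm' _ h4)
      exact Setoid.trans' _ h4 (Setoid.trans' _ (Setoid.symm' _ this) (Setoid.symm' _ h5))

theorem Half.join_upper (u v : Half n) (h : u.thru.card = v.thru.card) :
    (u.join v h).upper = u := by
  refine Half.ext rfl ?_
  ext i
  rw [Diagram.mem_upper]
  exact ⟨fun ⟨_, hj⟩ => Matched.mem_left hj, fun hi => Matched.exists_right h hi⟩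

theorem Half.join_lower (u v : Half n) (h : u.thru.card = v.thru.card) :
    (u.join v h).lower = v := by
  refine Half.ext rfl ?_
  ext i
  rw [Diagram.mem_lower]
  exact ⟨fun ⟨_, hj⟩ => Matched.mem_right hj, fun hi => Matched.exists_left h hi⟩

instance : Finite (Diagram n) := by
  have : Finite (Setoid (Vert n)) :=
    Finite.of_injective (fun r : Setoid (Vert n) => (r : Vert n → Vert n → Prop))
      fun r s h => Setoid.ext fun x y => iff_of_eq (congrFun (congrFun h x) y)
  exact Finite.of_injective Diagram.rel fun _ _ => Diagram.rel_injective

end Halves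

/-! ### Products of diagrams -/

section Products

variable {n : ℕ}

theorem avoid_congr {X X' Y Y' : Type} (s : Setoid X') (f : Y → X) (f' : Y' → X') (α : X ≃ X')
    (β : Y ≃ Y') (h : ∀ y, α (f y) = f' (β y)) : avoid (s.comap α) f = avoid s f' := by
  unfold avoid
  refine Nat.card_congr ((Quotient.congr α (fun a b => Iff.rfl)).subtypeEquiv fun q => ?_)
  induction q using Quotient.inductionOn with | _ x
  constructor
  · intro hq y' hy
    refine hq (β.symm y') ?_
    have h1 : s (f' y') (α x) := Quotient.exact hy
    refine Quotient.sound (s := s.comap α) ?_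
    change s (α _) (α x)
    rw [h, β.apply_symm_apply]
    exact h1
  · intro hq y hy
    have h1 : s (α (f y)) (α x) := Quotient.exact (s := s.comap α) hy
    rw [h] at h1
    exact hq (β y) (Quotient.sound h1)

/-- Reversal of the three rows. -/
def rev3 : Fin 3 × Fin n ≃ Fin 3 × Fin n := Fin.revPerm.prodCongr (Equiv.refl _)

theorem comap_equiv_map {X Y : Type} (r : Setoid X) (α : X ≃ Y) : r.comap α.symm = r.map α := by
  apply le_antisymm
  · intro x y h
    have := map_rel r α (x := α.symm x) (y := α.symm y) h
    simpa using this
  · rw [map_le_iff]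
    intro x y h
    change r (α.symm (α x)) (α.symm (α y))
    simpa using h

theorem stack_swap (a b : Setoid (Vert n)) :
    stack (b.comap Sum.swap) (a.comap Sum.swap) = (stack a b).comap rev3 := by
  have h1 : ∀ r : Setoid (Vert n), r.comap Sum.swap = r.map Sum.swap := fun r =>
    comap_equiv_map r (Equiv.sumComm _ _)
  have h2 : (stack a b).comap rev3 = (stack a b).map rev3 := by
    have := comap_equiv_map (stack a b) (rev3 (n := n))
    rwa [show (rev3 (n := n)).symm = rev3 from rfl] at this
  rw [h2, stack, stack, map_sup, h1, h1, map_map', map_map', map_map', map_map', sup_comm]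
  congr 2
  · funext x; rcases x with x | x <;> rfl
  · funext x; rcases x with x | x <;> rfl

theorem glue_swap (a b : Setoid (Vert n)) :
    glue (b.comap Sum.swap) (a.comap Sum.swap) = (glue a b).comap Sum.swap := by
  rw [glue, stack_swap]
  ext x y
  rcases x with x | x <;> rcases y with y | y <;> rfl

/-- Reflection carries the internal components of one concatenation to those of the reversed one.
This is why reflection that keeps the count is an anti-involution of the cyclic monoid. -/
theorem internal_swap (a b : Setoid (Vert n)) :
    internal (b.comap Sum.swap) (a.comap Sum.swap) = internal a b := by
  rw [internal, stack_swap, internal]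
  refine avoid_congr _ _ _ rev3 (Equiv.sumComm _ _) ?_
  rintro (x | x) <;> rfl

theorem Diagram.flip_mul (a b : Diagram n) : (a * b).flip = b.flip * a.flip :=
  Diagram.rel_injective (glue_swap a.rel b.rel).symm

theorem glue_left {a b : Setoid (Vert n)} {i i' : Fin n} (h : a (.inl i) (.inl i')) :
    glue a b (.inl i) (.inl i') :=
  (le_sup_left : a.map (row 0 1) ≤ stack a b) (map_rel a (row 0 1) h)

theorem glue_right {a b : Setoid (Vert n)} {i i' : Fin n} (h : b (.inr i) (.inr i')) :
    glue a b (.inr i) (.inr i') :=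
  (le_sup_right : b.map (row 1 2) ≤ stack a b) (map_rel b (row 1 2) h)

theorem glue_thru {a b : Setoid (Vert n)} {i k j : Fin n} (h : a (.inl i) (.inr k))
    (h' : b (.inl k) (.inr j)) : glue a b (.inl i) (.inr j) :=
  Setoid.trans' (stack a b)
    ((le_sup_left : a.map (row 0 1) ≤ stack a b) (map_rel a (row 0 1) h))
    ((le_sup_right : b.map (row 1 2) ≤ stack a b) (map_rel b (row 1 2) h'))

/-- The components of `a * b` if every cap of `b` is closed by a cup of `a`: labels for the three
rows by blocks of `a`, except for the points of the lower row that do not belong to a through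
strand of `b`. -/
theorem stack_le_of_caps {a b : Diagram n}
    (h : ∀ k k', b.rel (.inl k) (.inl k') → a.rel (.inr k) (.inr k')) :
    ∃ f : Fin 3 × Fin n → Quotient a.rel ⊕ Quotient b.rel,
      stack a.rel b.rel ≤ Setoid.ker f ∧ (∀ i, f (0, i) = .inl (Quotient.mk _ (.inl i))) ∧
      (∀ k, f (1, k) = .inl (Quotient.mk _ (.inr k))) ∧
      (∀ k j, b.rel (.inl k) (.inr j) → f (2, j) = .inl (Quotient.mk _ (.inr k))) ∧
      (∀ j, (¬ ∃ k, b.rel (.inl k) (.inr j)) → f (2, j) = .inr (Quotient.mk _ (.inr j))) := by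
  classical
  let f : Fin 3 × Fin n → Quotient a.rel ⊕ Quotient b.rel := fun v =>
    if v.1 = 0 then .inl (Quotient.mk _ (.inl v.2))
    else if v.1 = 1 then .inl (Quotient.mk _ (.inr v.2))
    else if h : ∃ k, b.rel (.inl k) (.inr v.2) then .inl (Quotient.mk _ (.inr h.choose))
    else .inr (Quotient.mk _ (.inr v.2))
  have h0 : ∀ i, f (0, i) = .inl (Quotient.mk _ (.inl i)) := fun i => rfl
  have h1 : ∀ i, f (1, i) = .inl (Quotient.mk _ (.inr i)) := fun i => rfl
  have h2 : ∀ k j, b.rel (.inl k) (.inr j) → f (2, j) = .inl (Quotient.mk _ (.inr k)) := by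
    intro k j hkj
    have hex : ∃ k, b.rel (.inl k) (.inr j) := ⟨k, hkj⟩
    have : f (2, j) = .inl (Quotient.mk _ (.inr hex.choose)) := by
      simp only [f]
      rw [if_neg (by decide), if_neg (by decide), dif_pos hex]
    rw [this, b.thru_unique' hex.choose_spec hkj]
  have h3 : ∀ j, (¬ ∃ k, b.rel (.inl k) (.inr j)) → f (2, j) = .inr (Quotient.mk _ (.inr j)) := by
    intro j hj
    simp only [f]
    rw [if_neg (by decide), if_neg (by decide), dif_neg hj]
  refine ⟨f, sup_le ?_ ?_, h0, h1, h2, h3⟩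
  · rw [map_le_iff]
    have : ∀ x, f (row 0 1 x) = .inl (Quotient.mk _ x) := by rintro (x | x) <;> rfl
    intro x y hxy
    change f _ = f _
    rw [this, this]
    exact congrArg _ (Quotient.sound hxy)
  · rw [map_le_iff]
    rintro (x | x) (y | y) hxy <;> change f _ = f _ <;> simp only [row, Sum.elim_inl, Sum.elim_inr]
    · rw [h1, h1]
      exact congrArg _ (Quotient.sound (h x y hxy))
    · rw [h1, h2 x y hxy]
    · rw [h1, h2 y x (b.rel.symm hxy)]
    · by_cases hx : ∃ k, b.rel (.inl k) (.inr x)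
      · obtain ⟨k, hk⟩ := hx
        rw [h2 k x hk, h2 k y (b.rel.trans hk hxy)]
      · rw [h3 x hx, h3 y fun ⟨k, hk⟩ => hx ⟨k, b.rel.trans hk (b.rel.symm hxy)⟩]
        exact congrArg _ (Quotient.sound hxy)

section
variable {a b : Diagram n} (h : ∀ k k', b.rel (.inl k) (.inl k') → a.rel (.inr k) (.inr k'))
include h

theorem Diagram.mul_rel_top (i i' : Fin n) :
    (a * b).rel (.inl i) (.inl i') ↔ a.rel (.inl i) (.inl i') := by
  refine ⟨fun hi => ?_, fun hi => glue_left hi⟩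
  obtain ⟨f, hf, h0, -⟩ := stack_le_of_caps h
  have h1 : f (0, i) = f (0, i') := hf hi
  rw [h0, h0] at h1
  exact Quotient.exact (Sum.inl_injective h1)

theorem Diagram.mul_rel_thru (i j : Fin n) :
    (a * b).rel (.inl i) (.inr j) ↔ ∃ k, a.rel (.inl i) (.inr k) ∧ b.rel (.inl k) (.inr j) := by
  refine ⟨fun hi => ?_, fun ⟨k, hk, hk'⟩ => glue_thru hk hk'⟩
  obtain ⟨f, hf, h0, h1, h2, h3⟩ := stack_le_of_caps h
  have h4 : f (0, i) = f (2, j) := hf hi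
  by_cases hj : ∃ k, b.rel (.inl k) (.inr j)
  · obtain ⟨k, hk⟩ := hj
    rw [h0, h2 k j hk] at h4
    exact ⟨k, Quotient.exact (Sum.inl_injective h4), hk⟩
  · rw [h0, h3 j hj] at h4
    simp at h4

/-- The second alternative records the strands of `a` on the middle row that connect two through
strands of `b` and so bend them into one bottom strand. -/
theorem Diagram.mul_rel_bot (j j' : Fin n) :
    (a * b).rel (.inr j) (.inr j') ↔ b.rel (.inr j) (.inr j') ∨
      ∃ k k', b.rel (.inl k) (.inr j) ∧ b.rel (.inl k') (.inr j') ∧ a.rel (.inr k) (.inr k') := by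
  constructor
  · intro hj
    obtain ⟨f, hf, h0, h1, h2, h3⟩ := stack_le_of_caps h
    have h4 : f (2, j) = f (2, j') := hf hj
    by_cases hj : ∃ k, b.rel (.inl k) (.inr j) <;> by_cases hj' : ∃ k, b.rel (.inl k) (.inr j')
    · obtain ⟨k, hk⟩ := hj
      obtain ⟨k', hk'⟩ := hj'
      rw [h2 k j hk, h2 k' j' hk'] at h4
      exact Or.inr ⟨k, k', hk, hk', Quotient.exact (Sum.inl_injective h4)⟩
    · obtain ⟨k, hk⟩ := hj
      rw [h2 k j hk, h3 j' hj'] at h4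
      simp at h4
    · obtain ⟨k, hk⟩ := hj'
      rw [h2 k j' hk, h3 j hj] at h4
      simp at h4
    · rw [h3 j hj, h3 j' hj'] at h4
      exact Or.inl (Quotient.exact (Sum.inr_injective h4))
  · rintro (h1 | ⟨k, k', h1, h2, h3⟩)
    · exact glue_right h1
    · have s1 : stack a.rel b.rel (1, k) (2, j) :=
        (le_sup_right : b.rel.map (row 1 2) ≤ stack a.rel b.rel) (map_rel b.rel (row 1 2) h1)
      have s2 : stack a.rel b.rel (1, k') (2, j') :=
        (le_sup_right : b.rel.map (row 1 2) ≤ stack a.rel b.rel) (map_rel b.rel (row 1 2) h2)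
      have s3 : stack a.rel b.rel (1, k) (1, k') :=
        (le_sup_left : a.rel.map (row 0 1) ≤ stack a.rel b.rel) (map_rel a.rel (row 0 1) h3)
      exact Setoid.trans' (stack a.rel b.rel) (Setoid.symm' _ s1) (Setoid.trans' _ s3 s2)

end

/-- If the lower half of `a` is the mirror image of the upper half of `b`, then the outer halves of
`a` and `b` are the halves of the product. -/
theorem Diagram.mul_upper_of_matched {a b : Diagram n} (h : a.lower = b.upper) :
    (a * b).upper = a.upper := by
  have h' : ∀ k k', b.rel (.inl k) (.inl k') → a.rel (.inr k) (.inr k') := fun k k' hk => by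
    rw [← Diagram.lower_rel, h]; exact hk
  refine Half.ext (Setoid.ext fun i i' => mul_rel_top h' i i') ?_
  ext i
  rw [mem_upper, mem_upper]
  simp only [mul_rel_thru h']
  constructor
  · rintro ⟨j, k, hk, -⟩
    exact ⟨k, hk⟩
  · rintro ⟨k, hk⟩
    obtain ⟨j, hj⟩ := (b.mem_upper k).mp (h ▸ (a.mem_lower k).mpr ⟨i, hk⟩)
    exact ⟨j, k, hk, hj⟩

theorem Diagram.mul_lower_of_matched {a b : Diagram n} (h : a.lower = b.upper) :
    (a * b).lower = b.lower := by
  rw [lower, flip_mul, mul_upper_of_matched, upper_flip]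
  rw [lower_flip, upper_flip, h]

theorem Diagram.mul_eq_join {a b c : Diagram n} (h : a.lower = b.upper) (h1 : a.upper = c.upper)
    (h2 : b.lower = c.lower) : a * b = c :=
  Diagram.ext_halves ((mul_upper_of_matched h).trans h1) ((mul_lower_of_matched h).trans h2)

/-- All middle halves match their mirror images, so only the outer halves of `a` survive. This
regularity is the source of the idempotents `a * a.flip`. -/
theorem Diagram.flip_regular (a : Diagram n) : a * a.flip * a = a := by
  refine mul_eq_join ?_ ?_ rfl
  · rw [mul_lower_of_matched (upper_flip a).symm, lower_flip]
  · exact mul_upper_of_matched (upper_flip a).symm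

end Products

end Motz

namespace Motz

/-! ### Green's relations in finite monoids -/

section FiniteGreen

variable {S : Type} [Monoid S]

theorem leR_trans {a b c : S} (h : leR a b) (h' : leR b c) : leR a c := by
  obtain ⟨x, rfl⟩ := h
  obtain ⟨y, rfl⟩ := h'
  exact ⟨x * y, mul_assoc _ _ _⟩

theorem leR_mul (a b : S) : leR a (a * b) := ⟨b, rfl⟩

theorem leL.leJ {a b : S} (h : leL a b) : leJ a b := by
  obtain ⟨c, rfl⟩ := h
  exact ⟨c, 1, (mul_one _).symm⟩

theorem leR.leJ {a b : S} (h : leR a b) : leJ a b := by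
  obtain ⟨c, rfl⟩ := h
  exact ⟨1, c, by rw [one_mul]⟩

theorem simL.symm {a b : S} (h : simL a b) : simL b a := ⟨h.2, h.1⟩

theorem simR.symm {a b : S} (h : simR a b) : simR b a := ⟨h.2, h.1⟩

theorem simL.trans {a b c : S} (h : simL a b) (h' : simL b c) : simL a c :=
  ⟨leL_trans h.1 h'.1, leL_trans h'.2 h.2⟩

theorem simR.trans {a b c : S} (h : simR a b) (h' : simR b c) : simR a c :=
  ⟨leR_trans h.1 h'.1, leR_trans h'.2 h.2⟩

theorem simH_refl (a : S) : simH a a := ⟨simL_refl a, simR_refl a⟩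

theorem simL.simJ {a b : S} (h : simL a b) : simJ a b := ⟨h.1.leJ, h.2.leJ⟩

theorem simR.simJ {a b : S} (h : simR a b) : simJ a b := ⟨h.1.leJ, h.2.leJ⟩

theorem simJ.trans {a b c : S} (h : simJ a b) (h' : simJ b c) : simJ a c :=
  ⟨leJ_trans h.1 h'.1, leJ_trans h'.2 h.2⟩

theorem simJ.symm {a b : S} (h : simJ a b) : simJ b a := ⟨h.2, h.1⟩

theorem jcell_le {a b : S} : jcell a ≤ jcell b ↔ leJ a b := Iff.rfl

theorem jcell_eq {a b : S} : jcell a = jcell b ↔ simJ a b :=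
  ⟨fun h => ⟨jcell_le.mp h.le, jcell_le.mp h.ge⟩,
    fun h => le_antisymm (jcell_le.mpr h.1) (jcell_le.mpr h.2)⟩

theorem jcell_surjective (l : JCell S) : ∃ a : S, jcell a = l := by
  induction l using Quotient.inductionOn with | _ a
  exact ⟨a, rfl⟩

theorem leR.mul_left_eq {e a : S} (he : IsIdempotentElem e) (h : leR e a) : e * a = a := by
  obtain ⟨c, rfl⟩ := h
  rw [← mul_assoc, he]

theorem eq_pow_mul_pow {x a c : S} (h : a = x * a * c) (k : ℕ) : a = x ^ k * a * c ^ k := by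
  induction k with
  | zero => simp
  | succ k ih =>
    calc a = x ^ k * a * c ^ k := ih
      _ = x ^ k * (x * a * c) * c ^ k := by rw [← h]
      _ = _ := by rw [pow_succ, pow_succ']; simp only [mul_assoc]

variable [Finite S]

theorem exists_pow_eq_pow_add (c : S) : ∃ i p, 0 < p ∧ c ^ i = c ^ (i + p) := by
  obtain ⟨i, j, hne, h⟩ := Finite.exists_ne_map_eq_of_infinite fun k : ℕ => c ^ k
  rcases hne.lt_or_gt with h1 | h1
  · exact ⟨i, j - i, by omega, by rw [show i + (j - i) = j by omega]; exact h⟩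
  · exact ⟨j, i - j, by omega, by rw [show j + (i - j) = i by omega]; exact h.symm⟩

/-- Stability of finite monoids: iterating `a = x a (c y)` until the powers of `c y` repeat gives `a
= a (c y)^p` with `p > 0`, and this lies in `a c S`. -/
theorem leR_of_leJ {a b : S} (h : leR a b) (h' : leJ b a) : leR b a := by
  obtain ⟨c, rfl⟩ := h
  obtain ⟨x, y, hxy⟩ := h'
  have h1 : a = x * a * (c * y) := by simpa only [mul_assoc] using hxy
  obtain ⟨i, p, hp, hip⟩ := exists_pow_eq_pow_add (c * y)
  have h2 : a = a * (c * y) ^ p := by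
    calc a = x ^ i * a * (c * y) ^ i := eq_pow_mul_pow h1 i
      _ = x ^ i * a * (c * y) ^ i * (c * y) ^ p := by rw [mul_assoc _ ((c * y) ^ i), ← pow_add, ← hip]
      _ = a * (c * y) ^ p := by rw [← eq_pow_mul_pow h1 i]
  obtain ⟨q, rfl⟩ := Nat.exists_eq_succ_of_ne_zero hp.ne'
  refine ⟨y * (c * y) ^ q, ?_⟩
  rw [pow_succ'] at h2
  simpa only [mul_assoc] using h2

theorem leL_of_leJ {a b : S} (h : leL a b) (h' : leJ b a) : leL b a := by
  obtain ⟨c, rfl⟩ := h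
  obtain ⟨x, y, hxy⟩ := h'
  have h1 : a = (x * c) * a * y := by simpa only [mul_assoc] using hxy
  obtain ⟨i, p, hp, hip⟩ := exists_pow_eq_pow_add (x * c)
  have h2 : a = (x * c) ^ p * a := by
    calc a = (x * c) ^ i * a * y ^ i := eq_pow_mul_pow h1 i
      _ = (x * c) ^ p * ((x * c) ^ i * a * y ^ i) := by
        rw [← mul_assoc, ← mul_assoc, ← pow_add, add_comm p, ← hip]
      _ = (x * c) ^ p * a := by rw [← eq_pow_mul_pow h1 i]
  obtain ⟨q, rfl⟩ := Nat.exists_eq_succ_of_ne_zero hp.ne'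
  refine ⟨(x * c) ^ q * x, ?_⟩
  rw [pow_succ] at h2
  simpa only [mul_assoc] using h2

theorem simR_of_leR {a b : S} (h : leR a b) (h' : leJ b a) : simR b a := ⟨leR_of_leJ h h', h⟩

theorem simL_of_leL {a b : S} (h : leL a b) (h' : leJ b a) : simL b a := ⟨leL_of_leJ h h', h⟩

/-- An element of `e S e` in the `J`-cell of `e` lies in `H(e)`. -/
theorem simH_of_leJ {e s : S} (h1 : leL e s) (h2 : leR e s) (h' : leJ s e) : simH s e :=
  ⟨simL_of_leL h1 h', simR_of_leR h2 h'⟩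

/-- Idempotents in the same `J`-cell are isomorphic. -/
theorem exists_isomorphism {e f : S} (he : IsIdempotentElem e) (hf : IsIdempotentElem f)
    (h : simJ e f) : ∃ p q, p * q = e ∧ q * p = f ∧ e * p = p ∧ f * q = q := by
  -- From `f = x e y` take `p = e y f` and `q = f x e`; then `q p = f` by computation. The product
  -- `p q` is an idempotent in `e S` and in the `J`-cell of `e`, so stability puts `e` into `p q S`,
  -- whence `p q = p q e = e`.
  obtain ⟨⟨x, y, hxy⟩, h'⟩ := h
  have hqp : (f * x * e) * (e * y * f) = f := by
    calc (f * x * e) * (e * y * f) = f * (x * (e * e) * y) * f := by simp only [mul_assoc]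
      _ = f * f * f := by rw [he.eq, ← hxy]
      _ = f := by rw [hf.eq, hf.eq]
  refine ⟨e * y * f, f * x * e, ?_, hqp, by simp only [← mul_assoc, he.eq],
    by simp only [← mul_assoc, hf.eq]⟩
  obtain ⟨p, hp⟩ : ∃ p, p = e * y * f := ⟨_, rfl⟩
  obtain ⟨q, hq⟩ : ∃ q, q = f * x * e := ⟨_, rfl⟩
  rw [← hp, ← hq] at hqp ⊢
  have hpf : p * f = p := by rw [hp, mul_assoc, hf.eq]
  have hqe : q * e = q := by rw [hq, mul_assoc, he.eq]
  have hid : (p * q) * (p * q) = p * q := by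
    rw [mul_assoc, ← mul_assoc q, hqp, ← mul_assoc, hpf]
  have h1 : leR e (p * q) := ⟨y * f * q, by simp only [hp, mul_assoc]⟩
  have h2 : leJ (p * q) e := by
    refine leJ_trans ⟨q, p, ?_⟩ h'
    rw [← mul_assoc, hqp, mul_assoc, hqp, hf.eq]
  obtain ⟨c, hc⟩ := leR_of_leJ h1 h2
  calc p * q = p * q * e := by rw [mul_assoc, hqe]
    _ = p * q * (p * q * c) := by rw [← hc]
    _ = e := by rw [← mul_assoc, hid, ← hc]

end FiniteGreen

end Motz

namespace Motz

/-! ### Modules with a unique maximal submodule -/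

section Local

variable {K A M W : Type*} [Field K] [Ring A] [Algebra K A] [AddCommGroup M] [Module K M]
  [Module A M] [IsScalarTower K A M] [AddCommGroup W] [Module K W]

/-- `W` is identified, via the inclusion `i` and the retraction `r`, with the image of the element
`ε` of `A`, which acts as `i ∘ r`; it generates `M`, and it has no proper subspace which is invariant under
all compressions to `W` of elements of `A`. -/
structure IsLocal (ε : A) (i : W →ₗ[K] M) (r : M →ₗ[K] W) : Prop where
  nontrivial : Nontrivial W
  retract : ∀ w, r (i w) = w
  smul_eq : ∀ v, ε • v = i (r v)
  generates : ∀ P : Submodule A M, (∀ w, i w ∈ P) → P = ⊤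
  irreducible : ∀ U : Submodule K W, (∀ w ∈ U, ∀ a : A, r (a • i w) ∈ U) → U = ⊥ ∨ U = ⊤

namespace IsLocal

variable {ε : A} {i : W →ₗ[K] M} {r : M →ₗ[K] W}

variable (A) in
/-- The largest submodule on which `r` vanishes. -/
def core (r : M →ₗ[K] W) : Submodule A M where
  carrier := {v | ∀ a : A, r (a • v) = 0}
  add_mem' h h' a := by rw [smul_add, map_add, h a, h' a, add_zero]
  zero_mem' a := by rw [smul_zero, map_zero]
  smul_mem' b v h a := by rw [← mul_smul]; exact h (a * b)

/-- As `ε` acts by `i ∘ r`, the preimage of `P` under `i` is stable under all compressions, so it is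
`0` or `W`. If it is `W`, then `P` contains generators of `M`; if it is `0`, then `r` kills all of
`P`. -/
theorem le_core (h : IsLocal ε i r) {P : Submodule A M} (hP : P ≠ ⊤) : P ≤ core A r := by
  have hmem : ∀ v ∈ P, i (r v) ∈ P := fun v hv => h.smul_eq v ▸ P.smul_mem ε hv
  rcases h.irreducible ((P.restrictScalars K).comap i) (fun w hw a => hmem _ (P.smul_mem a hw))
    with h0 | h1
  · intro v hv a
    have : r (a • v) ∈ (P.restrictScalars K).comap i := hmem _ (P.smul_mem a hv)
    rw [h0] at this
    exact this
  · refine absurd (h.generates P fun w => ?_) hP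
    have : w ∈ (P.restrictScalars K).comap i := h1 ▸ Submodule.mem_top
    exact this

omit [Algebra K A] [IsScalarTower K A M] in
theorem core_ne_top (h : IsLocal ε i r) : core A r ≠ ⊤ := by
  intro h1
  obtain ⟨w, hw⟩ := @exists_ne W h.nontrivial 0
  have h2 : i w ∈ core A r := h1 ▸ Submodule.mem_top
  have := h2 1
  rw [one_smul, h.retract] at this
  exact hw this

theorem isCoatom_core (h : IsLocal ε i r) : IsCoatom (core A r) :=
  ⟨h.core_ne_top, fun P hP => by
    by_contra hne
    exact absurd (h.le_core hne) hP.not_ge⟩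

theorem isCoatom_iff (h : IsLocal ε i r) {P : Submodule A M} : IsCoatom P ↔ P = core A r := by
  constructor
  · intro hP
    by_contra hne
    rcases (h.le_core hP.1).eq_or_lt with h1 | h1
    · exact hne h1
    · exact h.core_ne_top (hP.2 _ h1)
  · rintro rfl
    exact h.isCoatom_core

theorem jacobson_eq (h : IsLocal ε i r) : Module.jacobson A M = core A r := by
  refine le_antisymm (sInf_le h.isCoatom_core) (le_sInf fun P hP => ?_)
  rw [h.isCoatom_iff.mp hP]

/-- The core contains every proper submodule and is proper, so it is the only maximal submodule and
equals the radical. -/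
theorem isSimpleModule_head (h : IsLocal ε i r) : IsSimpleModule A (Head A M) := by
  rw [isSimpleModule_iff_isCoatom, h.jacobson_eq]
  exact h.isCoatom_core

/-- A nonzero map to a simple module identifies the head with that module. -/
theorem nonempty_head_equiv (h : IsLocal ε i r) {X : Type*} [AddCommGroup X] [Module A X]
    [IsSimpleModule A X] (f : M →ₗ[A] X) (hf : f ≠ 0) : Nonempty (Head A M ≃ₗ[A] X) := by
  have hs : Function.Surjective f := (LinearMap.surjective_or_eq_zero f).resolve_right hf
  have e := f.quotKerEquivOfSurjective hs
  have : IsCoatom (LinearMap.ker f) := by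
    rw [← isSimpleModule_iff_isCoatom]
    exact IsSimpleModule.congr e
  exact ⟨(Submodule.quotEquivOfEq _ _ (h.jacobson_eq.trans (h.isCoatom_iff.mp this).symm)).trans e⟩

theorem mkQ_ne_zero (h : IsLocal ε i r) {w : W} (hw : w ≠ 0) :
    (Module.jacobson A M).mkQ (i w) ≠ 0 := by
  intro h0
  rw [Submodule.mkQ_apply, Submodule.Quotient.mk_eq_zero, h.jacobson_eq] at h0
  have := h0 1
  rw [one_smul, h.retract] at this
  exact hw this

end IsLocal

end Local

/-! ### Induced representations -/

section Induced

open scoped TensorProduct Classical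

variable {K : Type u} [Field K] {S : Type} [Monoid S]

theorem irreducible_submodule {G W : Type*} [Monoid G] [AddCommGroup W] [Module K W]
    (σ : Representation K G W) (hσ : σ.IsIrreducible) (U : Submodule K W)
    (hU : ∀ g, ∀ w ∈ U, σ g w ∈ U) : U = ⊥ ∨ U = ⊤ := by
  rcases hσ.eq_bot_or_eq_top (⟨U, fun g w hw => hU g w hw⟩ : Subrepresentation σ) with h | h
  · exact Or.inl (congrArg Subrepresentation.toSubmodule h)
  · exact Or.inr (congrArg Subrepresentation.toSubmodule h)

theorem irreducible_nontrivial {G W : Type*} [Monoid G] [AddCommGroup W] [Module K W]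
    (σ : Representation K G W) (hσ : σ.IsIrreducible) : Nontrivial W := by
  by_contra hW
  rw [not_nontrivial_iff_subsingleton] at hW
  obtain ⟨a, b, hab⟩ := hσ.exists_pair_ne
  refine hab (Subrepresentation.toSubmodule_injective ?_)
  exact Subsingleton.elim _ _

theorem irreducible_of_submodule {G W : Type*} [Monoid G] [AddCommGroup W] [Module K W]
    [Nontrivial W] (σ : Representation K G W)
    (h : ∀ U : Submodule K W, (∀ g, ∀ w ∈ U, σ g w ∈ U) → U = ⊥ ∨ U = ⊤) : σ.IsIrreducible where
  exists_pair_ne := ⟨⊥, ⊤, fun h => by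
    have := congrArg Subrepresentation.toSubmodule h
    exact bot_ne_top (α := Submodule K W) this⟩
  eq_bot_or_eq_top U := by
    rcases h U.toSubmodule (fun g w hw => U.apply_mem_toSubmodule g hw) with h | h
    · exact Or.inl (Subrepresentation.toSubmodule_injective h)
    · exact Or.inr (Subrepresentation.toSubmodule_injective h)

theorem of_smul_asModule {V : Type*} [AddCommGroup V] [Module K V] (ρ : Representation K S V)
    (s : S) (v : V) :
    MonoidAlgebra.of K S s • (show ρ.asModule from v) = (show ρ.asModule from ρ s v) := by
  rw [MonoidAlgebra.of_apply, Representation.single_smul, one_smul]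
  rfl

variable {e : Idem S} {G : Type} [Monoid G] {W : Type u} [AddCommGroup W] [Module K W]
  (φ : G ≃* HCell e) (σ : Representation K G W)

variable (K) in
/-- The basis vector of `Δ_L` given by an element of `L`. -/
noncomputable def Delta.single {x : S} (l : LCell x) : Delta K x :=
  (Finsupp.single l (1 : K) : LCell x →₀ K)

theorem deltaLeft_single (x s : S) (l : LCell x) : deltaLeft K x s (Delta.single K l) =
    if h : simL (s * l.1) x then Delta.single K ⟨s * l.1, h⟩ else 0 :=
  (Finsupp.linearCombination_single (α := LCell x) (M := LCell x →₀ K) K (1 : K) l).trans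
    (one_smul K _)

theorem deltaRight_single (h : HCell e) (l : LCell e.1) :
    deltaRight K h (Delta.single K l) = Delta.single K ⟨l.1 * h.1, simL_mul l.2 h⟩ :=
  Finsupp.mapDomain_single

theorem Delta.hom_ext {x : S} {X : Type*} [AddCommGroup X] [Module K X] {f g : Delta K x →ₗ[K] X}
    (h : ∀ l, f (Delta.single K l) = g (Delta.single K l)) : f = g :=
  Finsupp.lhom_ext' (M := K) (α := LCell x) fun l => LinearMap.ext_ring (h l)

theorem Delta.exists_lift {x : S} {X : Type*} [AddCommGroup X] [Module K X] (F : LCell x → X) :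
    ∃ f : Delta K x →ₗ[K] X, ∀ l, f (Delta.single K l) = F l :=
  ⟨Finsupp.linearCombination K F, fun _ =>
    (Finsupp.linearCombination_single _ _ _).trans (one_smul _ _)⟩

/-- The element `l ⊗ w` of the induced representation. -/
noncomputable def indMk (l : LCell e.1) : W →ₗ[K] (ind K φ σ).asModule :=
  (indRel K φ σ).mkQ ∘ₗ TensorProduct.mk K (Delta K e.1) W (Delta.single K l)

theorem of_smul_indMk (s : S) (l : LCell e.1) (w : W) :
    MonoidAlgebra.of K S s • indMk φ σ l w =
      if h : simL (s * l.1) e.1 then indMk φ σ ⟨s * l.1, h⟩ w else 0 := by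
  have h1 := of_smul_asModule (ind K φ σ) s (indMk φ σ l w)
  refine h1.trans ?_
  change (indRel K φ σ).mkQ ((deltaLeft K e.1 s (Delta.single K l)) ⊗ₜ[K] w) = _
  rw [deltaLeft_single]
  split_ifs with h
  · rfl
  · exact (congrArg _ (TensorProduct.zero_tmul _ w)).trans (map_zero _)

theorem indMk_mul (l : LCell e.1) (g : G) (w : W) :
    indMk φ σ ⟨l.1 * (φ g).1, simL_mul l.2 (φ g)⟩ w = indMk φ σ l (σ g w) := by
  refine (Submodule.Quotient.eq _).mpr (Submodule.subset_span ⟨Delta.single K l, g, w, ?_⟩)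
  rw [deltaRight_single]
  rfl

theorem ind_hom_ext {X : Type*} [AddCommGroup X] [Module K X]
    {f g : (ind K φ σ).asModule →ₗ[K] X}
    (h : ∀ l w, f (indMk φ σ l w) = g (indMk φ σ l w)) : f = g := by
  refine Submodule.linearMap_qext (p := indRel K φ σ) ?_
  refine TensorProduct.ext ?_
  refine Delta.hom_ext fun l => ?_
  ext w
  exact h l w

/-- Linear maps from the induced representation. -/
theorem exists_ind_lift {X : Type*} [AddCommGroup X] [Module K X] (F : LCell e.1 → W →ₗ[K] X)
    (hF : ∀ l g w, F ⟨l.1 * (φ g).1, simL_mul l.2 (φ g)⟩ w = F l (σ g w)) :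
    ∃ f : (ind K φ σ).asModule →ₗ[K] X, ∀ l w, f (indMk φ σ l w) = F l w := by
  obtain ⟨F', hF'⟩ := Delta.exists_lift (K := K) F
  refine ⟨(indRel K φ σ).liftQ (TensorProduct.lift F') (Submodule.span_le.mpr ?_), fun l w => ?_⟩
  · rintro _ ⟨d, g, w, rfl⟩
    rw [SetLike.mem_coe, LinearMap.mem_ker, map_sub, TensorProduct.lift.tmul,
      TensorProduct.lift.tmul, sub_eq_zero]
    have : (F'.flip w) ∘ₗ (deltaRight K (φ g)) = F'.flip (σ g w) := by
      refine Delta.hom_ext fun l => ?_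
      change F' (deltaRight K (φ g) (Delta.single K l)) w = F' (Delta.single K l) (σ g w)
      rw [deltaRight_single, hF', hF', hF]
    exact LinearMap.congr_fun this d
  · change F' (Delta.single K l) w = _
    rw [hF']

/-- The idempotent as an element of its left cell. -/
def LCell.self (e : S) : LCell e := ⟨e, simL_refl e⟩

/-- `W` sits in the induced module as `e ⊗ W`. For `l` in the left cell, `e l` either leaves the
left cell or lies in `H(e)`, so `e` acts as the retraction `l ⊗ w ↦ e ⊗ (e l) w`. Since `l = l e`,
the copy of `W` generates, and the compressions of the elements of `H(e)` are the irreducible action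
`σ`. -/
theorem ind_isLocal [Finite S] (hσ : σ.IsIrreducible) :
    ∃ r : (ind K φ σ).asModule →ₗ[K] W,
      IsLocal (MonoidAlgebra.of K S e.1) (indMk φ σ (LCell.self e.1)) r := by
  -- Stability: `e l` lies in `e S`, and being in the `J`-cell of `e` it lies in the right cell of
  -- `e`.
  have hH : ∀ l : LCell e.1, simL (e.1 * l.1) e.1 → simH (e.1 * l.1) e.1 := fun l hl =>
    ⟨hl, simR_of_leR (leR_mul _ _) hl.1.leJ⟩
  obtain ⟨r, hr⟩ := exists_ind_lift φ σ (X := W)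
    (fun l => if h : simH (e.1 * l.1) e.1 then σ (φ.symm ⟨e.1 * l.1, h⟩) else 0) (by
      intro l g w
      by_cases h : simH (e.1 * l.1) e.1
      · have h' : simH (e.1 * (l.1 * (φ g).1)) e.1 := by
          rw [← mul_assoc]
          exact ⟨simL_mul h.1 (φ g), (simR_mul (φ g).2.2 ⟨_, h⟩)⟩
        rw [dif_pos h, dif_pos h', ← Module.End.mul_apply, ← map_mul]
        congr 2
        rw [MulEquiv.symm_apply_eq, map_mul, MulEquiv.apply_symm_apply]
        exact Subtype.ext (mul_assoc _ _ _).symm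
      · rw [dif_neg h, dif_neg]
        · rfl
        · intro h'
          exact h (hH l ((simL_mul_iff e.1 l (φ g)).mp h'.1)))
  have hself : ∀ w, r (indMk φ σ (LCell.self e.1) w) = w := by
    intro w
    have h1 : simH (e.1 * e.1) e.1 := by rw [e.2.eq]; exact simH_refl _
    rw [hr]
    have : φ.symm ⟨e.1 * e.1, h1⟩ = 1 := by
      rw [MulEquiv.symm_apply_eq, map_one]
      exact Subtype.ext e.2
    change (if h : simH (e.1 * e.1) e.1 then σ (φ.symm ⟨e.1 * e.1, h⟩) else 0) w = w
    rw [dif_pos h1, this, map_one]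
    rfl
  refine ⟨r, irreducible_nontrivial σ hσ, hself, fun v => ?_, ?_, ?_⟩
  · have : (Algebra.lsmul K K (ind K φ σ).asModule (MonoidAlgebra.of K S e.1)) =
        indMk φ σ (LCell.self e.1) ∘ₗ r := by
      refine ind_hom_ext φ σ fun l w => ?_
      change MonoidAlgebra.of K S e.1 • indMk φ σ l w = indMk φ σ (LCell.self e.1) (r _)
      rw [of_smul_indMk, hr]
      by_cases h : simH (e.1 * l.1) e.1
      · rw [dif_pos h.1, dif_pos h, ← indMk_mul]
        congr 2
        simp only [MulEquiv.apply_symm_apply, LCell.self, ← mul_assoc, e.2.eq]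
      · rw [dif_neg fun h' => h (hH l h'), dif_neg h, LinearMap.zero_apply, map_zero]
    exact LinearMap.congr_fun this v
  · intro P hP
    have : (P.restrictScalars K).mkQ = 0 := by
      refine ind_hom_ext φ σ fun l w => ?_
      rw [LinearMap.zero_apply, Submodule.mkQ_apply, Submodule.Quotient.mk_eq_zero]
      have h1 := P.smul_mem (MonoidAlgebra.of K S l.1) (hP w)
      have h2 : simL (l.1 * (LCell.self e.1).1) e.1 := by
        rw [show l.1 * (LCell.self e.1).1 = l.1 from l.mul_right]; exact l.2
      rw [of_smul_indMk, dif_pos h2] at h1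
      have h3 : (⟨l.1 * (LCell.self e.1).1, h2⟩ : LCell e.1) = l := Subtype.ext l.mul_right
      rwa [h3] at h1
    rw [eq_top_iff]
    intro v _
    have h1 := LinearMap.congr_fun this v
    exact (Submodule.Quotient.mk_eq_zero _).mp h1
  · intro U hU
    refine irreducible_submodule σ hσ U fun g w hw => ?_
    have h1 := hU w hw (MonoidAlgebra.of K S (φ g).1)
    have h2 : simL ((φ g).1 * (LCell.self e.1).1) e.1 := by
      rw [show (φ g).1 * (LCell.self e.1).1 = (φ g).1 from (φ g).mul_right]; exact (φ g).2.1
    rw [of_smul_indMk, dif_pos h2] at h1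
    have h3 : indMk φ σ ⟨(φ g).1 * (LCell.self e.1).1, h2⟩ w =
        indMk φ σ (LCell.self e.1) (σ g w) := by
      rw [← indMk_mul]
      congr 2
      exact Subtype.ext ((φ g).mul_right.trans (φ g).mul_left.symm)
    rwa [h3, hself] at h1

theorem simpleRep_isSimpleModule [Finite S] (hσ : σ.IsIrreducible) :
    IsSimpleModule (MonoidAlgebra K S) (simpleRep K φ σ) := by
  obtain ⟨r, hr⟩ := ind_isLocal φ σ hσ
  exact hr.isSimpleModule_head

/-- The inclusion of `W` into `L_W`. -/
noncomputable def simpleMk : W →ₗ[K] simpleRep K φ σ :=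
  ((Module.jacobson (MonoidAlgebra K S) (ind K φ σ).asModule).mkQ.restrictScalars K) ∘ₗ
    indMk φ σ (LCell.self e.1)

theorem of_smul_simpleMk (g : G) (w : W) :
    MonoidAlgebra.of K S (φ g).1 • simpleMk φ σ w = simpleMk φ σ (σ g w) := by
  have h2 : simL ((φ g).1 * (LCell.self e.1).1) e.1 := by
    rw [show (φ g).1 * (LCell.self e.1).1 = (φ g).1 from (φ g).mul_right]; exact (φ g).2.1
  change MonoidAlgebra.of K S (φ g).1 •
    (Module.jacobson (MonoidAlgebra K S) (ind K φ σ).asModule).mkQ (indMk φ σ (LCell.self e.1) w) =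
    (Module.jacobson (MonoidAlgebra K S) (ind K φ σ).asModule).mkQ
      (indMk φ σ (LCell.self e.1) (σ g w))
  rw [← map_smul, of_smul_indMk, dif_pos h2, ← indMk_mul]
  congr 3
  exact Subtype.ext ((φ g).mul_right.trans (φ g).mul_left.symm)

theorem simpleMk_ne_zero [Finite S] (hσ : σ.IsIrreducible) {w : W} (hw : w ≠ 0) :
    simpleMk φ σ w ≠ 0 := by
  obtain ⟨r, hr⟩ := ind_isLocal φ σ hσ
  exact hr.mkQ_ne_zero hw

theorem simpleMk_injective [Finite S] (hσ : σ.IsIrreducible) :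
    Function.Injective (simpleMk φ σ) := by
  rw [injective_iff_map_eq_zero]
  intro w hw
  by_contra h
  exact simpleMk_ne_zero φ σ hσ h hw

theorem range_simpleMk [Finite S] (hσ : σ.IsIrreducible) (v : simpleRep K φ σ) :
    ∃ w, MonoidAlgebra.of K S e.1 • v = simpleMk φ σ w := by
  obtain ⟨r, hr⟩ := ind_isLocal φ σ hσ
  obtain ⟨v, rfl⟩ := Submodule.mkQ_surjective _ v
  refine ⟨r v, ?_⟩
  rw [← map_smul, hr.smul_eq]
  rfl

theorem smul_ind_eq_zero {s : S} (hs : ¬ leJ s e.1) (v : (ind K φ σ).asModule) :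
    MonoidAlgebra.of K S s • v = 0 := by
  have : (Algebra.lsmul K K (ind K φ σ).asModule (MonoidAlgebra.of K S s)) = 0 := by
    refine ind_hom_ext φ σ fun l w => ?_
    change MonoidAlgebra.of K S s • indMk φ σ l w = 0
    rw [of_smul_indMk, dif_neg]
    intro h
    exact hs (leJ_trans (leR_mul s l.1).leJ h.1.leJ)
  exact LinearMap.congr_fun this v

theorem smul_simpleRep_eq_zero {s : S} (hs : ¬ leJ s e.1) (v : simpleRep K φ σ) :
    MonoidAlgebra.of K S s • v = 0 := by
  obtain ⟨v, rfl⟩ := Submodule.mkQ_surjective _ v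
  rw [← map_smul, smul_ind_eq_zero φ σ hs, map_zero]

/-- The idempotent fixes the nonzero image of `W`, and every `s` that acts nontrivially satisfies `s
≤_J e`. So the cell of `e` is the greatest of the cells that do not annihilate, not merely a maximal
one. -/
theorem isApex_simpleRep_iff [Finite S] (hσ : σ.IsIrreducible) (J : JCell S) :
    IsApex K (simpleRep K φ σ) J ↔ J = jcell e.1 := by
  have h1 : (∃ f : Idem S, jcell f.1 = jcell e.1) ∧ ∃ (s : S) (v : simpleRep K φ σ),
      jcell s = jcell e.1 ∧ MonoidAlgebra.of K S s • v ≠ 0 := by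
    obtain ⟨w, hw⟩ := @exists_ne W (irreducible_nontrivial σ hσ) 0
    refine ⟨⟨e, rfl⟩, e.1, simpleMk φ σ w, rfl, ?_⟩
    have := of_smul_simpleMk φ σ 1 w
    rw [map_one, map_one] at this
    exact this.trans_ne (simpleMk_ne_zero φ σ hσ hw)
  have h2 : ∀ J : JCell S, (∃ f : Idem S, jcell f.1 = J) ∧ (∃ (s : S) (v : simpleRep K φ σ),
      jcell s = J ∧ MonoidAlgebra.of K S s • v ≠ 0) → J ≤ jcell e.1 := by
    rintro _ ⟨-, s, v, rfl, hv⟩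
    by_contra hs
    exact hv (smul_simpleRep_eq_zero φ σ hs v)
  constructor
  · intro hJ
    exact le_antisymm (h2 J hJ.1) (hJ.2 h1 (h2 J hJ.1))
  · rintro rfl
    exact ⟨h1, fun J' hJ' _ => h2 J' hJ'⟩

/-- A simple representation with apex `e` is determined by the action of `H(e)` on its image
under `e`. -/
theorem nonempty_simpleRep_equiv [Finite S] (hσ : σ.IsIrreducible) {X : Type*} [AddCommGroup X]
    [Module K X] [Module (MonoidAlgebra K S) X] [IsScalarTower K (MonoidAlgebra K S) X]
    [IsSimpleModule (MonoidAlgebra K S) X] (j : W →ₗ[K] X) (hj : j ≠ 0)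
    (hjσ : ∀ g w, MonoidAlgebra.of K S (φ g).1 • j w = j (σ g w))
    (hX : ∀ s, ¬ leJ s e.1 → ∀ v : X, MonoidAlgebra.of K S s • v = 0) :
    Nonempty (simpleRep K φ σ ≃ₗ[MonoidAlgebra K S] X) := by
  obtain ⟨r, hr⟩ := ind_isLocal φ σ hσ
  -- The map `l ⊗ w ↦ l · j(w)`. It is a module map because a product `s l` that leaves the left
  -- cell is not below `e` in the `J`-order, and such elements kill `X`.
  obtain ⟨f, hf⟩ := exists_ind_lift φ σ (X := X)
    (fun l => (Algebra.lsmul K K X (MonoidAlgebra.of K S l.1)) ∘ₗ j) (by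
      intro l g w
      change MonoidAlgebra.of K S (l.1 * (φ g).1) • j w = MonoidAlgebra.of K S l.1 • j (σ g w)
      rw [map_mul, mul_smul, hjσ])
  have hf' : ∀ l w, f (indMk φ σ l w) = MonoidAlgebra.of K S l.1 • j w := hf
  have hcomm : ∀ s v, f (MonoidAlgebra.of K S s • v) = MonoidAlgebra.of K S s • f v := by
    intro s v
    have : f ∘ₗ (Algebra.lsmul K K (ind K φ σ).asModule (MonoidAlgebra.of K S s)) =
        (Algebra.lsmul K K X (MonoidAlgebra.of K S s)) ∘ₗ f := by
      refine ind_hom_ext φ σ fun l w => ?_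
      change f (MonoidAlgebra.of K S s • indMk φ σ l w) =
        MonoidAlgebra.of K S s • f (indMk φ σ l w)
      rw [of_smul_indMk, hf', ← mul_smul, ← map_mul]
      split_ifs with h
      · rw [hf']
      · rw [map_zero, hX]
        intro h'
        exact h (simL_of_leL (leL_trans l.2.2 (leL_mul s l.1)) h')
    exact LinearMap.congr_fun this v
  refine hr.nonempty_head_equiv (MonoidAlgebra.equivariantOfLinearOfComm f hcomm) ?_
  intro h0
  refine hj (LinearMap.ext fun w => ?_)
  have h1 := LinearMap.congr_fun h0 (indMk φ σ (LCell.self e.1) w)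
  have h2 : f (indMk φ σ (LCell.self e.1) w) = 0 := h1
  rw [hf'] at h2
  have h3 := hjσ 1 w
  rw [map_one, map_one] at h3
  exact h3.symm.trans h2

end Induced

end Motz

namespace Motz

/-! ### Green's relations of the Motzkin monoid -/

section DiagramGreen

variable {n : ℕ}

/-- If the block of `i` in `a` reaches no bottom point, its top points are not connected to anything
else in the stack. The predicate `p` singles them out and is constant on components. -/
theorem Diagram.upper_thru_mul_subset (a c : Diagram n) :
    (a * c).upper.thru ⊆ a.upper.thru := by
  intro i hi
  rw [mem_upper] at hi ⊢
  obtain ⟨j, hij⟩ := hi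
  by_contra! hcon
  let p : Fin 3 × Fin n → Prop := fun v => v.1 = 0 ∧ a.rel (.inl i) (.inl v.2)
  have hle : stack a.rel c.rel ≤ Setoid.ker p := by
    refine sup_le ?_ ?_
    · rw [map_le_iff]
      have key : ∀ x y, a.rel x y → p (row 0 1 x) → p (row 0 1 y) := by
        rintro (x | x) (y | y) hxy ⟨h1, h2⟩
        · exact ⟨rfl, a.rel.trans h2 hxy⟩
        · exact absurd (a.rel.trans h2 hxy) (hcon y)
        · exact absurd h1 (by simp [row])
        · exact absurd h1 (by simp [row])
      exact fun x y hxy => propext ⟨key x y hxy, key y x (a.rel.symm hxy)⟩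
    · rw [map_le_iff]
      have key : ∀ x, ¬ p (row 1 2 x) := by
        rintro (x | x) ⟨h1, -⟩ <;> simp [row] at h1
      exact fun x y _ => propext ⟨fun h => absurd h (key x), fun h => absurd h (key y)⟩
  have h1 : p (0, i) = p (2, j) := hle hij
  have h2 : p (2, j) := h1 ▸ ⟨rfl, a.rel.refl _⟩
  exact absurd h2.1 (by simp)

theorem leR_flip {a b : Diagram n} : leR a.flip b.flip ↔ leL a b := by
  constructor
  · rintro ⟨c, hc⟩
    refine ⟨c.flip, ?_⟩
    rw [← b.flip_flip, hc, Diagram.flip_mul, a.flip_flip]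
  · rintro ⟨c, rfl⟩
    exact ⟨c.flip, Diagram.flip_mul _ _⟩

theorem simR_flip {a b : Diagram n} : simR a.flip b.flip ↔ simL a b :=
  and_congr leR_flip leR_flip

/-- Right multiplication can only join points of the top edge and destroy through points, so mutual
divisibility fixes the upper half. Conversely `b = a (a^* b)` when the upper halves agree, by
matching halves. -/
theorem Diagram.simR_iff {a b : Diagram n} : simR a b ↔ a.upper = b.upper := by
  have key : ∀ {a b : Diagram n}, leR a b →
      (∀ i j, a.upper.rel i j → b.upper.rel i j) ∧ b.upper.thru ⊆ a.upper.thru := by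
    rintro a _ ⟨c, rfl⟩
    exact ⟨fun i j h => glue_left h, upper_thru_mul_subset a c⟩
  have key' : ∀ {a b : Diagram n}, a.upper = b.upper → leR a b := by
    intro a b h
    refine ⟨a.flip * b, (mul_eq_join ?_ h ?_).symm⟩
    · rw [mul_upper_of_matched (by rw [lower_flip, h]), upper_flip]
    · rw [mul_lower_of_matched (by rw [lower_flip, h])]
  constructor
  · rintro ⟨h, h'⟩
    exact Half.ext (Setoid.ext fun i j => ⟨(key h).1 i j, (key h').1 i j⟩)
      ((key h').2.antisymm (key h).2)
  · exact fun h => ⟨key' h, key' h.symm⟩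

theorem Diagram.simL_iff {a b : Diagram n} : simL a b ↔ a.lower = b.lower := by
  rw [← simR_flip, simR_iff, upper_flip, upper_flip]

/-- The Motzkin monoid is `H`-trivial. -/
theorem Diagram.simH_iff {a b : Diagram n} : simH a b ↔ a = b :=
  ⟨fun h => ext_halves (simR_iff.mp h.2) (simL_iff.mp h.1), fun h => h ▸ simH_refl a⟩

/-- The half without strands except for the through strands at the points of `s`. -/
def Half.stops (s : Finset (Fin n)) : Half n where
  rel := ⊥
  thru := s
  size_le_two _ _ _ h _ := Or.inl h
  planar _ _ _ _ h1 h2 _ h4 _ := absurd h4 (h1.trans h2).ne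
  single _ _ _ h := h
  exposed _ _ _ h1 h2 h _ := absurd h (h1.trans h2).ne

/-- The diagram whose only strands are the vertical strands at the points of `s`. -/
def Diagram.pid (s : Finset (Fin n)) : Diagram n := (Half.stops s).join (Half.stops s) rfl

theorem Diagram.pid_upper (s : Finset (Fin n)) : (pid s).upper = Half.stops s :=
  Half.join_upper _ _ _

theorem Diagram.pid_lower (s : Finset (Fin n)) : (pid s).lower = Half.stops s :=
  Half.join_lower _ _ _

theorem Diagram.pid_through (s : Finset (Fin n)) : (pid s).through = s.card := by
  rw [through_eq, pid_upper]; rfl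

theorem Diagram.pid_caps (a : Diagram n) (s : Finset (Fin n)) (k k' : Fin n)
    (h : (pid s).rel (.inl k) (.inl k')) : a.rel (.inr k) (.inr k') := by
  have : k = k' := h
  rw [this]

theorem Diagram.mul_pid_lower (a : Diagram n) (s : Finset (Fin n)) :
    (a * pid s).lower.thru = s ∩ a.lower.thru := by
  have key : ∀ k j, (pid s).rel (.inl k) (.inr j) ↔ k = j ∧ j ∈ s := by
    intro k j
    change (∃ hi : k ∈ s, (matching s s rfl ⟨k, hi⟩ : Fin n) = j) ↔ _
    have : ∀ x : s, matching s s rfl x = x := fun x => by simp [matching]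
    simp only [this]
    constructor
    · rintro ⟨h, rfl⟩
      exact ⟨rfl, h⟩
    · rintro ⟨rfl, h⟩
      exact ⟨h, rfl⟩
  ext j
  rw [mem_lower, Finset.mem_inter, mem_lower]
  simp only [mul_rel_thru (pid_caps a s), key]
  constructor
  · rintro ⟨i, k, h1, rfl, h2⟩
    exact ⟨h2, i, h1⟩
  · rintro ⟨h1, i, h2⟩
    exact ⟨i, j, h2, rfl, h1⟩

theorem Diagram.mul_pid_through (a : Diagram n) (s : Finset (Fin n)) :
    (a * pid s).through = (s ∩ a.lower.thru).card := by
  rw [← card_lower, mul_pid_lower]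

theorem Diagram.through_mul_le_right (a b : Diagram n) : (a * b).through ≤ b.through := by
  rw [← through_flip, flip_mul, ← through_flip b]
  exact through_mul_le _ _

/-- Multiply `a` on the left by the diagram joining the upper halves of `b` and `a`, and on the
right by the one joining their lower halves. -/
theorem Diagram.leJ_of_through_eq {a b : Diagram n} (h : a.through = b.through) : leJ a b := by
  have h1 : b.upper.thru.card = a.upper.thru.card := by rw [← through_eq, ← through_eq, h]
  have h2 : a.lower.thru.card = b.lower.thru.card := by rw [card_lower, card_lower, h]
  refine ⟨b.upper.join a.upper h1, a.lower.join b.lower h2, (mul_eq_join ?_ ?_ ?_).symm⟩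
  · rw [mul_lower_of_matched, Half.join_upper]
    rw [Half.join_lower]
  · rw [mul_upper_of_matched, Half.join_upper]
    rw [Half.join_lower]
  · rw [Half.join_lower]

theorem Diagram.leJ_iff {a b : Diagram n} : leJ a b ↔ b.through ≤ a.through := by
  constructor
  · rintro ⟨c, d, rfl⟩
    exact (through_mul_le _ _).trans (through_mul_le_right _ _)
  · intro h
    rw [← card_lower a] at h
    -- Cutting all through strands of `a` except those ending in `s` leaves exactly as many as `b`
    -- has.
    obtain ⟨s, hs, hc⟩ := Finset.exists_subset_card_eq h
    refine leJ_trans (b := a * pid s) ⟨1, pid s, by rw [one_mul]⟩ (leJ_of_through_eq ?_)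
    rw [mul_pid_through, Finset.inter_eq_left.mpr hs, hc]

theorem Diagram.upper_of_through_eq {a : Diagram n} (h : a.through = n) :
    a.upper = Half.stops Finset.univ := by
  have h1 : a.upper.thru = Finset.univ := by
    rw [← Finset.card_eq_iff_eq_univ, ← through_eq, h, Fintype.card_fin]
  refine Half.ext (Setoid.ext fun i j => ⟨fun hij => ?_, fun hij => ?_⟩) h1
  · exact a.upper.single i (h1 ▸ Finset.mem_univ _) j hij
  · obtain rfl : i = j := hij
    exact Setoid.refl' _ _

theorem Diagram.through_one : (1 : Diagram n).through = n := by
  have h : (1 : Diagram n).upper.thru = Finset.univ := by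
    ext i
    rw [mem_upper]
    exact ⟨fun _ => Finset.mem_univ _, fun _ => ⟨i, rfl⟩⟩
  rw [through_eq, h, Finset.card_univ, Fintype.card_fin]

theorem Diagram.eq_of_through_eq {a b : Diagram n} (h : a.through = n) (h' : b.through = n) :
    a = b := by
  refine ext_halves ?_ ?_
  · rw [upper_of_through_eq h, upper_of_through_eq h']
  · rw [← upper_flip, ← upper_flip, upper_of_through_eq (a.through_flip.trans h),
      upper_of_through_eq (b.through_flip.trans h')]

/-- With `n` through strands no point is left for another block, and the matching is the identity.
This detects the units of the truncations. -/
theorem Diagram.eq_one_iff {a : Diagram n} : a = 1 ↔ a.through = n :=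
  ⟨fun h => h ▸ through_one, fun h => eq_of_through_eq h through_one⟩

theorem Diagram.mul_flip_idem (a : Diagram n) : IsIdempotentElem (a * a.flip) := by
  rw [IsIdempotentElem, ← mul_assoc, flip_regular]

theorem Diagram.through_mul_flip (a : Diagram n) : (a * a.flip).through = a.through :=
  le_antisymm (through_mul_le _ _) (by
    have := through_mul_le (a * a.flip) a
    rwa [flip_regular] at this)

end DiagramGreen

/-! ### Green's relations of the cyclic Motzkin monoid -/

section CyclicGreen

variable {m n : ℕ}

instance [NeZero m] : Finite (CyclicMotzkin m n) :=
  Finite.of_injective (fun x : CyclicMotzkin m n => (x.skeleton, x.count)) fun _ _ h =>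
    CDiagram.ext (congrArg Prod.fst h) (congrArg Prod.snd h)

/-- The central element which adds `g` internal components. -/
def shift (g : ZMod m) : CyclicMotzkin m n := ⟨1, g⟩

theorem shift_mul (g : ZMod m) (x : CyclicMotzkin m n) :
    shift g * x = ⟨x.skeleton, g + x.count⟩ := by
  ext1
  · exact one_mul _
  · change g + x.count + ((internal (1 : Diagram n).rel _ : ℕ) : ZMod m) = _
    rw [Diagram.one_rel, internal_id_left, Nat.cast_zero, add_zero]

theorem mul_shift (g : ZMod m) (x : CyclicMotzkin m n) : x * shift g = shift g * x := by
  rw [shift_mul]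
  ext1
  · exact mul_one _
  · change x.count + g + ((internal _ (1 : Diagram n).rel : ℕ) : ZMod m) = _
    rw [Diagram.one_rel, internal_id_right, Nat.cast_zero, add_zero, add_comm]

theorem shift_zero : shift 0 = (1 : CyclicMotzkin m n) := rfl

theorem shift_add (g h : ZMod m) : (shift (g + h) : CyclicMotzkin m n) = shift g * shift h := by
  rw [shift_mul]; rfl

/-- The count lives in a group, so the difference can be supplied by a central unit. Consequently
the cell orders cannot see the count. -/
theorem eq_shift_mul {x y : CyclicMotzkin m n} (h : x.skeleton = y.skeleton) :
    y = shift (y.count - x.count) * x := by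
  rw [shift_mul]
  ext1
  · exact h.symm
  · simp

theorem leL_iff {x y : CyclicMotzkin m n} : leL x y ↔ leL x.skeleton y.skeleton := by
  constructor
  · rintro ⟨c, rfl⟩
    exact ⟨c.skeleton, rfl⟩
  · rintro ⟨c, hc⟩
    -- Lift the factor of the skeletons with count zero and correct the resulting count by a shift.
    refine ⟨shift (y.count - ((⟨c, 0⟩ : CyclicMotzkin m n) * x).count) * ⟨c, 0⟩, ?_⟩
    rw [mul_assoc]
    exact eq_shift_mul hc.symm

theorem leR_iff {x y : CyclicMotzkin m n} : leR x y ↔ leR x.skeleton y.skeleton := by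
  constructor
  · rintro ⟨c, rfl⟩
    exact ⟨c.skeleton, rfl⟩
  · rintro ⟨c, hc⟩
    refine ⟨⟨c, 0⟩ * shift (y.count - (x * (⟨c, 0⟩ : CyclicMotzkin m n)).count), ?_⟩
    rw [← mul_assoc, mul_shift]
    exact eq_shift_mul hc.symm

theorem leJ_iff_skeleton {x y : CyclicMotzkin m n} : leJ x y ↔ leJ x.skeleton y.skeleton := by
  constructor
  · rintro ⟨c, d, rfl⟩
    exact ⟨c.skeleton, d.skeleton, rfl⟩
  · rintro ⟨c, d, hc⟩
    exact leJ_trans (leL_mul (⟨c, 0⟩ : CyclicMotzkin m n) x).leJ (leR_iff.mpr ⟨d, hc⟩).leJ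

theorem leJ_iff_through {x y : CyclicMotzkin m n} : leJ x y ↔ y.through ≤ x.through :=
  leJ_iff_skeleton.trans Diagram.leJ_iff

theorem simJ_iff_through {x y : CyclicMotzkin m n} : simJ x y ↔ x.through = y.through := by
  rw [simJ, leJ_iff_through, leJ_iff_through]
  omega

theorem simL_iff {x y : CyclicMotzkin m n} : simL x y ↔ simL x.skeleton y.skeleton :=
  and_congr leL_iff leL_iff

theorem simR_iff {x y : CyclicMotzkin m n} : simR x y ↔ simR x.skeleton y.skeleton :=
  and_congr leR_iff leR_iff

theorem simH_iff {x y : CyclicMotzkin m n} : simH x y ↔ x.skeleton = y.skeleton := by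
  rw [← Diagram.simH_iff]
  exact and_congr simL_iff simR_iff

theorem card_diagram_simH (x : Diagram n) : Nat.card {y : Diagram n // simH y x} = 1 := by
  rw [Nat.card_eq_one_iff_unique]
  refine ⟨⟨fun y z => Subtype.ext ?_⟩, ⟨⟨x, simH_refl x⟩⟩⟩
  rw [Diagram.simH_iff.mp y.2, Diagram.simH_iff.mp z.2]

theorem card_simH (x : CyclicMotzkin m n) : Nat.card {y : CyclicMotzkin m n // simH y x} = m := by
  have : {y : CyclicMotzkin m n // simH y x} ≃ ZMod m :=
    { toFun := fun y => y.1.count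
      invFun := fun g => ⟨⟨x.skeleton, g⟩, simH_iff.mpr rfl⟩
      left_inv := fun y => Subtype.ext (CDiagram.ext (simH_iff.mp y.2).symm rfl)
      right_inv := fun _ => rfl }
  rw [Nat.card_congr this, Nat.card_zmod]

/-- The idempotent over an idempotent diagram. -/
theorem isIdempotentElem_over {a : Diagram n} (ha : IsIdempotentElem a) :
    IsIdempotentElem (⟨a, -(internal a.rel a.rel : ZMod m)⟩ : CyclicMotzkin m n) := by
  ext1
  · exact ha
  -- The count `c = -Φ(a,a)` is the solution of `c + c + Φ(a,a) = c`.
  · rw [CDiagram.mul_count]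
    ring

theorem exists_idempotent_iff (x : CyclicMotzkin m n) :
    (∃ y, simH y x ∧ IsIdempotentElem y) ↔ ∃ y, simH y x.skeleton ∧ IsIdempotentElem y := by
  constructor
  · rintro ⟨y, hy, h⟩
    exact ⟨y.skeleton, Diagram.simH_iff.mpr (simH_iff.mp hy), congrArg CDiagram.skeleton h⟩
  · rintro ⟨y, hy, h⟩
    exact ⟨⟨y, _⟩, simH_iff.mpr (Diagram.simH_iff.mp hy), isIdempotentElem_over h⟩

/-- The isomorphism `ℤ/m ≅ H(e)`. -/
noncomputable def cyclicHCell (e : Idem (CyclicMotzkin m n)) :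
    Multiplicative (ZMod m) ≃* HCell e where
  toFun g := ⟨shift g.toAdd * e.1, simH_iff.mpr (by rw [shift_mul])⟩
  invFun y := Multiplicative.ofAdd (y.1.count - e.1.count)
  left_inv g := by
    change Multiplicative.ofAdd ((shift g.toAdd * e.1).count - e.1.count) = g
    rw [shift_mul]
    simp
  right_inv y := Subtype.ext (eq_shift_mul (simH_iff.mp y.2).symm).symm
  map_mul' g h := Subtype.ext (by
    change shift (g * h).toAdd * e.1 = shift g.toAdd * e.1 * (shift h.toAdd * e.1)
    rw [toAdd_mul, shift_add]
    simp only [mul_assoc]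
    rw [← mul_assoc e.1, mul_shift _ e.1, mul_assoc _ e.1, e.2.eq])

theorem coe_cyclicHCell (e : Idem (CyclicMotzkin m n)) (g : Multiplicative (ZMod m)) :
    (cyclicHCell e g : CyclicMotzkin m n) = shift g.toAdd * e.1 := rfl

/-- The element over `a * a.flip` with the corrected count; it is invariant under reflection and has
`a` in its right cell because `a a^* a = a`. -/
theorem exists_idem_over (a : Diagram n) :
    ∃ e : Idem (CyclicMotzkin m n), simR e.1.skeleton a ∧ e.1.flip = e.1 ∧
      e.1.through = a.through := by
  refine ⟨⟨_, isIdempotentElem_over a.mul_flip_idem⟩, ?_, ?_, ?_⟩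
  · refine ⟨⟨a, a.flip_regular.symm⟩, ⟨a.flip, rfl⟩⟩
  · refine CDiagram.ext ?_ rfl
    change (a * a.flip).flip = a * a.flip
    rw [Diagram.flip_mul, Diagram.flip_flip]
  · exact a.through_mul_flip

theorem exists_idem_through {j : ℕ} (hj : j ≤ n) :
    ∃ e : Idem (CyclicMotzkin m n), e.1.through = j := by
  have : j ≤ (Finset.univ : Finset (Fin n)).card := by simpa using hj
  obtain ⟨s, -, hs⟩ := Finset.exists_subset_card_eq this
  obtain ⟨e, -, -, he⟩ := exists_idem_over (m := m) (Diagram.pid s)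
  exact ⟨e, by rw [he, Diagram.pid_through, hs]⟩

end CyclicGreen

end Motz

namespace Motz

/-! ### The simple representations of the cyclic Motzkin monoid -/

section Classification

open scoped TensorProduct Classical

variable {K : Type u} [Field K] {m n : ℕ}

theorem of_idem_smul_simpleMk {S : Type} [Monoid S] {e : Idem S} {G : Type} [Monoid G] {W : Type u}
    [AddCommGroup W] [Module K W] (φ : G ≃* HCell e) (σ : Representation K G W) (w : W) :
    MonoidAlgebra.of K S e.1 • simpleMk φ σ w = simpleMk φ σ w := by
  have := of_smul_simpleMk φ σ 1 w
  rwa [map_one, map_one] at this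

theorem of_shift_smul_simpleMk (e : Idem (CyclicMotzkin m n)) {W : Type u} [AddCommGroup W]
    [Module K W] (σ : Representation K (Multiplicative (ZMod m)) W) (g : Multiplicative (ZMod m))
    (w : W) : MonoidAlgebra.of K (CyclicMotzkin m n) (shift g.toAdd) • simpleMk (cyclicHCell e) σ w =
      simpleMk (cyclicHCell e) σ (σ g w) := by
  rw [← of_smul_simpleMk, coe_cyclicHCell, map_mul, mul_smul, of_idem_smul_simpleMk]

theorem of_smul_comm_shift {X : Type*} [AddCommGroup X] [Module (MonoidAlgebra K (CyclicMotzkin m n)) X]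
    (g : ZMod m) (s : CyclicMotzkin m n) (v : X) :
    MonoidAlgebra.of K (CyclicMotzkin m n) s • MonoidAlgebra.of K (CyclicMotzkin m n) (shift g) • v =
      MonoidAlgebra.of K (CyclicMotzkin m n) (shift g) • MonoidAlgebra.of K (CyclicMotzkin m n) s • v := by
  rw [← mul_smul, ← mul_smul, ← map_mul, ← map_mul, mul_shift]

/-- Injective linear maps with the same range have isomorphic sources. -/
theorem exists_equiv_of_range {W W' X : Type*} [AddCommGroup W] [Module K W] [AddCommGroup W']
    [Module K W'] [AddCommGroup X] [Module K X] (f : W →ₗ[K] X) (g : W' →ₗ[K] X)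
    (hf : Function.Injective f) (hg : Function.Injective g) (h : ∀ w, ∃ w', g w' = f w)
    (h' : ∀ w', ∃ w, f w = g w') : ∃ θ : W ≃ₗ[K] W', ∀ w, g (θ w) = f w := by
  have hr : LinearMap.range f = LinearMap.range g := by
    ext x
    constructor
    · rintro ⟨w, rfl⟩; exact h w
    · rintro ⟨w, rfl⟩; exact h' w
  refine ⟨(LinearEquiv.ofInjective f hf).trans ((LinearEquiv.ofEq _ _ hr).trans
    (LinearEquiv.ofInjective g hg).symm), fun w => ?_⟩
  have := (LinearEquiv.ofInjective g hg).apply_symm_apply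
    (LinearEquiv.ofEq _ _ hr (LinearEquiv.ofInjective f hf w))
  exact congrArg Subtype.val this

theorem isApex_congr {S : Type} [Monoid S] {M N : Type u} [AddCommGroup M] [AddCommGroup N]
    [Module (MonoidAlgebra K S) M] [Module (MonoidAlgebra K S) N] (f : M ≃ₗ[MonoidAlgebra K S] N)
    (J : JCell S) : IsApex K M J ↔ IsApex K N J := by
  have : ∀ s : S, (∃ v : M, MonoidAlgebra.of K S s • v ≠ 0) ↔
      ∃ v : N, MonoidAlgebra.of K S s • v ≠ 0 := by
    intro s
    constructor
    · rintro ⟨v, hv⟩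
      exact ⟨f v, by rw [← map_smul]; exact fun h => hv (f.map_eq_zero_iff.mp h)⟩
    · rintro ⟨v, hv⟩
      exact ⟨f.symm v, by rw [← map_smul]; exact fun h => hv (f.symm.map_eq_zero_iff.mp h)⟩
  simp only [IsApex, exists_and_left, this]

variable [NeZero m]

/-- The apex is an isomorphism invariant, so the idempotents are `J`-equivalent and there are `p`,
`q` with `p q = e` and `q p = e'`. Then `q` carries the image of `e` bijectively onto that of `e'`,
and it commutes with the central shifts through which `ℤ/m` acts. -/
theorem simpleRep_equiv_forward (e e' : Idem (CyclicMotzkin m n)) {W W' : Type u} [AddCommGroup W]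
    [Module K W] [AddCommGroup W'] [Module K W'] (σ : Representation K (Multiplicative (ZMod m)) W)
    (σ' : Representation K (Multiplicative (ZMod m)) W') (hσ : σ.IsIrreducible)
    (hσ' : σ'.IsIrreducible)
    (f : simpleRep K (cyclicHCell e) σ ≃ₗ[MonoidAlgebra K (CyclicMotzkin m n)]
      simpleRep K (cyclicHCell e') σ') :
    e.1.through = e'.1.through ∧ Nonempty (σ.Equiv σ') := by
  have hJ : simJ e.1 e'.1 := by
    rw [← jcell_eq, ← isApex_simpleRep_iff (cyclicHCell e') σ' hσ', ← isApex_congr f,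
      isApex_simpleRep_iff (cyclicHCell e) σ hσ]
  refine ⟨simJ_iff_through.mp hJ, ?_⟩
  obtain ⟨p, q, hpq, hqp, hep, heq⟩ := exists_isomorphism e.2 e'.2 hJ
  let A := MonoidAlgebra.of K (CyclicMotzkin m n)
  let g : W →ₗ[K] simpleRep K (cyclicHCell e') σ' :=
    Algebra.lsmul K K _ (A q) ∘ₗ (f.toLinearMap.restrictScalars K) ∘ₗ simpleMk (cyclicHCell e) σ
  have hg : ∀ w, g w = A q • f (simpleMk (cyclicHCell e) σ w) := fun _ => rfl
  have hp : ∀ w, A p • g w = f (simpleMk (cyclicHCell e) σ w) := fun w => by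
    rw [hg, ← mul_smul, ← map_mul, hpq, ← map_smul, of_idem_smul_simpleMk]
  -- Both maps have the image of `e'` as their range: `e' q = q` gives one inclusion, and `q (p w')
  -- = e' w' = w'` the other.
  obtain ⟨θ, hθ⟩ := exists_equiv_of_range g (simpleMk (cyclicHCell e') σ')
    (fun w w' h => simpleMk_injective (cyclicHCell e) σ hσ (f.injective (by
      rw [← hp, ← hp, h])))
    (simpleMk_injective (cyclicHCell e') σ' hσ')
    (fun w => by
      obtain ⟨w', hw'⟩ := range_simpleMk (cyclicHCell e') σ' hσ' (g w)
      refine ⟨w', hw'.symm.trans ?_⟩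
      rw [hg, ← mul_smul, ← map_mul, heq])
    (fun w' => by
      obtain ⟨w, hw⟩ := range_simpleMk (cyclicHCell e) σ hσ
        (f.symm (A p • simpleMk (cyclicHCell e') σ' w'))
      refine ⟨w, ?_⟩
      rw [hg, ← hw, map_smul, f.apply_symm_apply, ← mul_smul, ← mul_smul, ← map_mul, ← map_mul,
        mul_assoc, hep, hqp, of_idem_smul_simpleMk])
  refine ⟨Representation.Equiv.mk θ fun a => LinearMap.ext fun w => ?_⟩
  refine simpleMk_injective (cyclicHCell e') σ' hσ' ?_
  change simpleMk (cyclicHCell e') σ' (θ (σ a w)) = simpleMk (cyclicHCell e') σ' (σ' a (θ w))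
  rw [hθ, ← of_shift_smul_simpleMk, hθ, hg, hg, ← of_shift_smul_simpleMk, map_smul,
    of_smul_comm_shift]

/-- Transport `W` by `w ↦ p · θ w` into the image of `e` on the second simple module; it intertwines
the two actions since shifts are central, and then the characterisation by apex and image applies.
-/
theorem simpleRep_equiv_backward (e e' : Idem (CyclicMotzkin m n)) {W W' : Type u} [AddCommGroup W]
    [Module K W] [AddCommGroup W'] [Module K W'] (σ : Representation K (Multiplicative (ZMod m)) W)
    (σ' : Representation K (Multiplicative (ZMod m)) W') (hσ : σ.IsIrreducible)
    (hσ' : σ'.IsIrreducible) (h : e.1.through = e'.1.through) (θ : σ.Equiv σ') :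
    Nonempty (simpleRep K (cyclicHCell e) σ ≃ₗ[MonoidAlgebra K (CyclicMotzkin m n)]
      simpleRep K (cyclicHCell e') σ') := by
  have hJ : simJ e.1 e'.1 := simJ_iff_through.mpr h
  obtain ⟨p, q, hpq, hqp, hep, heq⟩ := exists_isomorphism e.2 e'.2 hJ
  let A := MonoidAlgebra.of K (CyclicMotzkin m n)
  have hs := simpleRep_isSimpleModule (cyclicHCell e') σ' hσ'
  let j : W →ₗ[K] simpleRep K (cyclicHCell e') σ' :=
    Algebra.lsmul K K _ (A p) ∘ₗ simpleMk (cyclicHCell e') σ' ∘ₗ θ.toLinearMap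
  have hj : ∀ w, j w = A p • simpleMk (cyclicHCell e') σ' (θ w) := fun _ => rfl
  refine nonempty_simpleRep_equiv (cyclicHCell e) σ hσ j ?_ ?_ ?_
  · intro h0
    obtain ⟨w, hw⟩ := @exists_ne W (irreducible_nontrivial σ hσ) 0
    have h1 : A q • j w = 0 := by rw [h0, LinearMap.zero_apply, smul_zero]
    rw [hj, ← mul_smul, ← map_mul, hqp, of_idem_smul_simpleMk] at h1
    refine simpleMk_ne_zero (cyclicHCell e') σ' hσ' ?_ h1
    exact fun h2 => hw (θ.toLinearEquiv.map_eq_zero_iff.mp h2)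
  · intro g w
    have h1 : θ (σ g w) = σ' g (θ w) := θ.toIntertwiningMap.isIntertwining _ _ g w
    rw [coe_cyclicHCell, hj, hj, ← mul_smul, ← map_mul, mul_assoc, hep, map_mul, mul_smul, h1,
      ← of_shift_smul_simpleMk, of_smul_comm_shift]
  · intro s hs
    exact smul_simpleRep_eq_zero (cyclicHCell e') σ' fun h => hs (leJ_trans h hJ.2)

/-- The apex is found as the least number of through strands of an element that does not annihilate
`V`. With `e` an idempotent of that number, `e V` is nonzero and irreducible under `H(e)`, because
every other element of `e S e` acts by zero. -/
theorem exists_simpleRep_equiv (V : Type u) [AddCommGroup V]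
    [Module (MonoidAlgebra K (CyclicMotzkin m n)) V]
    [IsSimpleModule (MonoidAlgebra K (CyclicMotzkin m n)) V] :
    ∃ (e : Idem (CyclicMotzkin m n)) (W : Type u) (_ : AddCommGroup W) (_ : Module K W)
      (σ : Representation K (Multiplicative (ZMod m)) W), σ.IsIrreducible ∧
        Nonempty (V ≃ₗ[MonoidAlgebra K (CyclicMotzkin m n)]
          simpleRep K (cyclicHCell e) σ) := by
  let A := MonoidAlgebra.of K (CyclicMotzkin m n)
  let _ : Module K V := Module.compHom V (algebraMap K (MonoidAlgebra K (CyclicMotzkin m n)))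
  have : IsScalarTower K (MonoidAlgebra K (CyclicMotzkin m n)) V :=
    IsScalarTower.of_algebraMap_smul fun _ _ => rfl
  have hex : ∃ j : ℕ, ∃ s : CyclicMotzkin m n, s.through = j ∧ ∃ v : V, A s • v ≠ 0 := by
    have := IsSimpleModule.nontrivial (MonoidAlgebra K (CyclicMotzkin m n)) V
    obtain ⟨v, hv⟩ := exists_ne (0 : V)
    exact ⟨_, 1, rfl, v, by rwa [map_one, one_smul]⟩
  obtain ⟨s, hs, v, hv⟩ := Nat.find_spec hex
  have hmin : ∀ t : CyclicMotzkin m n, t.through < Nat.find hex → ∀ v : V, A t • v = 0 := by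
    intro t ht v
    by_contra h
    exact Nat.find_min hex ht ⟨t, rfl, v, h⟩
  obtain ⟨e, he⟩ : ∃ e : Idem (CyclicMotzkin m n), e.1.through = Nat.find hex :=
    exists_idem_through (hs ▸ s.skeleton.through_le)
  have hkill : ∀ t, ¬ leJ t e.1 → ∀ v : V, A t • v = 0 := by
    intro t ht
    rw [leJ_iff_through, he, not_le] at ht
    exact hmin t ht
  -- The chosen `s` with nonzero action factors through `e`, so `e` cannot act by zero.
  have hev : ∃ v : V, A e.1 • v ≠ 0 := by
    obtain ⟨c, d, hcd⟩ : leJ e.1 s := leJ_iff_through.mpr (by rw [hs, he])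
    refine ⟨A d • v, fun h => hv ?_⟩
    rw [hcd, map_mul, map_mul, mul_smul, mul_smul, h, smul_zero]
  let W : Submodule K V := LinearMap.range (Algebra.lsmul K K V (A e.1))
  have hW : ∀ w ∈ W, A e.1 • w = w := by
    rintro _ ⟨v, rfl⟩
    change A e.1 • A e.1 • v = A e.1 • v
    rw [← mul_smul, ← map_mul, e.2.eq]
  have hmem : ∀ v, A e.1 • v ∈ W := fun v => ⟨v, rfl⟩
  have hstab : ∀ (g : ZMod m), ∀ w ∈ W, Algebra.lsmul K K V (A (shift g)) w ∈ W := by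
    rintro g _ ⟨v, rfl⟩
    exact ⟨A (shift g) • v, of_smul_comm_shift g e.1 v⟩
  let σ : Representation K (Multiplicative (ZMod m)) W :=
    { toFun := fun g => (Algebra.lsmul K K V (A (shift g.toAdd))).restrict (hstab g.toAdd)
      map_one' := by
        ext w
        change A (shift 0) • w.1 = w.1
        rw [shift_zero, map_one, one_smul]
      map_mul' := fun g h => by
        ext w
        change A (shift (g.toAdd + h.toAdd)) • w.1 = A (shift g.toAdd) • A (shift h.toAdd) • w.1
        rw [shift_add, map_mul, mul_smul] }
  have hσ : ∀ g w, (σ g w : V) = A (shift g.toAdd) • (w : V) := fun g w => rfl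
  have : Nontrivial W := by
    obtain ⟨v, hv⟩ := hev
    exact ⟨⟨⟨_, hmem v⟩, 0, fun h => hv (congrArg Subtype.val h)⟩⟩
  have hirr : σ.IsIrreducible := by
    refine irreducible_of_submodule σ fun U hU => or_iff_not_imp_left.mpr fun hU0 => ?_
    obtain ⟨u, hu, hu0⟩ := U.exists_mem_ne_zero_of_ne_bot hU0
    -- By linearity take `a = t` in the monoid. Then `e t u = (e t e) u`, and `e t e` either lies in
    -- `H(e)`, where it acts as a shift, or has too few through strands and acts by zero.
    have key : ∀ a : MonoidAlgebra K (CyclicMotzkin m n),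
        (⟨A e.1 • a • u.1, hmem _⟩ : W) ∈ U := by
      intro a
      induction a using MonoidAlgebra.induction_on with
      | of t =>
        have h1 : A e.1 • A t • u.1 = A (e.1 * t * e.1) • u.1 := by
          rw [map_mul, map_mul, mul_smul, mul_smul, hW _ u.2]
        by_cases ht : leJ (e.1 * t * e.1) e.1
        · have hH : simH (e.1 * t * e.1) e.1 :=
            simH_of_leJ ⟨_, rfl⟩ ⟨t * e.1, mul_assoc _ _ _⟩ ht
          obtain ⟨g, hg⟩ := (cyclicHCell e).surjective ⟨_, hH⟩
          have hg' : e.1 * t * e.1 = shift g.toAdd * e.1 := (congrArg Subtype.val hg).symm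
          have h2 : (⟨A e.1 • A t • u.1, hmem _⟩ : W) = σ g u := by
            refine Subtype.ext ?_
            change A e.1 • A t • u.1 = _
            rw [hσ, h1, hg', map_mul, mul_smul, hW _ u.2]
          exact h2 ▸ hU g u hu
        · have h2 : (⟨A e.1 • A t • u.1, hmem _⟩ : W) = 0 :=
            Subtype.ext (h1.trans (hkill _ ht _))
          exact h2 ▸ U.zero_mem
      | add a b ha hb =>
        have h2 : (⟨A e.1 • (a + b) • u.1, hmem _⟩ : W) =
            ⟨A e.1 • a • u.1, hmem _⟩ + ⟨A e.1 • b • u.1, hmem _⟩ :=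
          Subtype.ext (by simp only [add_smul, smul_add, Submodule.coe_add])
        exact h2 ▸ U.add_mem ha hb
      | smul c a ha =>
        have h2 : (⟨A e.1 • (c • a) • u.1, hmem _⟩ : W) = c • ⟨A e.1 • a • u.1, hmem _⟩ :=
          Subtype.ext (by
            change A e.1 • (c • a) • u.1 = c • A e.1 • a • u.1
            rw [smul_assoc]
            exact ((Algebra.lsmul K K V (A e.1)).map_smul c _))
        exact h2 ▸ U.smul_mem c ha
    rw [eq_top_iff]
    rintro ⟨_, v, rfl⟩ -
    -- Simplicity of `V`: every vector is `a u`, so every element `e v` of `W` has the form `e a u`.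
    have h3 : Submodule.span (MonoidAlgebra K (CyclicMotzkin m n)) {u.1} = ⊤ :=
      (eq_bot_or_eq_top _).resolve_left (by
        rw [Submodule.span_singleton_eq_bot]
        exact fun h => hu0 (Subtype.ext h))
    obtain ⟨a, ha⟩ := Submodule.mem_span_singleton.mp (h3 ▸ Submodule.mem_top : v ∈ _)
    subst ha
    exact key a
  refine ⟨e, W, inferInstance, inferInstance, σ, hirr, ?_⟩
  obtain ⟨f⟩ := nonempty_simpleRep_equiv (cyclicHCell e) σ hirr (X := V) W.subtype
    (fun h0 => by
      obtain ⟨w, hw⟩ := exists_ne (0 : W)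
      exact hw (Subtype.ext (LinearMap.congr_fun h0 w)))
    (fun g w => by
      rw [coe_cyclicHCell, map_mul, mul_smul]
      exact congrArg _ (hW w.1 w.2))
    hkill
  exact ⟨f.symm⟩

end Classification

end Motz

namespace Motz

/-! ### Comparison with the Motzkin algebra -/

section Comparison

open scoped TensorProduct Classical

variable {K : Type u} [Field K] {m n : ℕ}

theorem cellRep_single (ζ : K) (x : Diagram n) (s : CDiagram ℕ n) (l : LCell x) :
    cellRep K ζ x s (Finsupp.single l 1) =
      if h : simL (s.skeleton * l.1) x then
        Finsupp.single ⟨s.skeleton * l.1, h⟩ (ζ ^ (s.count + internal s.skeleton.rel l.1.rel))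
      else 0 :=
  (Finsupp.linearCombination_single _ _ _).trans (one_smul _ _)

theorem finrank_one_eq_bot_or_top {W : Type*} [AddCommGroup W] [Module K W]
    (hW : Module.finrank K W = 1) (U : Submodule K W) : U = ⊥ ∨ U = ⊤ := by
  have := isSimpleModule_iff_finrank_eq_one.mpr hW
  exact eq_bot_or_eq_top U

section Data

variable (ζ : K) (hζ : ζ ≠ 0) (x : Diagram n) (e : CDiagram ℕ n)
  (he : cellRep K ζ x e * cellRep K ζ x e = cellRep K ζ x e)
  (he' : IsIdempotentElem e.skeleton) (l₀ : LCell x) (hl₀ : simR e.skeleton l₀.1)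
include hζ he he' hl₀

/-- `e` multiplies `l₀` by a power of `ζ`, which is nonzero; as `e` acts idempotently this scalar is
`1`. -/
theorem cellRep_idem_single :
    cellRep K ζ x e (Finsupp.single l₀ 1) = Finsupp.single l₀ 1 := by
  have h1 : e.skeleton * l₀.1 = l₀.1 := leR.mul_left_eq he' hl₀.1
  have h2 : ∃ c : K, c ≠ 0 ∧ cellRep K ζ x e (Finsupp.single l₀ 1) = c • Finsupp.single l₀ 1 := by
    refine ⟨ζ ^ (e.count + internal e.skeleton.rel l₀.1.rel), pow_ne_zero _ hζ, ?_⟩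
    rw [cellRep_single, dif_pos (by rw [h1]; exact l₀.2), Finsupp.smul_single, smul_eq_mul, mul_one]
    congr 1
    exact Subtype.ext h1
  obtain ⟨c, hc, h2⟩ := h2
  have h3 := LinearMap.congr_fun he (Finsupp.single l₀ 1)
  rw [Module.End.mul_apply, h2, map_smul, h2, smul_smul] at h3
  have h4 := DFunLike.congr_fun h3 l₀
  simp only [Finsupp.smul_single, smul_eq_mul, mul_one, Finsupp.single_eq_same] at h4
  rw [h2, mul_left_cancel₀ hc (h4.trans (mul_one c).symm), one_smul]

omit hζ he he' in
-- If `e l` stays in the left cell, it lies in the left cell and the right cell of `l₀`. `H`-cells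
-- of `Mo_n` are singletons, so `e l = l₀` and the image of `e` is contained in one line.
theorem cellRep_idem (v : LCell x →₀ K) :
    cellRep K ζ x e v = (cellRep K ζ x e v l₀) • Finsupp.single l₀ 1 := by
  suffices h : cellRep K ζ x e = (Finsupp.lapply l₀ ∘ₗ cellRep K ζ x e).smulRight
      (Finsupp.single l₀ 1) from LinearMap.congr_fun h v
  refine Finsupp.lhom_ext' fun l => LinearMap.ext_ring ?_
  change cellRep K ζ x e (Finsupp.single l 1) =
    (cellRep K ζ x e (Finsupp.single l 1) l₀) • Finsupp.single l₀ 1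
  rw [cellRep_single]
  split_ifs with h
  · have h1 : e.skeleton * l.1 = l₀.1 := by
      rw [← Diagram.simH_iff]
      refine ⟨h.trans l₀.2.symm, simR.trans ?_ hl₀⟩
      exact simR_of_leR (leR_mul _ _) ((h.trans l₀.2.symm).simJ.trans hl₀.symm.simJ).1
    have h2 : (⟨e.skeleton * l.1, h⟩ : LCell x) = l₀ := Subtype.ext h1
    rw [h2, Finsupp.single_eq_same, Finsupp.smul_single, smul_eq_mul, mul_one]
  · rw [Finsupp.zero_apply, zero_smul]

variable {W : Type*} [AddCommGroup W] [Module K W] (hW : Module.finrank K W = 1) (κ : W ≃ₗ[K] K)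
  {A M : Type*} [Ring A] [Algebra K A] [AddCommGroup M] [Module K M] [Module A M]
  [IsScalarTower K A M] (ι : M ≃ₗ[K] (LCell x →₀ K)) (α : CDiagram ℕ n → A)
  (hα : ∀ s v, ι (α s • v) = cellRep K ζ x s (ι v))
include hW hα

omit hζ he he' hl₀ hW hα in
variable (K) in
/-- The compression of the cell module to the image of `e`. -/
noncomputable def cellRetract : M →ₗ[K] W :=
  κ.symm.toLinearMap ∘ₗ Finsupp.lapply l₀ ∘ₗ cellRep K ζ x e ∘ₗ ι.toLinearMap

omit hζ he he' hl₀ hW hα in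
variable (K) in
/-- The inclusion of the image of `e`. -/
noncomputable def cellIncl : W →ₗ[K] M :=
  ι.symm.toLinearMap ∘ₗ Finsupp.lsingle l₀ ∘ₗ κ.toLinearMap

/-- Formulated for any algebra whose elements `α s` act on `M` by the cell representation, so that
one argument covers both the Motzkin algebra and the algebra of the cyclic monoid. The local
structure comes from the line through `l₀`. -/
theorem cellModule_isLocal :
    IsLocal (α e) (cellIncl K x l₀ κ ι) (cellRetract K ζ x e l₀ κ ι) where
  nontrivial := Module.nontrivial_of_finrank_pos (R := K) (by omega)
  retract w := by
    change κ.symm (cellRep K ζ x e (ι (ι.symm (Finsupp.single l₀ (κ w)))) l₀) = w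
    rw [LinearEquiv.apply_symm_apply, ← mul_one (κ w), ← smul_eq_mul, ← Finsupp.smul_single,
      map_smul, cellRep_idem_single ζ hζ x e he he' l₀ hl₀, Finsupp.smul_apply,
      Finsupp.single_eq_same, smul_eq_mul, mul_one, LinearEquiv.symm_apply_apply]
  smul_eq v := by
    refine ι.injective ?_
    rw [hα]
    change _ = ι (ι.symm (Finsupp.single l₀ (κ (κ.symm (cellRep K ζ x e (ι v) l₀)))))
    rw [LinearEquiv.apply_symm_apply, LinearEquiv.apply_symm_apply,
      cellRep_idem ζ x e l₀ hl₀, Finsupp.smul_apply, Finsupp.single_eq_same,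
      Finsupp.smul_single]
  generates P hP := by
    have h1 : ι.symm (Finsupp.single l₀ 1) ∈ P := by
      have := hP (κ.symm 1)
      change ι.symm (Finsupp.single l₀ (κ (κ.symm 1))) ∈ P at this
      rwa [LinearEquiv.apply_symm_apply] at this
    have key : ∀ l, ∃ p ∈ P, ∃ c : K, c ≠ 0 ∧ ι p = Finsupp.single l c := by
      intro l
      -- Both `l` and `l₀` lie in the left cell, so `l = s l₀`, and `s` sends `l₀` to a nonzero
      -- multiple of `l`.
      obtain ⟨s, hs⟩ := (l₀.2.trans l.2.symm).1
      refine ⟨_, P.smul_mem (α ⟨s, 0⟩) h1, ζ ^ (0 + internal s.rel l₀.1.rel), pow_ne_zero _ hζ, ?_⟩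
      rw [hα, LinearEquiv.apply_symm_apply, cellRep_single]
      change (if h : simL (s * l₀.1) x then _ else _) = _
      rw [dif_pos (by rw [← hs]; exact l.2)]
      congr 1
      exact Subtype.ext hs.symm
    have key2 : ∀ u : LCell x →₀ K, ι.symm u ∈ P.restrictScalars K := by
      intro u
      induction u using Finsupp.induction_linear with
      | zero => rw [map_zero]; exact zero_mem _
      | add u v hu hv => rw [map_add]; exact add_mem hu hv
      | single l c =>
        obtain ⟨p, hp, d, hd, hpd⟩ := key l
        have : ι.symm (Finsupp.single l c) = (c * d⁻¹) • p := by
          rw [LinearEquiv.symm_apply_eq, map_smul, hpd, Finsupp.smul_single, smul_eq_mul,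
            inv_mul_cancel_right₀ hd]
        rw [this]
        exact Submodule.smul_mem _ _ hp
    rw [eq_top_iff]
    intro v _
    have := key2 (ι v)
    rwa [LinearEquiv.symm_apply_apply] at this
  irreducible U _ := finrank_one_eq_bot_or_top hW U

omit hζ he he' hl₀ hW hα in
/-- The radical of the cell module. -/
noncomputable def cellRadical : Submodule K (LCell x →₀ K) :=
  ⨅ s, LinearMap.ker (Finsupp.lapply l₀ ∘ₗ cellRep K ζ x e ∘ₗ cellRep K ζ x s)

include κ in
-- The radical is the core of the retraction to the line, and once the `α s` span `A` the conditions
-- defining it involve only the operators of diagrams. Hence the dimension of the head does not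
-- depend on `A`.
theorem finrank_head_cellModule (hspan : ∀ a : A, a ∈ Submodule.span K (Set.range α)) :
    Module.finrank K (Head A M) =
      Module.finrank K ((LCell x →₀ K) ⧸ cellRadical ζ x e l₀) := by
  have hloc := cellModule_isLocal ζ hζ x e he he' l₀ hl₀ hW κ ι α hα
  have h1 : ∀ v, v ∈ Module.jacobson A M ↔ ι v ∈ cellRadical ζ x e l₀ := by
    intro v
    have hr : ∀ s, cellRetract K ζ x e l₀ κ ι (α s • v) =
        κ.symm (cellRep K ζ x e (cellRep K ζ x s (ι v)) l₀) := by
      intro s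
      rw [← hα]
      rfl
    rw [hloc.jacobson_eq, cellRadical, Submodule.mem_iInf]
    constructor
    · intro hv s
      have h2 := hv (α s)
      rw [hr, LinearEquiv.map_eq_zero_iff] at h2
      exact h2
    · intro hv a
      induction hspan a using Submodule.span_induction with
      | mem a ha =>
        obtain ⟨s, rfl⟩ := ha
        rw [hr, LinearEquiv.map_eq_zero_iff]
        exact hv s
      | zero => rw [zero_smul, map_zero]
      | add a b _ _ ha hb => rw [add_smul, map_add, ha, hb, add_zero]
      | smul c a _ ha => rw [smul_assoc, map_smul, ha, smul_zero]
  have h2 : ((Module.jacobson A M).restrictScalars K).map ι.toLinearMap =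
      cellRadical ζ x e l₀ := by
    ext u
    constructor
    · rintro ⟨v, hv, rfl⟩
      exact (h1 v).mp hv
    · intro hu
      exact ⟨ι.symm u, (h1 _).mpr (by rwa [LinearEquiv.apply_symm_apply]), ι.apply_symm_apply u⟩
  rw [← (Submodule.Quotient.restrictScalarsEquiv K (Module.jacobson A M)).finrank_eq]
  exact (Submodule.Quotient.equiv _ _ ι h2).finrank_eq

end Data

/-- Since `ζ ^ m = 1`, exponents matter only modulo `m`; this lets the cell representation descend
to the cyclic monoid. -/
theorem cellRep_congr {ζ : K} (hζ : ζ ^ m = 1) (x : Diagram n) (a : Diagram n) {c d : ℕ}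
    (h : (c : ZMod m) = d) : cellRep K ζ x ⟨a, c⟩ = cellRep K ζ x ⟨a, d⟩ := by
  have h1 : ζ ^ c = ζ ^ d := by
    rw [ZMod.natCast_eq_natCast_iff] at h
    rw [pow_eq_pow_mod c hζ, pow_eq_pow_mod d hζ, h]
  refine Finsupp.lhom_ext' fun l => LinearMap.ext_ring ?_
  change cellRep K ζ x ⟨a, c⟩ (Finsupp.single l 1) = cellRep K ζ x ⟨a, d⟩ (Finsupp.single l 1)
  rw [cellRep_single, cellRep_single]
  simp only [pow_add, h1]

section

variable [NeZero m]

/-- The cell module as a representation of the cyclic Motzkin monoid, where `1 ∈ ℤ/m` acts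
by `ζ`. -/
noncomputable def cyclicCellRep {ζ : K} (hζ : ζ ^ m = 1) (x : Diagram n) :
    Representation K (CyclicMotzkin m n) (LCell x →₀ K) where
  toFun s := cellRep K ζ x ⟨s.skeleton, s.count.val⟩
  map_one' := by
    change cellRep K ζ x ⟨1, (0 : ZMod m).val⟩ = 1
    rw [ZMod.val_zero]
    exact map_one _
  map_mul' s t := by
    rw [← map_mul]
    refine cellRep_congr hζ x _ ?_
    simp [CDiagram.mul_count]

theorem cyclicCellRep_natCast {ζ : K} (hζ : ζ ^ m = 1) (x : Diagram n) (s : CDiagram ℕ n) :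
    cyclicCellRep hζ x ⟨s.skeleton, (s.count : ZMod m)⟩ = cellRep K ζ x s :=
  cellRep_congr hζ x _ (by simp)

theorem cyclicCellRep_shift {ζ : K} (hζ : ζ ^ m = 1) (x : Diagram n) (g : ZMod m)
    (v : LCell x →₀ K) : cyclicCellRep hζ x (shift g) v = ζ ^ g.val • v := by
  suffices h : cyclicCellRep hζ x (shift g) = ζ ^ g.val • LinearMap.id from
    LinearMap.congr_fun h v
  refine Finsupp.lhom_ext' fun l => LinearMap.ext_ring ?_
  change cellRep K ζ x ⟨1, g.val⟩ (Finsupp.single l 1) = ζ ^ g.val • Finsupp.single l 1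
  rw [cellRep_single]
  simp only [one_mul, l.2, dif_pos, Diagram.one_rel, internal_id_left, add_zero,
    Finsupp.smul_single, smul_eq_mul, mul_one]

theorem cyclicCellRep_eq_zero {ζ : K} (hζ : ζ ^ m = 1) (x : Diagram n) (s : CyclicMotzkin m n)
    (hs : ¬ leJ s.skeleton x) : cyclicCellRep hζ x s = 0 := by
  refine Finsupp.lhom_ext' fun l => LinearMap.ext_ring ?_
  change cellRep K ζ x ⟨s.skeleton, s.count.val⟩ (Finsupp.single l 1) = 0
  rw [cellRep_single, dif_neg]
  exact fun h => hs (leJ_trans (leR_mul _ _).leJ h.1.leJ)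

theorem rep_ofAdd_one_pow {W : Type*} [AddCommGroup W] [Module K W]
    (σ : Representation K (Multiplicative (ZMod m)) W) {ζ : K}
    (hσ : ∀ w, σ (Multiplicative.ofAdd 1) w = ζ • w) (g : Multiplicative (ZMod m)) (w : W) :
    σ g w = ζ ^ g.toAdd.val • w := by
  have h1 : g = Multiplicative.ofAdd (1 : ZMod m) ^ g.toAdd.val := by
    rw [← ofAdd_nsmul, nsmul_one, ZMod.natCast_zmod_val]
    rfl
  have h2 : ∀ k : ℕ, σ (Multiplicative.ofAdd (1 : ZMod m) ^ k) w = ζ ^ k • w := by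
    intro k
    induction k with
    | zero => simp
    | succ k ih => rw [pow_succ', map_mul, Module.End.mul_apply, ih, map_smul, hσ, smul_smul,
        pow_succ]
  conv_lhs => rw [h1]
  exact h2 _

/-- The data comparing the two heads, for `x` and an idempotent with equally many through
strands. -/
theorem exists_cell_data {ζ : K} (hζ : ζ ^ m = 1) (x : Diagram n) (e : Idem (CyclicMotzkin m n))
    (hxe : x.through = e.1.through) :
    ∃ (f : CDiagram ℕ n) (l₀ : LCell x), (⟨f.skeleton, (f.count : ZMod m)⟩ : CyclicMotzkin m n) = e.1 ∧
      cellRep K ζ x f * cellRep K ζ x f = cellRep K ζ x f ∧ IsIdempotentElem f.skeleton ∧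
      simR f.skeleton l₀.1 := by
  have hc : e.1.skeleton.upper.thru.card = x.lower.thru.card := by
    rw [← Diagram.through_eq, Diagram.card_lower, hxe]; rfl
  -- `l₀` has the upper half of `e` and the lower half of `x`, so it lies in the right cell of `e`
  -- and in the left cell of `x`.
  refine ⟨⟨e.1.skeleton, e.1.count.val⟩, ⟨e.1.skeleton.upper.join x.lower hc, ?_⟩, ?_, ?_, ?_, ?_⟩
  · rw [Diagram.simL_iff, Half.join_lower]
  · ext1 <;> simp
  -- With counts in `ℕ` the lift of `e` is idempotent only up to a multiple of `m`. Its operator is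
  -- idempotent because it is the operator of `e` in the cyclic monoid.
  · have := map_mul (cyclicCellRep hζ x) e.1 e.1
    rw [e.2.eq] at this
    exact this.symm
  · exact congrArg CDiagram.skeleton e.2
  · rw [Diagram.simR_iff, Half.join_upper]

theorem motzkinAlgebra_smul (ζ : K) (x : Diagram n) (s : CDiagram ℕ n) (v : CellModule K ζ x) :
    (RingQuot.mkAlgHom K (bubbleRel K ζ n) (MonoidAlgebra.of K _ s) : MotzkinAlgebra K ζ n) • v =
      (show CellModule K ζ x from cellRep K ζ x s v) := by
  change cellAction K ζ x _ v = _
  rw [cellAction, RingQuot.liftAlgHom_mkAlgHom_apply, Representation.asAlgebraHom_of]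

theorem motzkinAlgebra_span (ζ : K) (a : MotzkinAlgebra K ζ n) :
    a ∈ Submodule.span K (Set.range fun s : CDiagram ℕ n =>
      (RingQuot.mkAlgHom K (bubbleRel K ζ n) (MonoidAlgebra.of K _ s) : MotzkinAlgebra K ζ n)) := by
  obtain ⟨b, rfl⟩ := RingQuot.mkAlgHom_surjective K (bubbleRel K ζ n) a
  induction b using MonoidAlgebra.induction_on with
  | of s => exact Submodule.subset_span ⟨s, rfl⟩
  | add a b ha hb => rw [map_add]; exact add_mem ha hb
  | smul c a ha => rw [map_smul]; exact Submodule.smul_mem _ _ ha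

/-- The head of the cell module is simple, elements not below `e` in the `J`-order kill it, and the
line through `l₀` is fixed by `e` and carries the character `ζ`. So it is the simple module attached
to `e` and `σ`, and its dimension is given by `cellRadical`. -/
theorem simpleRep_finrank_eq_cellRadical {ζ : K} (hζ : ζ ^ m = 1) (x : Diagram n)
    (e : Idem (CyclicMotzkin m n)) (hxe : x.through = e.1.through) {W : Type u} [AddCommGroup W]
    [Module K W] (σ : Representation K (Multiplicative (ZMod m)) W)
    (hW : Module.finrank K W = 1) (hσ : ∀ w, σ (Multiplicative.ofAdd 1) w = ζ • w)
    {V : Type u} [AddCommGroup V] [Module K V] (ρ : Representation K (CyclicMotzkin m n) V)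
    (ι₀ : V ≃ₗ[K] (LCell x →₀ K)) (hρ₀ : ∀ s v, ι₀ (ρ s v) = cyclicCellRep hζ x s (ι₀ v))
    (hζ0 : ζ ≠ 0) (f : CDiagram ℕ n)
    (l₀ : LCell x) (hfe : (⟨f.skeleton, (f.count : ZMod m)⟩ : CyclicMotzkin m n) = e.1)
    (hf : cellRep K ζ x f * cellRep K ζ x f = cellRep K ζ x f) (hf' : IsIdempotentElem f.skeleton)
    (hl₀ : simR f.skeleton l₀.1) (κ : W ≃ₗ[K] K) (hirr : σ.IsIrreducible) :
    Module.finrank K (simpleRep K (cyclicHCell e) σ) =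
      Module.finrank K ((LCell x →₀ K) ⧸ cellRadical ζ x f l₀) := by
  obtain ⟨β, hβ0⟩ : ∃ β : CDiagram ℕ n → MonoidAlgebra K (CyclicMotzkin m n), ∀ s,
    β s = MonoidAlgebra.of K _ ⟨s.skeleton, (s.count : ZMod m)⟩ := ⟨_, fun _ => rfl⟩
  obtain ⟨ι', hρ⟩ : ∃ ι' : ρ.asModule ≃ₗ[K] (LCell x →₀ K), ∀ s v,
    ι' (MonoidAlgebra.of K _ s • v) = cyclicCellRep hζ x s (ι' v) :=
    ⟨ρ.asModuleEquiv.trans ι₀, fun s v => (congrArg ι₀ (of_smul_asModule ρ s v)).trans (hρ₀ s _)⟩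
  have hβ : ∀ s (v : ρ.asModule), ι' (β s • v) = cellRep K ζ x s (ι' v) := by
    intro s v
    rw [← cyclicCellRep_natCast hζ, hβ0, hρ]
  have hloc' := cellModule_isLocal (A := MonoidAlgebra K (CyclicMotzkin m n)) (M := ρ.asModule)
    ζ hζ0 x f hf hf' l₀ hl₀ hW κ ι' β hβ
  have h2 := finrank_head_cellModule ζ hζ0 x f hf hf' l₀ hl₀ hW κ ι' β hβ (by
    intro a
    induction a using MonoidAlgebra.induction_on with
    | of s => exact Submodule.subset_span ⟨⟨s.skeleton, s.count.val⟩, by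
        refine (hβ0 _).trans (congrArg _ ?_)
        ext1 <;> simp⟩
    | add a b ha hb => exact add_mem ha hb
    | smul c a ha => exact Submodule.smul_mem _ _ ha)
  refine Eq.trans ?_ h2
  have := hloc'.isSimpleModule_head
  let j : W →ₗ[K] Head (MonoidAlgebra K (CyclicMotzkin m n)) ρ.asModule :=
    ((Module.jacobson (MonoidAlgebra K (CyclicMotzkin m n)) ρ.asModule).mkQ.restrictScalars K) ∘ₗ
      cellIncl K x l₀ κ ι'
  have hj : ∀ w, j w = (Module.jacobson (MonoidAlgebra K (CyclicMotzkin m n)) ρ.asModule).mkQ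
    (cellIncl K x l₀ κ ι' w) := fun _ => rfl
  obtain ⟨F⟩ := nonempty_simpleRep_equiv (cyclicHCell e) σ hirr j (by
      intro h0
      obtain ⟨w, hw⟩ := @exists_ne W hloc'.nontrivial 0
      exact hloc'.mkQ_ne_zero hw (LinearMap.congr_fun h0 w)) (by
      intro g w
      rw [hj, hj, ← map_smul]
      congr 1
      refine ι'.injective ?_
      rw [coe_cyclicHCell, map_mul, mul_smul, hρ]
      have h3 : MonoidAlgebra.of K _ e.1 • cellIncl K x l₀ κ ι' w = cellIncl K x l₀ κ ι' w := by
        have := hloc'.smul_eq (cellIncl K x l₀ κ ι' w)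
        rw [hloc'.retract] at this
        rwa [hβ0, hfe] at this
      rw [h3, rep_ofAdd_one_pow σ hσ, map_smul, map_smul]
      exact cyclicCellRep_shift hζ x _ _) (by
      intro s hs v
      obtain ⟨v, rfl⟩ := Submodule.mkQ_surjective _ v
      rw [← map_smul]
      have h4 : MonoidAlgebra.of K _ s • v = 0 := by
        refine ι'.injective ?_
        rw [hρ, map_zero]
        rw [cyclicCellRep_eq_zero hζ x s (by
          rw [Diagram.leJ_iff, hxe]
          rw [leJ_iff_through] at hs
          exact hs), LinearMap.zero_apply]
      rw [h4, map_zero])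
  exact (F.restrictScalars K).finrank_eq

theorem ne_zero_of_pow_eq_one {ζ : K} (hζ : ζ ^ m = 1) : ζ ≠ 0 := by
  rintro rfl
  rw [zero_pow (NeZero.ne m)] at hζ
  exact zero_ne_one hζ

/-- The cyclic monoid supplies the element over `x * x.flip` that acts as a projection to a line in
the cell module, also when regarded in the Motzkin algebra. -/
theorem isSimpleModule_motzkinSimple {ζ : K} (hζ : ζ ^ m = 1) (x : Diagram n) :
    IsSimpleModule (MotzkinAlgebra K ζ n) (MotzkinSimple K ζ x) := by
  obtain ⟨e, -, -, he⟩ := exists_idem_over (m := m) x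
  obtain ⟨f, l₀, -, hf, hf', hl₀⟩ := exists_cell_data hζ x e he.symm
  let α : CDiagram ℕ n → MotzkinAlgebra K ζ n := fun s =>
    RingQuot.mkAlgHom K (bubbleRel K ζ n) (MonoidAlgebra.of K _ s)
  let ι : CellModule K ζ x ≃ₗ[K] (LCell x →₀ K) := LinearEquiv.refl K (LCell x →₀ K)
  have hα : ∀ s (v : CellModule K ζ x), ι (α s • v) = cellRep K ζ x s (ι v) := fun s v =>
    motzkinAlgebra_smul ζ x s v
  exact (cellModule_isLocal ζ (ne_zero_of_pow_eq_one hζ) x f hf hf' l₀ hl₀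
    (Module.finrank_self K) (LinearEquiv.refl K K) ι α hα).isSimpleModule_head

theorem finrank_simpleRep_eq_motzkinSimple {ζ : K} (hζ : ζ ^ m = 1) (x : Diagram n)
    (e : Idem (CyclicMotzkin m n)) (hxe : x.through = e.1.through) {W : Type u} [AddCommGroup W]
    [Module K W] (σ : Representation K (Multiplicative (ZMod m)) W)
    (hW : Module.finrank K W = 1) (hσ : ∀ w, σ (Multiplicative.ofAdd 1) w = ζ • w) :
    Module.finrank K (simpleRep K (cyclicHCell e) σ) =
      Module.finrank K (MotzkinSimple K ζ x) := by
  have hζ0 := ne_zero_of_pow_eq_one hζ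
  obtain ⟨f, l₀, hfe, hf, hf', hl₀⟩ := exists_cell_data hζ x e hxe
  have : Module.Finite K W := Module.finite_of_finrank_pos (by omega)
  have κ : W ≃ₗ[K] K := LinearEquiv.ofFinrankEq W K (by rw [hW, Module.finrank_self])
  have hirr : σ.IsIrreducible := by
    have : Nontrivial W := Module.nontrivial_of_finrank_pos (R := K) (by omega)
    exact irreducible_of_submodule σ fun U _ => finrank_one_eq_bot_or_top hW U
  let α : CDiagram ℕ n → MotzkinAlgebra K ζ n := fun s =>
    RingQuot.mkAlgHom K (bubbleRel K ζ n) (MonoidAlgebra.of K _ s)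
  let ι : CellModule K ζ x ≃ₗ[K] (LCell x →₀ K) := LinearEquiv.refl K (LCell x →₀ K)
  have hα : ∀ s (v : CellModule K ζ x), ι (α s • v) = cellRep K ζ x s (ι v) := fun s v =>
    motzkinAlgebra_smul ζ x s v
  have h1 := finrank_head_cellModule ζ hζ0 x f hf hf' l₀ hl₀ hW κ ι α hα (motzkinAlgebra_span ζ)
  refine Eq.trans ?_ h1.symm
  exact simpleRep_finrank_eq_cellRadical hζ x e hxe σ hW hσ (cyclicCellRep hζ x)
    (LinearEquiv.refl K _) (fun _ _ => rfl) hζ0 f l₀ hfe hf hf' hl₀ κ hirr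

end

end Comparison

end Motz

namespace Motz

/-! ### Trivial representations and the representation gap -/

section TrivialSum

variable {K : Type u} [Field K] {S : Type} [Monoid S]

/-- The characters of `1_b` and `1_t`. -/
def IsTrivialChar (ε : S → K) : Prop :=
  (∀ s, IsUnit s → ε s = 1) ∧ ((∀ s, ¬ IsUnit s → ε s = 0) ∨ ∀ s, ¬ IsUnit s → ε s = 1)

/-- The cocycle describing an extension of two trivial representations is a coboundary. -/
theorem exists_coboundary {m : ℕ} (hm : (m : K) ≠ 0) (hper : ∀ a : S, ∃ k, a ^ (k + m) = a ^ k)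
    (hS : WellConnected S) {ε η : S → K} (hε : IsTrivialChar ε) (hη : IsTrivialChar η)
    (f : S → K) (hf : ∀ a b, f (a * b) = η b * f a + ε a * f b) :
    ∃ c, ∀ s, f s + c * ε s = c * η s := by
  -- Here `f` is additive along powers of `a`, so periodicity `a ^ (k + m) = a ^ k` forces `m f(a) =
  -- 0`. In particular `f` vanishes on units.
  have hpow : ∀ a, ε a = 1 → η a = 1 → (∀ k, ε (a ^ k) = 1) → f a = 0 := by
    intro a h1 h2 h3
    have h0 : f 1 = 0 := by
      have := hf 1 1
      rw [mul_one, hε.1 1 isUnit_one, hη.1 1 isUnit_one, one_mul] at this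
      simpa using this
    have h4 : ∀ k : ℕ, f (a ^ k) = k * f a := by
      intro k
      induction k with
      | zero => simp [h0]
      | succ k ih => rw [pow_succ, hf, h2, h3, ih]; push_cast; ring
    obtain ⟨k, hk⟩ := hper a
    have h5 := h4 (k + m)
    rw [hk, h4] at h5
    push_cast at h5
    have h6 : (m : K) * f a = 0 := by linear_combination -h5
    exact (mul_eq_zero.mp h6).resolve_left hm
  have hunit : ∀ a, IsUnit a → f a = 0 := fun a ha =>
    hpow a (hε.1 a ha) (hη.1 a ha) fun k => hε.1 _ (ha.pow k)
  rcases hS with ⟨hR, hL, hN⟩ | hS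
  swap
  · exact ⟨0, fun s => by rw [hunit s (hS s)]; ring⟩
  obtain ⟨a₀, ha₀⟩ := hR.1
  rcases hε.2 with h1 | h1 <;> rcases hη.2 with h2 | h2
  -- `1_b` by `1_b`: the cocycle vanishes on products of two non-units, and by null-connectedness
  -- every non-unit is one.
  · refine ⟨0, fun s => ?_⟩
    by_cases hs : IsUnit s
    · rw [hunit s hs]; ring
    · obtain ⟨b, c, hb, hc, rfl⟩ := hN s hs
      rw [hf, h2 c hc, h1 b hb]; ring
  -- Here `f(ab) = f(a)` for non-units, so right-connectedness makes `f` constant on them, and this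
  -- constant is the coboundary. The next case is its mirror image with `f(ab) = f(b)`.
  · have key : ∀ x y, Relation.EqvGen (stepR S) x y → f x = f y := by
      intro x y hxy
      induction hxy with
      | rel x y h =>
        obtain ⟨b, hy, hb, rfl⟩ := h
        rw [hf, h1 y hy, h2 b hb]; ring
      | refl => rfl
      | symm _ _ _ ih => exact ih.symm
      | trans _ _ _ _ _ ih ih' => exact ih.trans ih'
    refine ⟨f a₀, fun s => ?_⟩
    by_cases hs : IsUnit s
    · rw [hunit s hs, hε.1 s hs, hη.1 s hs]; ring
    · rw [key s a₀ (hR.2 s a₀ hs ha₀), h1 s hs, h2 s hs]; ring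
  · have key : ∀ x y, Relation.EqvGen (stepL S) x y → f x = f y := by
      intro x y hxy
      induction hxy with
      | rel x y h =>
        obtain ⟨a, ha, hy, rfl⟩ := h
        rw [hf, h1 a ha, h2 y hy]; ring
      | refl => rfl
      | symm _ _ _ ih => exact ih.symm
      | trans _ _ _ _ _ ih ih' => exact ih.trans ih'
    refine ⟨-f a₀, fun s => ?_⟩
    by_cases hs : IsUnit s
    · rw [hunit s hs, hε.1 s hs, hη.1 s hs]; ring
    · rw [key s a₀ (hL.2 s a₀ hs ha₀), h1 s hs, h2 s hs]; ring
  · have hε1 : ∀ s, ε s = 1 := fun s => (em (IsUnit s)).elim (hε.1 s) (h1 s)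
    have hη1 : ∀ s, η s = 1 := fun s => (em (IsUnit s)).elim (hη.1 s) (h2 s)
    exact ⟨0, fun s => by rw [hpow s (hε1 s) (hη1 s) fun k => hε1 _]; ring⟩

variable {V : Type u} [AddCommGroup V] [Module K V] (ρ : Representation K S V)

theorem acts_iff_exists_char (v : V) :
    (ActsBot K ρ v ∨ ActsTop K ρ v) ↔ ∃ ε : S → K, IsTrivialChar ε ∧ ∀ s, ρ s v = ε s • v := by
  classical
  constructor
  · rintro (h | h)
    · refine ⟨fun s => if IsUnit s then 1 else 0, ⟨fun s hs => if_pos hs,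
        Or.inl fun s hs => if_neg hs⟩, fun s => ?_⟩
      rw [h s]
      by_cases hs : IsUnit s <;> simp [hs]
    · exact ⟨fun _ => 1, ⟨fun _ _ => rfl, Or.inr fun _ _ => rfl⟩, fun s => by rw [h s, one_smul]⟩
  · rintro ⟨ε, ⟨h1, h2 | h2⟩, h⟩
    · refine Or.inl fun s => ?_
      by_cases hs : IsUnit s
      · rw [h, h1 s hs, one_smul, if_pos hs]
      · rw [h, h2 s hs, zero_smul, if_neg hs]
    · refine Or.inr fun s => ?_
      by_cases hs : IsUnit s
      · rw [h, h1 s hs, one_smul]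
      · rw [h, h2 s hs, one_smul]

theorem isTrivialSum_of_span [FiniteDimensional K V]
    (h : ⊤ ≤ Submodule.span K {v | ActsBot K ρ v ∨ ActsTop K ρ v}) : IsTrivialSum K ρ := by
  let b := Module.Basis.ofSpan h
  have := Module.Finite.finite_basis b
  have : Fintype _ := Fintype.ofFinite ((linearIndepOn_empty K id).extend
    (Set.empty_subset {v | ActsBot K ρ v ∨ ActsTop K ρ v}))
  refine ⟨b.reindex (Fintype.equivFinOfCardEq (Module.finrank_eq_card_basis b).symm), fun i => ?_⟩
  rw [Module.Basis.reindex_apply]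
  exact Module.Basis.ofSpan_subset h ⟨_, rfl⟩

/-- A simple representation with a vector that spans a trivial representation is trivial. -/
theorem trivial_of_acts (hρ : ρ.IsIrreducible) {v : V} (hv : v ≠ 0)
    (h : ActsBot K ρ v ∨ ActsTop K ρ v) :
    (Module.finrank K V = 1 ∧ ∀ v, ActsBot K ρ v) ∨
      (Module.finrank K V = 1 ∧ ∀ v, ActsTop K ρ v) := by
  obtain ⟨ε, hε, hs⟩ := (acts_iff_exists_char ρ v).mp h
  have h1 : K ∙ v = ⊤ := by
    refine (irreducible_submodule ρ hρ (K ∙ v) ?_).resolve_left ?_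
    · intro s w hw
      obtain ⟨c, rfl⟩ := Submodule.mem_span_singleton.mp hw
      rw [map_smul, hs]
      exact Submodule.smul_mem _ _ (Submodule.smul_mem _ _ (Submodule.mem_span_singleton_self v))
    · exact fun h0 => hv (Submodule.span_singleton_eq_bot.mp h0)
  have h2 : Module.finrank K V = 1 := by
    rw [← finrank_top, ← h1, finrank_span_singleton hv]
  have h3 : ∀ w : V, ∃ c : K, c • v = w := fun w =>
    Submodule.mem_span_singleton.mp (h1 ▸ Submodule.mem_top)
  rcases h with h | h
  · refine Or.inl ⟨h2, fun w s => ?_⟩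
    obtain ⟨c, rfl⟩ := h3 w
    rw [map_smul, h s, smul_ite, smul_zero]
  · refine Or.inr ⟨h2, fun w s => ?_⟩
    obtain ⟨c, rfl⟩ := h3 w
    rw [map_smul, h s]

theorem finiteDimensional_of_irreducible [Finite S] (hρ : ρ.IsIrreducible) :
    FiniteDimensional K V := by
  have := irreducible_nontrivial ρ hρ
  obtain ⟨v, hv⟩ := exists_ne (0 : V)
  have h1 : Submodule.span K (Set.range fun s => ρ s v) = ⊤ := by
    refine (irreducible_submodule ρ hρ _ ?_).resolve_left fun h => hv ?_
    · intro s w hw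
      induction hw using Submodule.span_induction with
      | mem w hw =>
        obtain ⟨t, rfl⟩ := hw
        exact Submodule.subset_span ⟨s * t, by simp⟩
      | zero => rw [map_zero]; exact zero_mem _
      | add _ _ _ _ h h' => rw [map_add]; exact add_mem h h'
      | smul c _ _ h => rw [map_smul]; exact Submodule.smul_mem _ _ h
    · have : v ∈ Submodule.span K (Set.range fun s => ρ s v) := Submodule.subset_span ⟨1, by simp⟩
      rwa [h] at this
  exact Module.finite_def.mpr (h1 ▸ Submodule.fg_span (Set.finite_range _))

theorem exists_irreducible_submodule [FiniteDimensional K V] [Nontrivial V] :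
    ∃ (U : Submodule K V) (hU : ∀ s, U ≤ U.comap (ρ s)),
      (ρ.subrepresentation U hU).IsIrreducible := by
  obtain ⟨U, ⟨hU, hU0⟩, hmin⟩ := WellFounded.has_min (wellFounded_lt (α := Submodule K V))
    {U | (∀ s, U ≤ U.comap (ρ s)) ∧ U ≠ ⊥} ⟨⊤, fun _ _ _ => Submodule.mem_top, top_ne_bot⟩
  refine ⟨U, hU, ?_⟩
  have := Submodule.nontrivial_iff_ne_bot.mpr hU0
  refine irreducible_of_submodule _ fun W hW => ?_
  by_contra! hW'
  refine hmin (W.map U.subtype) ⟨?_, ?_⟩ (lt_of_le_of_ne (Submodule.map_subtype_le _ _) fun h => ?_)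
  · rintro s _ ⟨w, hw, rfl⟩
    exact ⟨_, hW s w hw, rfl⟩
  · intro h0
    refine hW'.1 (Submodule.map_injective_of_injective U.injective_subtype ?_)
    rw [h0, Submodule.map_bot]
  · refine hW'.2 (Submodule.map_injective_of_injective U.injective_subtype ?_)
    rw [h, Submodule.map_top, Submodule.range_subtype]

/-- A minimal nonzero invariant subspace is simple, and it is too small to be a nontrivial simple
representation. -/
theorem exists_acts [FiniteDimensional K V] [Nontrivial V]
    (h : ∀ d ∈ nontrivialSimpleDims K S, Module.finrank K V < d) :
    ∃ v : V, v ≠ 0 ∧ (ActsBot K ρ v ∨ ActsTop K ρ v) := by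
  obtain ⟨U, hU, hirr⟩ := exists_irreducible_submodule ρ
  have := irreducible_nontrivial _ hirr
  obtain ⟨u, hu⟩ := exists_ne (0 : U)
  refine ⟨u, fun h0 => hu (Subtype.ext h0), ?_⟩
  by_contra hn
  rw [not_or] at hn
  refine absurd (h (Module.finrank K U) ⟨U, _, _, _, hirr, ?_, ?_, rfl⟩)
    (Submodule.finrank_le U).not_gt
  · rintro ⟨-, h1⟩
    refine hn.1 fun s => (congrArg Subtype.val (h1 u s)).trans ?_
    split_ifs <;> rfl
  · rintro ⟨-, h1⟩
    exact hn.2 fun s => congrArg Subtype.val (h1 u s)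

/-- Representations of a well-connected monoid of dimension less than that of all nontrivial simple
representations are trivial. -/
theorem trivialBelow_of_wellConnected {m : ℕ} (hm : (m : K) ≠ 0)
    (hper : ∀ a : S, ∃ k, a ^ (k + m) = a ^ k) (hS : WellConnected S) {N : ℕ}
    (hN : ∀ d ∈ nontrivialSimpleDims K S, N ≤ d) : TrivialBelow K S N := by
  suffices h : ∀ (d : ℕ) (V : Type u) [AddCommGroup V] [Module K V] [FiniteDimensional K V]
      (ρ : Representation K S V), Module.finrank K V = d → d < N →
      ⊤ ≤ Submodule.span K {v | ActsBot K ρ v ∨ ActsTop K ρ v} from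
    fun V _ _ _ ρ hV => isTrivialSum_of_span ρ (h _ V ρ rfl hV)
  intro d
  induction d with
  | zero =>
    intro V _ _ _ ρ hV _ v _
    have := Module.finrank_zero_iff.mp hV
    rw [Subsingleton.elim v 0]
    exact zero_mem _
  | succ d ih =>
    intro V _ _ _ ρ hV hd
    have : Nontrivial V := Module.nontrivial_of_finrank_pos (R := K) (by omega)
    obtain ⟨v, hv, hv'⟩ := exists_acts ρ fun d' hd' => by
      have := hN d' hd'
      omega
    obtain ⟨ε, hε, hs⟩ := (acts_iff_exists_char ρ v).mp hv'
    have hinv : ∀ s, K ∙ v ≤ (K ∙ v).comap (ρ s) := by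
      intro s
      rw [Submodule.span_singleton_le_iff_mem, Submodule.mem_comap, hs]
      exact Submodule.smul_mem _ _ (Submodule.mem_span_singleton_self v)
    have hq : Module.finrank K (V ⧸ K ∙ v) = d := by
      have := Submodule.finrank_quotient_add_finrank (K ∙ v)
      rw [finrank_span_singleton hv] at this
      omega
    have hmem : v ∈ Submodule.span K {v | ActsBot K ρ v ∨ ActsTop K ρ v} :=
      Submodule.subset_span hv'
    -- The quotient by the line of `v` is spanned by trivial vectors by induction; each of them is
    -- lifted to a trivial vector of `V`.
    have key : Submodule.span K {w | ActsBot K (ρ.quotient (K ∙ v) hinv) w ∨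
        ActsTop K (ρ.quotient (K ∙ v) hinv) w} ≤
        (Submodule.span K {v | ActsBot K ρ v ∨ ActsTop K ρ v}).map (K ∙ v).mkQ := by
      rw [Submodule.span_le]
      intro w hw
      -- On the zero vector every character is admissible; multiplicativity of `η` can only be read
      -- off from `w ≠ 0`.
      by_cases hw0 : w = 0
      · rw [hw0]; exact zero_mem _
      obtain ⟨η, hη, hw⟩ := (acts_iff_exists_char _ w).mp hw
      obtain ⟨w, rfl⟩ := Submodule.mkQ_surjective _ w
      -- The coefficient of `v` in `s w - η(s) w` is the cocycle of the extension; once it is a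
      -- coboundary with constant `c`, the lift `w + c v` is a trivial vector.
      have h1 : ∀ s, ∃ c : K, c • v = ρ s w - η s • w := by
        intro s
        rw [← Submodule.mem_span_singleton, ← Submodule.ker_mkQ (K ∙ v), LinearMap.mem_ker, map_sub,
          map_smul, sub_eq_zero]
        exact hw s
      choose f hf using h1
      have h2 : ∀ s, ρ s w = η s • w + f s • v := fun s => by rw [hf]; abel
      have h3 : ∀ a b, η (a * b) = η a * η b → f (a * b) = η b * f a + ε a * f b := by
        intro a b hab
        have h4 := h2 (a * b)
        rw [map_mul, Module.End.mul_apply, h2 b, map_add, map_smul, map_smul, h2 a, hs, hab] at h4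
        refine smul_left_injective K hv ?_
        change f (a * b) • v = (η b * f a + ε a * f b) • v
        rw [add_smul, mul_smul, mul_smul]
        refine add_left_cancel (a := (η a * η b) • w) (h4.symm.trans ?_)
        module
      have hηmul : ∀ a b, η (a * b) = η a * η b := by
        intro a b
        refine smul_left_injective K hw0 ?_
        change η (a * b) • _ = (η a * η b) • _
        rw [← hw, map_mul, Module.End.mul_apply, hw, map_smul, hw, smul_smul, mul_comm]
      obtain ⟨c, hc⟩ := exists_coboundary hm hper hS hε hη f fun a b => h3 a b (hηmul a b)
      refine ⟨w + c • v, Submodule.subset_span ((acts_iff_exists_char _ _).mpr ⟨η, hη, fun s => ?_⟩),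
        ?_⟩
      · rw [map_add, map_smul, h2, hs, smul_add, smul_smul, smul_smul, add_assoc, ← add_smul, hc,
          mul_comm]
      · rw [map_add, map_smul, Submodule.mkQ_apply _ v, (Submodule.Quotient.mk_eq_zero (K ∙ v)).mpr
          (Submodule.mem_span_singleton_self v), smul_zero, add_zero]
    intro w _
    obtain ⟨w', hw', hww⟩ := key (ih _ (ρ.quotient (K ∙ v) hinv) hq (by omega)
      (Submodule.mem_top (x := (K ∙ v).mkQ w)))
    have h5 : w - w' ∈ K ∙ v := by
      rw [← Submodule.ker_mkQ (K ∙ v), LinearMap.mem_ker, map_sub, hww, sub_self]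
    obtain ⟨c, hc⟩ := Submodule.mem_span_singleton.mp h5
    have : w = w' + c • v := by rw [hc]; abel
    rw [this]
    exact add_mem hw' (Submodule.smul_mem _ _ hmem)

end TrivialSum

end Motz

namespace Motz

/-! ### The representation gap as the least dimension of a nontrivial simple representation -/

section GapValue

variable {K : Type u} [Field K] {S : Type} [Monoid S]

/-- A nontrivial simple representation of dimension below `d` would contain a trivial vector and
hence be trivial itself. -/
theorem finrank_le_of_trivialBelow [Finite S] {ℓ d : ℕ} (hℓ : ℓ ∈ nontrivialSimpleDims K S)
    (hd : TrivialBelow K S d) : d ≤ ℓ := by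
  obtain ⟨V, _, _, ρ, hρ, hb, ht, rfl⟩ := hℓ
  by_contra! hlt
  have := finiteDimensional_of_irreducible ρ hρ
  have := irreducible_nontrivial ρ hρ
  obtain ⟨b, h⟩ := hd V ρ hlt
  let i : Fin (Module.finrank K V) := ⟨0, Module.finrank_pos⟩
  exact (trivial_of_acts ρ hρ (b.ne_zero i) (h i)).elim hb ht

theorem not_mulEquiv_unit {ℓ : ℕ} (hℓ : ℓ ∈ nontrivialSimpleDims K S) :
    ¬ Nonempty (S ≃* Unit) := by
  obtain ⟨V, _, _, ρ, hρ, hb, ht, rfl⟩ := hℓ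
  rintro ⟨φ⟩
  have := irreducible_nontrivial ρ hρ
  obtain ⟨v, hv⟩ := exists_ne (0 : V)
  refine (trivial_of_acts ρ hρ hv (Or.inr fun s => ?_)).elim hb ht
  rw [φ.injective (Subsingleton.elim (φ s) (φ 1)), map_one, Module.End.one_apply]

/-- If the idempotent `a` of `{1, a}` kills a nonzero vector, this vector spans `1_b`; otherwise
some `a v ≠ 0` is fixed and spans `1_t`. So a nontrivial simple representation excludes the
conventional value `0` of the gap. -/
theorem not_mulEquiv_withZero {ℓ : ℕ} (hℓ : ℓ ∈ nontrivialSimpleDims K S) :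
    ¬ Nonempty (S ≃* WithZero Unit) := by
  obtain ⟨V, _, _, ρ, hρ, hb, ht, rfl⟩ := hℓ
  rintro ⟨φ⟩
  have := irreducible_nontrivial ρ hρ
  have hS : ∀ s, s = φ.symm 0 ∨ s = 1 := by
    intro s
    rcases h : φ s with _ | x
    · exact Or.inl (φ.injective (by rw [h, φ.apply_symm_apply]; rfl))
    · exact Or.inr (φ.injective (by rw [h, map_one]; rfl))
  have hz : ¬ IsUnit (φ.symm 0) := fun h => by
    have := h.map φ
    rw [φ.apply_symm_apply] at this
    exact not_isUnit_zero this
  have hzz : φ.symm 0 * φ.symm 0 = φ.symm 0 := by rw [← map_mul, mul_zero]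
  by_cases h : ∃ v : V, v ≠ 0 ∧ ρ (φ.symm 0) v = 0
  · obtain ⟨v, hv, h⟩ := h
    refine (trivial_of_acts ρ hρ hv (Or.inl fun s => ?_)).elim hb ht
    rcases hS s with rfl | rfl
    · rw [h, if_neg hz]
    · rw [map_one, if_pos isUnit_one, Module.End.one_apply]
  · push Not at h
    obtain ⟨v, hv⟩ := exists_ne (0 : V)
    refine (trivial_of_acts ρ hρ (h v hv) (Or.inr fun s => ?_)).elim hb ht
    rcases hS s with rfl | rfl
    · rw [← Module.End.mul_apply, ← map_mul, hzz]
    · rw [map_one, Module.End.one_apply]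

/-- The least dimension of a nontrivial simple representation is itself an admissible bound by `h`,
and no larger number is one. -/
theorem isLeast_gap [Finite S] (hne : (nontrivialSimpleDims K S).Nonempty)
    (h : ∀ N, (∀ d ∈ nontrivialSimpleDims K S, N ≤ d) → TrivialBelow K S N) :
    IsLeast (nontrivialSimpleDims K S) (gap K S) := by
  have hmem := Nat.sInf_mem hne
  have h1 : IsGreatest {d | TrivialBelow K S d} (sInf (nontrivialSimpleDims K S)) :=
    ⟨h _ fun d hd => Nat.sInf_le hd, fun d hd => finrank_le_of_trivialBelow hmem hd⟩
  rw [gap, if_neg (not_or_intro (not_mulEquiv_unit hmem) (not_mulEquiv_withZero hmem)),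
    h1.csSup_eq]
  exact ⟨hmem, fun d hd => Nat.sInf_le hd⟩

/-- Representations of dimension at most one which are not nontrivial simple are trivial. -/
theorem trivialBelow_two {N : ℕ} (hN : ∀ d ∈ nontrivialSimpleDims K S, N ≤ d) (h2 : N ≤ 2) :
    TrivialBelow K S N := by
  intro V _ _ _ ρ hV
  refine isTrivialSum_of_span ρ ?_
  by_cases h0 : Module.finrank K V = 0
  · intro v _
    have := Module.finrank_zero_iff.mp h0
    rw [Subsingleton.elim v 0]
    exact zero_mem _
  · have : Nontrivial V := Module.nontrivial_of_finrank_pos (R := K) (by omega)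
    obtain ⟨v, hv, hv'⟩ := exists_acts ρ fun d' hd' => by
      have := hN d' hd'
      omega
    intro w _
    have h1 : Module.finrank K V = 1 := by omega
    obtain ⟨c, rfl⟩ := exists_smul_eq_of_finrank_eq_one h1 hv w
    exact Submodule.smul_mem _ _ (Submodule.subset_span hv')

/-- A representation on which a non-unit fixes a nonzero vector and some element acts by zero
has a nontrivial simple subquotient. -/
theorem exists_nontrivialSimpleDims {V : Type u} [AddCommGroup V] [Module K V]
    [FiniteDimensional K V] (ρ : Representation K S V) {e z : S} (he : ¬ IsUnit e) {v : V}
    (hv : v ≠ 0) (hev : ρ e v = v) (hz : ρ z = 0) :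
    ∃ d ∈ nontrivialSimpleDims K S, d ≤ Module.finrank K V := by
  -- Let `N` be maximal among the invariant subspaces that avoid `v`. Then every nonzero invariant
  -- subspace of `V ⧸ N` contains the image of `v`, in particular a simple one. That vector is fixed
  -- by the non-unit `e`, which excludes `1_b`, and killed by `z`, which excludes `1_t`.
  obtain ⟨N, ⟨hN, hvN⟩, hmax⟩ := WellFounded.has_min (wellFounded_gt (α := Submodule K V))
    {U | (∀ s, U ≤ U.comap (ρ s)) ∧ v ∉ U} ⟨⊥, fun s w hw => by
      rw [Submodule.mem_bot] at hw; rw [hw]; exact zero_mem _, by simpa using hv⟩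
  have hcon : ∀ U : Submodule K (V ⧸ N), (∀ s, U ≤ U.comap (ρ.quotient N hN s)) → U ≠ ⊥ →
      N.mkQ v ∈ U := by
    intro U hU hU0
    by_contra hvU
    refine hmax (U.comap N.mkQ) ⟨fun s w hw => hU s hw, hvU⟩ ?_
    refine lt_of_le_of_ne (fun w hw => ?_) fun h => hU0 ?_
    · rw [Submodule.mem_comap, Submodule.mkQ_apply, (Submodule.Quotient.mk_eq_zero N).mpr hw]
      exact zero_mem _
    · rw [eq_bot_iff]
      intro w hw
      obtain ⟨w, rfl⟩ := Submodule.mkQ_surjective _ w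
      have : w ∈ U.comap N.mkQ := hw
      rw [← h] at this
      exact (Submodule.Quotient.mk_eq_zero N).mpr this
  have hv0 : N.mkQ v ≠ 0 := fun h => hvN ((Submodule.Quotient.mk_eq_zero N).mp h)
  have : Nontrivial (V ⧸ N) := ⟨⟨_, _, hv0⟩⟩
  obtain ⟨U, hU, hirr⟩ := exists_irreducible_submodule (ρ.quotient N hN)
  have hU0 : U ≠ ⊥ := by
    have := irreducible_nontrivial _ hirr
    exact Submodule.nontrivial_iff_ne_bot.mp this
  have hvU := hcon U hU hU0
  have h1 : ρ.quotient N hN e (N.mkQ v) = N.mkQ v := congrArg N.mkQ hev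
  have h2 : ρ.quotient N hN z (N.mkQ v) = 0 := by
    change N.mkQ (ρ z v) = 0
    rw [hz, LinearMap.zero_apply, map_zero]
  refine ⟨_, ⟨U, _, _, _, hirr, ?_, ?_, rfl⟩,
    (Submodule.finrank_le U).trans (Submodule.finrank_quotient_le N)⟩
  · rintro ⟨-, h⟩
    have h3 := congrArg Subtype.val (h ⟨_, hvU⟩ e)
    rw [if_neg he] at h3
    exact hv0 (h1.symm.trans h3)
  · rintro ⟨-, h⟩
    have h3 := congrArg Subtype.val (h ⟨_, hvU⟩ z)
    exact hv0 (h3.symm.trans h2)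

/-- If all representations are trivial, then non-units are equal and units are trivial. -/
theorem eq_of_trivialBelow [Finite S] (h : ∀ N, TrivialBelow K S N) :
    (∀ s : S, IsUnit s → s = 1) ∧ ∀ s t : S, ¬ IsUnit s → ¬ IsUnit t → s = t := by
  -- The regular representation is faithful, whereas on a sum of trivial representations the action
  -- of an element depends only on whether it is a unit.
  obtain ⟨b, hb⟩ := h _ (MonoidAlgebra K S) (Representation.leftRegular K S) (Nat.lt_succ_self _)
  have key : ∀ s t : S, Representation.leftRegular K S s = Representation.leftRegular K S t →
      s = t := by
    intro s t hst
    have := LinearMap.congr_fun hst (MonoidAlgebra.single 1 1)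
    rw [Representation.ofMulAction_single, Representation.ofMulAction_single, smul_eq_mul,
      smul_eq_mul, mul_one, mul_one] at this
    exact MonoidAlgebra.of_injective (R := K) this
  constructor
  · intro s hs
    refine key s 1 (b.ext fun i => ?_)
    rw [map_one, Module.End.one_apply]
    rcases hb i with h | h
    · rw [h s, if_pos hs]
    · exact h s
  · intro s t hs ht
    refine key s t (b.ext fun i => ?_)
    rcases hb i with h | h
    · rw [h s, h t, if_neg hs, if_neg ht]
    · rw [h s, h t]

end GapValue

/-! ### Periodicity of powers and units of the truncations -/

section Truncation

variable {m n k : ℕ}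

/-- Once the powers of `a` repeat, consecutive powers are `H`-equivalent, hence equal because `Mo_n`
is `H`-trivial. -/
theorem Diagram.exists_pow_succ_eq (a : Diagram n) : ∃ k, a ^ (k + 1) = a ^ k := by
  obtain ⟨k, p, hp, h⟩ := exists_pow_eq_pow_add a
  refine ⟨k, simH_iff.mp ⟨⟨⟨a ^ (p - 1), ?_⟩, ⟨a, pow_succ' a k⟩⟩,
    ⟨⟨a ^ (p - 1), ?_⟩, ⟨a, pow_succ a k⟩⟩⟩⟩
  · rw [← pow_add, show p - 1 + (k + 1) = k + p by omega, ← h]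
  · rw [← pow_add, show k + 1 + (p - 1) = k + p by omega, ← h]

/-- When the skeleton has stabilised, each further factor `x` only adds a fixed shift `g`, and `m`
of them add `m g = 0`. -/
theorem exists_pow_add_eq (x : CyclicMotzkin m n) : ∃ k, x ^ (k + m) = x ^ k := by
  obtain ⟨k, hk⟩ := x.skeleton.exists_pow_succ_eq
  have hs : ∀ k, (x ^ k).skeleton = x.skeleton ^ k := by
    intro k
    induction k with
    | zero => rfl
    | succ k ih => rw [pow_succ, pow_succ, ← ih]; rfl
  obtain ⟨g, hg⟩ : ∃ g : ZMod m, x * x ^ k = shift g * x ^ k :=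
    ⟨_, eq_shift_mul (by rw [← pow_succ', hs, hs, hk])⟩
  have h : ∀ j : ℕ, x ^ (k + j) = shift ((j : ZMod m) * g) * x ^ k := by
    intro j
    induction j with
    | zero => simp [shift_zero]
    | succ j ih =>
      rw [← add_assoc, pow_succ', ih, ← mul_assoc, mul_shift, mul_assoc, hg, ← mul_assoc,
        ← shift_add]
      congr 2
      push_cast
      ring
  exact ⟨k, by rw [h, ZMod.natCast_self, zero_mul, shift_zero, one_mul]⟩

theorem truncation_exists_pow (x : truncation m n k) : ∃ l, x ^ (l + m) = x ^ l := by
  obtain ⟨l, hl⟩ := exists_pow_add_eq x.1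
  exact ⟨l, Subtype.ext hl⟩

theorem through_eq_of_isUnit {x : truncation m n k} (h : IsUnit x) : x.1.through = n := by
  obtain ⟨y, hy⟩ := h.exists_right_inv
  refine le_antisymm (Diagram.through_le _) ?_
  have h1 := Diagram.through_mul_le x.1.skeleton y.1.skeleton
  have h2 : x.1.skeleton * y.1.skeleton = 1 := congrArg (fun z => z.1.skeleton) hy
  rwa [h2, Diagram.through_one] at h1

/-- The skeleton is the identity. Either `x = 1`, or `n ≤ k`; in the latter case all shifts belong
to the truncation, and they are invertible. -/
theorem isUnit_iff_through {x : truncation m n k} : IsUnit x ↔ x.1.through = n := by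
  refine ⟨through_eq_of_isUnit, fun h => ?_⟩
  have h1 : x.1.skeleton = 1 := Diagram.eq_one_iff.mpr h
  rcases x.2 with h2 | h2
  · rw [show x = 1 from Subtype.ext h2]
    exact isUnit_one
  · have h3 : ∀ g : ZMod m, shift g ∈ truncation m n k := fun g => Or.inr (by
      change (1 : Diagram n).through ≤ k
      rw [Diagram.through_one, ← h]
      exact h2)
    have h4 : x.1 = shift x.1.count := CDiagram.ext h1 rfl
    refine ⟨⟨x, ⟨_, h3 (-x.1.count)⟩, Subtype.ext ?_, Subtype.ext ?_⟩, rfl⟩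
    · change x.1 * shift (-x.1.count) = 1
      rw [mul_shift, eq_comm, ← shift_zero, ← neg_add_cancel x.1.count, shift_add, ← h4]
    · change shift (-x.1.count) * x.1 = 1
      rw [eq_comm, ← shift_zero, ← neg_add_cancel x.1.count, shift_add, ← h4]

end Truncation

end Motz

namespace Motz

/-! ### Well-connectedness, reduced to Motzkin diagrams -/

section WellConnected

variable {m n k : ℕ}

/-- The diagrams underlying the non-units of the truncation. -/
abbrev Small (n k : ℕ) : Type := {a : Diagram n // a.through < n ∧ a.through ≤ k}

/-- Right multiplication with non-units. -/
def Small.step (a b : Small n k) : Prop := ∃ c : Small n k, a.1 = b.1 * c.1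

theorem small_of_not_isUnit {x : truncation m n k} (hx : ¬ IsUnit x) :
    x.1.skeleton.through < n ∧ x.1.skeleton.through ≤ k := by
  have h1 : x.1.through ≠ n := fun h => hx (isUnit_iff_through.mpr h)
  refine ⟨lt_of_le_of_ne (Diagram.through_le _) h1, x.2.resolve_left fun h => h1 ?_⟩
  rw [h]
  exact Diagram.through_one

theorem not_isUnit_of_small {x : truncation m n k} (a : Small n k) (hx : x.1.skeleton = a.1) :
    ¬ IsUnit x := by
  intro h
  have h1 := through_eq_of_isUnit h
  have h2 := a.2.1
  rw [← hx] at h2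
  exact h2.ne h1

/-- The element of the truncation over a small diagram with a given count. -/
def Small.lift (a : Small n k) (g : ZMod m) : truncation m n k := ⟨⟨a.1, g⟩, Or.inr a.2.2⟩

theorem Small.not_isUnit_lift (a : Small n k) (g : ZMod m) : ¬ IsUnit (a.lift g) :=
  not_isUnit_of_small a rfl

/-- The count of the lifted factor is free, so it can be chosen to produce any count of `x`;
connectivity is thus a question about skeletons. -/
theorem stepR_of_skeleton {x y : truncation m n k} (hy : ¬ IsUnit y) (c : Small n k)
    (h : x.1.skeleton = y.1.skeleton * c.1) : stepR (truncation m n k) x y := by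
  refine ⟨c.lift (x.1.count - y.1.count - (internal y.1.skeleton.rel c.1.rel : ZMod m)), hy,
    c.not_isUnit_lift _, Subtype.ext (CDiagram.ext h ?_)⟩
  change _ = y.1.count + (_ - _ - _) + ((internal y.1.skeleton.rel c.1.rel : ℕ) : ZMod m)
  abel

theorem stepL_of_skeleton {x y : truncation m n k} (hy : ¬ IsUnit y) (c : Small n k)
    (h : x.1.skeleton = c.1 * y.1.skeleton) : stepL (truncation m n k) x y := by
  refine ⟨c.lift (x.1.count - y.1.count - (internal c.1.rel y.1.skeleton.rel : ZMod m)),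
    c.not_isUnit_lift _, hy, Subtype.ext (CDiagram.ext h ?_)⟩
  change _ = (_ - _ - _) + y.1.count + ((internal c.1.rel y.1.skeleton.rel : ℕ) : ZMod m)
  abel

/-- The reflection of a small diagram. -/
def Small.flip (a : Small n k) : Small n k :=
  ⟨a.1.flip, by rw [Diagram.through_flip]; exact a.2⟩

/-- The projection `a^* a`. -/
def Small.proj (a : Small n k) : Small n k :=
  ⟨a.1.flip * a.1, (Diagram.through_mul_le_right _ _).trans_lt a.2.1,
    (Diagram.through_mul_le_right _ _).trans a.2.2⟩

/-- A non-unit right identity for `a`. It gives null-connectedness and links different counts over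
one diagram. -/
theorem Small.mul_proj (a : Small n k) : a.1 * a.proj.1 = a.1 :=
  (mul_assoc _ _ _).symm.trans a.1.flip_regular

theorem eqvGen_stepR {a b : Small n k} (h : Relation.EqvGen Small.step a b)
    (x y : truncation m n k) (hx : x.1.skeleton = a.1) (hy : y.1.skeleton = b.1) :
    Relation.EqvGen (stepR (truncation m n k)) x y := by
  induction h generalizing x y with
  | rel a b h =>
    obtain ⟨c, hc⟩ := h
    exact .rel _ _ (stepR_of_skeleton (not_isUnit_of_small b hy) c (by rw [hx, hy, hc]))
  | refl a =>
    exact .rel _ _ (stepR_of_skeleton (not_isUnit_of_small a hy) a.proj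
      (by rw [hx, hy, Small.mul_proj]))
  | symm _ _ _ ih => exact (ih y x hy hx).symm
  | trans _ b _ _ _ ih ih' =>
    exact (ih x (b.lift 0) hx rfl).trans _ _ _ (ih' (b.lift 0) y rfl hy)

/-- The reflected form of `eqvGen_stepR`: reflecting a chain of right multiplications gives a chain
of left multiplications, so only one side has to be studied. -/
theorem eqvGen_stepL {a b : Small n k} (h : Relation.EqvGen Small.step a b)
    (x y : truncation m n k) (hx : x.1.skeleton = a.1.flip) (hy : y.1.skeleton = b.1.flip) :
    Relation.EqvGen (stepL (truncation m n k)) x y := by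
  induction h generalizing x y with
  | rel a b h =>
    obtain ⟨c, hc⟩ := h
    exact .rel _ _ (stepL_of_skeleton (not_isUnit_of_small b.flip hy) c.flip
      (by rw [hx, hy, hc, Diagram.flip_mul]; rfl))
  | refl a =>
    refine .rel _ _ (stepL_of_skeleton (not_isUnit_of_small a.flip hy) a.proj.flip ?_)
    rw [hx, hy]
    conv_lhs => rw [← a.mul_proj, Diagram.flip_mul]
    rfl
  | symm _ _ _ ih => exact (ih y x hy hx).symm
  | trans _ b _ _ _ ih ih' =>
    exact (ih x (b.flip.lift 0) hx rfl).trans _ _ _ (ih' (b.flip.lift 0) y rfl hy)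

theorem wellConnected_of_small (a₀ : Small n k)
    (h : ∀ a b : Small n k, Relation.EqvGen Small.step a b) : WellConnected (truncation m n k) := by
  refine Or.inl ⟨⟨⟨a₀.lift 0, a₀.not_isUnit_lift 0⟩, fun x y hx hy => ?_⟩,
    ⟨⟨a₀.lift 0, a₀.not_isUnit_lift 0⟩, fun x y hx hy => ?_⟩, fun x hx => ?_⟩
  · exact eqvGen_stepR (h ⟨_, small_of_not_isUnit hx⟩ ⟨_, small_of_not_isUnit hy⟩) x y rfl rfl
  · exact eqvGen_stepL (h (Small.flip ⟨_, small_of_not_isUnit hx⟩)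
      (Small.flip ⟨_, small_of_not_isUnit hy⟩)) x y (Diagram.flip_flip _).symm
      (Diagram.flip_flip _).symm
  · obtain ⟨b, h1, h2, h3⟩ := stepR_of_skeleton (x := x) hx
      (Small.proj ⟨_, small_of_not_isUnit hx⟩)
      (Small.mul_proj ⟨_, small_of_not_isUnit hx⟩).symm
    exact ⟨x, b, h1, h2, h3⟩

/-- For `n ≤ 1` there is at most one diagram below the identity, since fewer than `n` through
strands means none and a single point is a stop. If there are no non-units, the truncation is a
group. -/
theorem wellConnected_of_le_one (hn : n ≤ 1) : WellConnected (truncation m n k) := by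
  by_cases h : ∃ x : truncation m n k, ¬ IsUnit x
  · obtain ⟨x, hx⟩ := h
    refine wellConnected_of_small ⟨_, small_of_not_isUnit hx⟩ fun a b => ?_
    have hsub : Subsingleton (Fin n) := Fin.subsingleton_iff_le_one.mpr hn
    have hup : ∀ a : Diagram n, a.through < n → a.upper = Half.stops ∅ := by
      intro a ha
      refine Half.ext (Setoid.ext fun i j => ?_) ?_
      · rw [Subsingleton.elim i j]
        exact iff_of_true (Setoid.refl' _ _) (Setoid.refl' _ _)
      · exact Finset.card_eq_zero.mp (show a.upper.thru.card = 0 by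
          rw [← Diagram.through_eq]; omega)
    have hab : a = b := Subtype.ext (Diagram.ext_halves
      ((hup _ a.2.1).trans (hup _ b.2.1).symm)
      ((hup a.1.flip a.flip.2.1).trans (hup b.1.flip b.flip.2.1).symm))
    rw [hab]
    exact .refl _
  · push Not at h
    exact Or.inr h

/-- Removes the strand joining `p` and `q`; the points of `t` become end points of through
strands. -/
def Half.uncap (u : Half n) (p q : Fin n) (t : Finset (Fin n)) (ht : t ⊆ {p, q})
    (hexp : ∀ x y z, x < y → y < z → u.rel x z → y ∉ t) : Half n where
  rel :=
    { r := fun x y => u.rel x y ∧ (x = y ∨ (x ≠ p ∧ x ≠ q) ∧ y ≠ p ∧ y ≠ q)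
      iseqv :=
        { refl := fun x => ⟨Setoid.refl' _ _, Or.inl rfl⟩
          symm := by
            rintro x y ⟨h, rfl | h'⟩
            · exact ⟨h, Or.inl rfl⟩
            · exact ⟨Setoid.symm' _ h, Or.inr h'.symm⟩
          trans := by
            rintro x y z ⟨h, rfl | h'⟩ ⟨h1, h1'⟩
            · exact ⟨h1, h1'⟩
            · refine ⟨Setoid.trans' _ h h1, ?_⟩
              rcases h1' with rfl | h1'
              · exact Or.inr h'
              · exact Or.inr ⟨h'.1, h1'.2⟩ } }
  thru := t
  size_le_two x y z h h' := u.size_le_two x y z h.1 h'.1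
  planar x y z w h1 h2 h3 h4 h5 :=
    ⟨u.planar x y z w h1 h2 h3 h4.1 h5.1, Or.inr ⟨(h4.2.resolve_left (h1.trans h2).ne).1,
      (h5.2.resolve_left (h2.trans h3).ne).1⟩⟩
  single x hx y h := by
    refine h.2.resolve_right fun h' => ?_
    have := ht hx
    simp only [Finset.mem_insert, Finset.mem_singleton] at this
    exact this.elim h'.1.1 h'.1.2
  exposed x y z h1 h2 h := hexp x y z h1 h2 h.1

/-- The half whose only strand joins the first two points. -/
def Half.cup (n : ℕ) : Half n where
  rel :=
    { r := fun x y => x = y ∨ x.1 ≤ 1 ∧ y.1 ≤ 1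
      iseqv := ⟨fun _ => Or.inl rfl, fun h => h.imp Eq.symm And.symm, fun {x y z} h h' => by
        rw [Fin.ext_iff] at *; omega⟩ }
  thru := ∅
  size_le_two x y z h h' := by
    change x = y ∨ x.1 ≤ 1 ∧ y.1 ≤ 1 at h
    change x = z ∨ x.1 ≤ 1 ∧ z.1 ≤ 1 at h'
    rw [Fin.ext_iff] at *
    omega
  planar x y z w h1 h2 h3 h4 h5 := by
    change x = z ∨ x.1 ≤ 1 ∧ z.1 ≤ 1 at h4
    rw [Fin.ext_iff] at h4
    omega
  single x hx := absurd hx (Finset.notMem_empty x)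
  exposed _ _ _ _ _ _ := Finset.notMem_empty _

/-- Dual form of `Diagram.mul_rel_bot`. -/
theorem Diagram.mul_rel_top' {a b : Diagram n}
    (h : ∀ k k', a.rel (.inr k) (.inr k') → b.rel (.inl k) (.inl k')) (j j' : Fin n) :
    (a * b).rel (.inl j) (.inl j') ↔ a.rel (.inl j) (.inl j') ∨
      ∃ k k', a.rel (.inl j) (.inr k) ∧ a.rel (.inl j') (.inr k') ∧
        b.rel (.inl k) (.inl k') := by
  have h1 := Diagram.mul_rel_bot (a := b.flip) (b := a.flip) h j j'
  rw [← Diagram.flip_mul] at h1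
  refine h1.trans (or_congr Iff.rfl (exists_congr fun k => exists_congr fun k' => ?_))
  exact and_congr a.rel_symm_iff (and_congr a.rel_symm_iff Iff.rfl)

/-- Dual form of `Diagram.mul_rel_top`. -/
theorem Diagram.mul_rel_bot' {a b : Diagram n}
    (h : ∀ k k', a.rel (.inr k) (.inr k') → b.rel (.inl k) (.inl k')) (j j' : Fin n) :
    (a * b).rel (.inr j) (.inr j') ↔ b.rel (.inr j) (.inr j') := by
  have h1 := Diagram.mul_rel_top (a := b.flip) (b := a.flip) h j j'
  rwa [← Diagram.flip_mul] at h1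

/-- The diagram with upper half `u` and stops at the bottom. -/
noncomputable def Half.close (u : Half n) (h : u.thru = ∅) : Diagram n :=
  u.join (Half.stops ∅) (by rw [h]; rfl)

theorem Half.close_through (u : Half n) (h : u.thru = ∅) : (u.close h).through = 0 := by
  rw [Diagram.through_eq, close, Half.join_upper, h]; rfl

theorem Diagram.eq_close {a : Diagram n} {u : Half n} (h : u.thru = ∅)
    (h1 : ∀ i j, a.rel (.inl i) (.inl j) ↔ u.rel i j)
    (h2 : ∀ i j, a.rel (.inr i) (.inr j) → i = j) (h3 : a.through = 0) : a = u.close h := by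
  have h4 : a.upper.thru = ∅ := Finset.card_eq_zero.mp (by rw [← through_eq, h3])
  have h5 : a.lower.thru = ∅ := Finset.card_eq_zero.mp (by rw [card_lower, h3])
  refine ext_halves ?_ ?_
  · rw [Half.close, Half.join_upper]
    exact Half.ext (Setoid.ext fun i j => h1 i j) (h4.trans h.symm)
  · rw [Half.close, Half.join_lower]
    refine Half.ext (Setoid.ext fun i j => ⟨fun hij => h2 i j hij, fun hij => ?_⟩) h5
    have : i = j := hij
    rw [this]

/-! ### Opening an exposed cap and closing or cutting it -/

section Uncap

variable (u : Half n) (hu : u.thru = ∅) {p q : Fin n} (hpq : p < q) (hr : u.rel p q)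
  (hexp : ∀ x y z, x < y → y < z → u.rel x z → y ∉ ({p, q} : Finset (Fin n))) (h2n : 2 < n)

/-- Opening an exposed cap to two through strands. -/
noncomputable def Half.openCap : Diagram n :=
  (u.uncap p q {p, q} subset_rfl hexp).join
    (stops {⟨0, by omega⟩, ⟨1, by omega⟩}) (by
      change ({p, q} : Finset (Fin n)).card = _
      rw [Finset.card_pair hpq.ne]
      exact (Finset.card_pair (Fin.ne_of_val_ne zero_ne_one)).symm)

theorem Half.openCap_through : (u.openCap hpq hexp h2n).through = 2 := by
  rw [Diagram.through_eq, openCap, join_upper]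
  exact Finset.card_pair hpq.ne

include hr in
-- The two opened strands end at the first two bottom points, where the cup reconnects them, so the
-- strand from `p` to `q` reappears.
theorem Half.openCap_mul_cup :
    u.openCap hpq hexp h2n * (cup n).close rfl = u.close hu := by
  have hcaps : ∀ k k', (u.openCap hpq hexp h2n).rel (.inr k) (.inr k') →
      ((cup n).close rfl).rel (.inl k) (.inl k') := fun k k' h => Or.inl h
  refine Diagram.eq_close hu (fun i j => ?_) (fun i j hij => ?_) ?_
  · rw [Diagram.mul_rel_top' hcaps]
    constructor
    · rintro (h | ⟨k, k', h1, h2, -⟩)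
      · exact h.1
      · have h3 : i ∈ ({p, q} : Finset (Fin n)) := Matched.mem_left h1
        have h4 : j ∈ ({p, q} : Finset (Fin n)) := Matched.mem_left h2
        simp only [Finset.mem_insert, Finset.mem_singleton] at h3 h4
        rcases h3 with rfl | rfl <;> rcases h4 with rfl | rfl
        · exact Setoid.refl' _ _
        · exact hr
        · exact Setoid.symm' _ hr
        · exact Setoid.refl' _ _
    · intro h
      by_cases hij : i = j
      · rw [hij]; exact Or.inl (Setoid.refl' _ _)
      have key : i ∈ ({p, q} : Finset (Fin n)) ↔ j ∈ ({p, q} : Finset (Fin n)) := by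
        simp only [Finset.mem_insert, Finset.mem_singleton]
        constructor
        · rintro (rfl | rfl)
          · rcases u.size_le_two _ _ _ h hr with h | h | h
            · exact absurd h hij
            · exact absurd h hpq.ne
            · exact Or.inr h
          · rcases u.size_le_two _ _ _ h (Setoid.symm' _ hr) with h | h | h
            · exact absurd h hij
            · exact absurd h hpq.ne'
            · exact Or.inl h
        · rintro (rfl | rfl)
          · rcases u.size_le_two _ _ _ (Setoid.symm' _ h) hr with h | h | h
            · exact absurd h.symm hij
            · exact absurd h hpq.ne
            · exact Or.inr h
          · rcases u.size_le_two _ _ _ (Setoid.symm' _ h) (Setoid.symm' _ hr) with h | h | h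
            · exact absurd h.symm hij
            · exact absurd h hpq.ne'
            · exact Or.inl h
      by_cases hi : i ∈ ({p, q} : Finset (Fin n))
      · obtain ⟨k, hk⟩ := (Diagram.mem_upper (u.openCap hpq hexp h2n) i).mp
          (by rw [openCap, join_upper]; exact hi)
        obtain ⟨k', hk'⟩ := (Diagram.mem_upper (u.openCap hpq hexp h2n) j).mp
          (by rw [openCap, join_upper]; exact key.mp hi)
        refine Or.inr ⟨k, k', hk, hk', Or.inr ?_⟩
        have h3 := Matched.mem_right hk
        have h4 := Matched.mem_right hk'
        simp only [stops, Finset.mem_insert, Finset.mem_singleton, Fin.ext_iff] at h3 h4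
        omega
      · refine Or.inl ⟨h, Or.inr ?_⟩
        have hj := mt key.mpr hi
        simp only [Finset.mem_insert, Finset.mem_singleton, not_or] at hi hj
        exact ⟨hi, hj⟩
  · exact (Diagram.mul_rel_bot' hcaps i j).mp hij
  · exact Nat.le_zero.mp ((Diagram.through_mul_le_right _ _).trans (close_through _ _).le)

/-- The opened strands now end in stops, so `p` and `q` become stops. Together with the closing by a
cup, this makes the diagrams with and without the cap right multiples of one element. -/
theorem Half.openCap_mul_stops :
    u.openCap hpq hexp h2n * (stops ∅).close rfl =
      (u.uncap p q ∅ (Finset.empty_subset _) fun _ _ _ _ _ _ => Finset.notMem_empty _).close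
        rfl := by
  have hcaps : ∀ k k', ((stops ∅).close rfl).rel (.inl k) (.inl k') →
      (u.openCap hpq hexp h2n).rel (.inr k) (.inr k') := fun k k' h => h
  refine Diagram.eq_close rfl (fun i j => ?_) (fun i j hij => ?_) ?_
  · rw [Diagram.mul_rel_top hcaps]
    exact Iff.rfl
  · rcases (Diagram.mul_rel_bot hcaps i j).mp hij with h | ⟨k, k', h, -⟩
    · exact h
    · exact absurd (Matched.mem_left h) (Finset.notMem_empty _)
  · exact Nat.le_zero.mp ((Diagram.through_mul_le_right _ _).trans (close_through _ _).le)

end Uncap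

/-- The strand with the leftmost left end point lies under no other strand: a covering strand would
start further left or cross it. -/
theorem exists_exposed_cap {u : Half n} (h : ∃ x y, x ≠ y ∧ u.rel x y) :
    ∃ p q, p < q ∧ u.rel p q ∧
      ∀ x y z, x < y → y < z → u.rel x z → y ∉ ({p, q} : Finset (Fin n)) := by
  classical
  obtain ⟨p, ⟨q, hpq, hr⟩, hmin⟩ := WellFounded.has_min (wellFounded_lt (α := Fin n))
    {p | ∃ q, p < q ∧ u.rel p q} (by
      obtain ⟨x, y, hxy, hr⟩ := h
      rcases lt_or_gt_of_ne hxy with h | h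
      · exact ⟨x, y, h, hr⟩
      · exact ⟨y, x, h, Setoid.symm' _ hr⟩)
  refine ⟨p, q, hpq, hr, fun x y z hxy hyz hxz hy => ?_⟩
  have hx : ¬ x < p := hmin x ⟨z, hxy.trans hyz, hxz⟩
  simp only [Finset.mem_insert, Finset.mem_singleton] at hy
  rcases hy with rfl | rfl
  · exact hx hxy
  · rcases (not_lt.mp hx).eq_or_lt with h | h
    · subst h
      rcases u.size_le_two _ _ _ hr hxz with h | h | h
      · exact hxy.ne h
      · exact (hxy.trans hyz).ne h
      · exact hyz.ne h
    · have h1 := u.planar p x y z h hxy hyz hr hxz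
      rcases u.size_le_two _ _ _ hr h1 with h' | h' | h'
      · exact hpq.ne h'
      · exact h.ne h'
      · exact hxy.ne h'.symm

/-- Every small diagram is connected to the one consisting of stops only: multiplying by the latter
removes through strands and bottom strands, after which the remaining caps are removed one at a time
by opening an exposed cap and cutting it. -/
theorem wellConnected_of_three_le (hn : 3 ≤ n) (hk : 2 ≤ k) : WellConnected (truncation m n k) := by
  classical
  have hclose : ∀ (u : Half n) (h : u.thru = ∅), (u.close h).through < n ∧ (u.close h).through ≤ k :=
    fun u h => by rw [Half.close_through]; omega
  have h1 : ∀ (d : ℕ) (u : Half n) (hu : u.thru = ∅),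
      (Finset.univ.filter fun x => ∃ y, x ≠ y ∧ u.rel x y).card = d →
      Relation.EqvGen (Small.step (n := n) (k := k)) ⟨u.close hu, hclose u hu⟩
        ⟨(Half.stops ∅).close rfl, hclose _ _⟩ := by
    intro d
    induction d using Nat.strong_induction_on with
    | _ d ih =>
      intro u hu hd
      by_cases h : ∃ x y, x ≠ y ∧ u.rel x y
      · obtain ⟨p, q, hpq, hr, hexp⟩ := exists_exposed_cap h
        -- The opened diagram has two through strands, so `k ≥ 2` keeps it in the truncation and `n
        -- ≥ 3` makes it a non-unit.
        let a : Small n k := ⟨u.openCap hpq hexp hn, by rw [Half.openCap_through]; omega⟩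
        let v := u.uncap p q ∅ (Finset.empty_subset _) fun _ _ _ _ _ _ => Finset.notMem_empty _
        have s1 : Small.step ⟨u.close hu, hclose u hu⟩ a :=
          ⟨⟨(Half.cup n).close rfl, hclose _ _⟩, (u.openCap_mul_cup hu hpq hr hexp hn).symm⟩
        have s2 : Small.step ⟨v.close rfl, hclose v rfl⟩ a :=
          ⟨⟨(Half.stops ∅).close rfl, hclose _ _⟩, (u.openCap_mul_stops hpq hexp hn).symm⟩
        refine ((Relation.EqvGen.rel _ _ s1).trans _ _ _ (Relation.EqvGen.rel _ _ s2).symm).trans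
          _ _ _ (ih _ ?_ v rfl rfl)
        -- The number of points on strands drops, since `p` becomes a stop and no strand is created.
        rw [← hd]
        refine Finset.card_lt_card (Finset.ssubset_iff_subset_ne.mpr ⟨fun x hx => ?_, fun h => ?_⟩)
        · obtain ⟨y, hxy, hx⟩ := (Finset.mem_filter.mp hx).2
          exact Finset.mem_filter.mpr ⟨Finset.mem_univ _, y, hxy, hx.1⟩
        · have hp : p ∈ Finset.univ.filter fun x => ∃ y, x ≠ y ∧ u.rel x y :=
            Finset.mem_filter.mpr ⟨Finset.mem_univ _, q, hpq.ne, hr⟩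
          rw [← h] at hp
          obtain ⟨y, hpy, hp⟩ := (Finset.mem_filter.mp hp).2
          exact (hp.2.resolve_left hpy).1.1 rfl
      · have : u = Half.stops ∅ := by
          refine Half.ext (Setoid.ext fun x y => ⟨fun hxy => ?_, fun hxy => ?_⟩) hu
          · by_contra hne
            exact h ⟨x, y, hne, hxy⟩
          · have hxy : x = y := hxy
            rw [hxy]
        subst this
        exact .refl _
  have h2 : ∀ a : Small n k, Relation.EqvGen Small.step a
      ⟨(Half.stops ∅).close rfl, hclose _ _⟩ := by
    intro a
    let u : Half n :=
      { a.1.upper with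
        thru := ∅
        single := fun x hx => absurd hx (Finset.notMem_empty x)
        exposed := fun _ _ _ _ _ _ => Finset.notMem_empty _ }
    have hcaps : ∀ k k', ((Half.stops ∅).close rfl).rel (.inl k) (.inl k') →
        a.1.rel (.inr k) (.inr k') := fun k k' h => by
      have : k = k' := h
      rw [this]
    have h3 : a.1 * (Half.stops ∅).close rfl = u.close rfl := by
      refine Diagram.eq_close rfl (fun i j => Diagram.mul_rel_top hcaps i j) (fun i j hij => ?_) ?_
      · rcases (Diagram.mul_rel_bot hcaps i j).mp hij with h | ⟨k, k', h, -⟩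
        · exact h
        · exact absurd (Matched.mem_left h) (Finset.notMem_empty _)
      · exact Nat.le_zero.mp ((Diagram.through_mul_le_right _ _).trans
          (Half.close_through _ _).le)
    exact (Relation.EqvGen.rel _ _ ⟨⟨(Half.stops ∅).close rfl, hclose _ _⟩, h3.symm⟩).symm.trans
      _ _ _ (h1 _ u rfl rfl)
  exact wellConnected_of_small ⟨_, hclose (Half.stops ∅) rfl⟩ fun a b =>
    (h2 a).trans _ _ _ (h2 b).symm

end WellConnected

end Motz

namespace Motz

/-! ### The representation gap of the truncated cyclic Motzkin monoids -/

section CyclicGap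

open scoped Classical

variable {K : Type u} [Field K] {m n k : ℕ} [NeZero m]

/-- The left cell representation with one through strand has a nontrivial simple subquotient. -/
theorem exists_nontrivial_of_two_le (hn : 2 ≤ n) (hk : 1 ≤ k) :
    ∃ d ∈ nontrivialSimpleDims K (truncation m n k), d ≤
      Nat.card (LCell (Diagram.pid {(⟨0, by omega⟩ : Fin n)})) := by
  obtain ⟨p, hp⟩ : ∃ p, p = Diagram.pid {(⟨0, by omega⟩ : Fin n)} := ⟨_, rfl⟩
  rw [← hp]
  have hp1 : p.through = 1 := by rw [hp, Diagram.pid_through, Finset.card_singleton]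
  let a : Small n k := ⟨p, by omega⟩
  let z : Small n k := ⟨Diagram.pid ∅, by rw [Diagram.pid_through, Finset.card_empty]; omega⟩
  have hpp : p * p = p := by
    rw [hp]
    exact Diagram.mul_eq_join (by rw [Diagram.pid_lower, Diagram.pid_upper]) rfl rfl
  have := Fintype.ofFinite (LCell p)
  -- Shifts are made to act trivially, that is, `ζ = 1`. The projection with one through strand is a
  -- non-unit because `n ≥ 2` and fixes its own basis vector; the diagram without through strands
  -- acts by zero.
  obtain ⟨d, hd, hd'⟩ := exists_nontrivialSimpleDims (K := K)
    ((cyclicCellRep (one_pow m) p).comp (truncation m n k).subtype)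
    (e := a.lift 0) (z := z.lift 0) (a.not_isUnit_lift 0) (v := Finsupp.single ⟨p, simL_refl p⟩ 1)
    (by simp) (by
      change cellRep K 1 p ⟨p, _⟩ (Finsupp.single _ 1) = _
      rw [cellRep_single, dif_pos (by rw [hpp]; exact simL_refl p), one_pow]
      congr 1
      exact Subtype.ext hpp) (by
      refine cyclicCellRep_eq_zero (one_pow m) p _ ?_
      rw [Diagram.leJ_iff, hp1]
      change ¬ 1 ≤ (Diagram.pid ∅).through
      rw [Diagram.pid_through, Finset.card_empty]
      omega)
  refine ⟨d, hd, hd'.trans ?_⟩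
  rw [Module.finrank_finsupp_self, Nat.card_eq_fintype_card]

/-- One of the two top points is a through point and the other must be a stop, so only the position
of the through point is free. -/
theorem card_lCell_two : Nat.card (LCell (Diagram.pid {(0 : Fin 2)})) ≤ 2 := by
  have hthru : ∀ l : LCell (Diagram.pid {(0 : Fin 2)}), l.1.upper.thru.card = 1 := by
    intro l
    rw [← Diagram.through_eq, ← Diagram.card_lower, Diagram.simL_iff.mp l.2, Diagram.pid_lower]
    rfl
  have hrel : ∀ l : LCell (Diagram.pid {(0 : Fin 2)}), ∀ i j, l.1.upper.rel i j ↔ i = j := by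
    intro l i j
    refine ⟨fun h => ?_, fun h => h ▸ Setoid.refl' _ _⟩
    by_contra hij
    obtain ⟨c, hc⟩ := Finset.card_eq_one.mp (hthru l)
    have hc' : c ∈ l.1.upper.thru := hc ▸ Finset.mem_singleton_self c
    have h1 : c = i ∨ c = j := by omega
    rcases h1 with rfl | rfl
    · exact hij (l.1.upper.single c hc' j h)
    · exact hij (l.1.upper.single c hc' i (Setoid.symm' _ h)).symm
  have hinj : Function.Injective fun l : LCell (Diagram.pid {(0 : Fin 2)}) =>
      (⟨l.1.upper.thru, Finset.mem_powersetCard_univ.mpr (hthru l)⟩ :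
        Finset.powersetCard 1 (Finset.univ : Finset (Fin 2))) := by
    intro l l' h
    refine Subtype.ext (Diagram.ext_halves (Half.ext (Setoid.ext fun i j => ?_)
      (congrArg Subtype.val h)) ?_)
    · rw [hrel, hrel]
    · rw [Diagram.simL_iff.mp l.2, Diagram.simL_iff.mp l'.2]
  refine (Nat.card_le_card_of_injective _ hinj).trans ?_
  rw [Nat.card_eq_fintype_card, Fintype.card_coe, Finset.card_powersetCard]
  simp

/-- Otherwise well-connectedness makes all representations trivial, which leaves at most one unit
and one non-unit. But the elements over the stop diagram with counts `0` and `1` are distinct for `m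
≥ 2` and are either both units or both non-units. -/
theorem exists_nontrivial_of_le_one (hm : (m : K) ≠ 0) (hn : n ≤ 1) (hm2 : 2 ≤ m) (hkn : k ≤ n) :
    (nontrivialSimpleDims K (truncation m n k)).Nonempty := by
  by_contra hempty
  rw [Set.not_nonempty_iff_eq_empty] at hempty
  obtain ⟨h1, h2⟩ := eq_of_trivialBelow (K := K) (S := truncation m n k) fun N =>
    trivialBelow_of_wellConnected hm truncation_exists_pow (wellConnected_of_le_one hn)
      (by simp [hempty])
  have h01 : (0 : ZMod m) ≠ 1 := by
    have : Fact (1 < m) := ⟨hm2⟩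
    exact zero_ne_one
  have hz : (Diagram.pid (∅ : Finset (Fin n))).through = 0 := by
    rw [Diagram.pid_through, Finset.card_empty]
  let x : ZMod m → truncation m n k := fun g => ⟨⟨Diagram.pid ∅, g⟩, Or.inr (by
    change (Diagram.pid ∅).through ≤ k
    omega)⟩
  have hx : x 0 ≠ x 1 := fun h => h01 (congrArg (fun y => y.1.count) h)
  by_cases hx0 : IsUnit (x 0)
  · have hx1 : IsUnit (x 1) := isUnit_iff_through.mpr
      (show (x 0).1.through = n from isUnit_iff_through.mp hx0)
    exact hx ((h1 _ hx0).trans (h1 _ hx1).symm)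
  · refine hx (h2 _ _ hx0 fun hx1 => hx0 ?_)
    exact isUnit_iff_through.mpr (show (x 1).1.through = n from isUnit_iff_through.mp hx1)

theorem isLeast_gap_truncation (hm : (m : K) ≠ 0) (hkn : k ≤ n)
    (h : n ≤ 1 ∧ 2 ≤ m ∨ n = 2 ∧ 1 ≤ k ∨ 3 ≤ n ∧ 2 ≤ k) :
    IsLeast (nontrivialSimpleDims K (truncation m n k)) (gap K (truncation m n k)) := by
  rcases h with ⟨hn, hm2⟩ | ⟨rfl, hk⟩ | ⟨hn, hk⟩
  · exact isLeast_gap (exists_nontrivial_of_le_one hm hn hm2 hkn) fun N hN =>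
      trivialBelow_of_wellConnected hm truncation_exists_pow (wellConnected_of_le_one hn) hN
  · obtain ⟨d, hd, hd'⟩ := exists_nontrivial_of_two_le (K := K) (m := m) le_rfl hk
    exact isLeast_gap ⟨d, hd⟩ fun N hN => trivialBelow_two hN
      ((hN d hd).trans (hd'.trans card_lCell_two))
  · obtain ⟨d, hd, -⟩ := exists_nontrivial_of_two_le (K := K) (m := m) (n := n) (k := k) (by omega)
      (by omega)
    exact isLeast_gap ⟨d, hd⟩ fun N hN =>
      trivialBelow_of_wellConnected hm truncation_exists_pow (wellConnected_of_three_le hn hk) hN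

end CyclicGap

end Motz

namespace Motz

/-! ### The cell structure of a finite monoid with an anti-involution -/

section CellReps

variable {S : Type} [Monoid S] [Finite S] {star : S → S}

variable (hmul : ∀ a b, star (a * b) = star b * star a) (hinv : ∀ a, star (star a) = a)
  (r : CellReps S star) {l : JCell S}

omit [Finite S] in
include hmul in
theorem leL.map_star {a b : S} (h : leL a b) : leR (star a) (star b) := by
  obtain ⟨c, rfl⟩ := h
  exact ⟨star c, hmul _ _⟩

omit [Finite S] in
include hmul in
theorem leR.map_star {a b : S} (h : leR a b) : leL (star a) (star b) := by
  obtain ⟨c, rfl⟩ := h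
  exact ⟨star c, hmul _ _⟩

omit [Finite S] in
include hmul in
theorem leJ.map_star {a b : S} (h : leJ a b) : leJ (star a) (star b) := by
  obtain ⟨c, d, rfl⟩ := h
  exact ⟨star d, star c, by rw [hmul, hmul, mul_assoc]⟩

omit [Finite S] in
include hmul in
theorem simL.map_star {a b : S} (h : simL a b) : simR (star a) (star b) :=
  ⟨leL.map_star hmul h.1, leL.map_star hmul h.2⟩

omit [Finite S] in
include hmul in
theorem simR.map_star {a b : S} (h : simR a b) : simL (star a) (star b) :=
  ⟨leR.map_star hmul h.1, leR.map_star hmul h.2⟩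

omit [Finite S] in
include hmul in
theorem simJ.map_star {a b : S} (h : simJ a b) : simJ (star a) (star b) :=
  ⟨leJ.map_star hmul h.1, leJ.map_star hmul h.2⟩

omit [Finite S] in
theorem lt_jcell_iff {l : JCell S} {a b : S} (ha : jcell a = l) (h : leJ a b) :
    l < jcell b ↔ ¬ simJ a b := by
  rw [lt_iff_le_and_ne, ← ha]
  exact ⟨fun h' h'' => h'.2 (jcell_eq.mpr h''), fun h' => ⟨jcell_le.mpr h,
    fun h'' => h' (jcell_eq.mp h'')⟩⟩

namespace CellReps

omit [Finite S] in
theorem mem_iff (T : RightCells l) (y : S) : y ∈ T.1 ↔ simR y (r.t l T) := by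
  obtain ⟨x, -, hx⟩ := T.2
  have h := r.t_mem l T
  rw [hx] at h ⊢
  exact ⟨fun h' => simR.trans h' (simR.symm h), fun h' => simR.trans h' h⟩

omit [Finite S] in
theorem eq_of_simR {T U : RightCells l} (h : simR (r.t l T) (r.t l U)) : T = U := by
  refine Subtype.ext (Set.ext fun y => ?_)
  rw [r.mem_iff, r.mem_iff]
  exact ⟨fun h' => h'.trans h, fun h' => h'.trans h.symm⟩

omit [Finite S] in
theorem exists_simR {x : S} (hx : jcell x = l) : ∃ T : RightCells l, simR x (r.t l T) :=
  ⟨⟨{y | simR y x}, x, hx, rfl⟩, (r.mem_iff _ x).mp (simR_refl x)⟩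

/-- The representative as an element of the left cell. -/
def tL (T : RightCells l) : LCell (r.e l).1 := ⟨r.t l T, r.t_simL l T⟩

omit [Finite S] in
theorem exists_retract (T : RightCells l) : ∃ u, u * r.t l T = (r.e l).1 := by
  obtain ⟨u, hu⟩ := (r.t_simL l T).1
  exact ⟨u, hu.symm⟩

omit [Finite S] in
theorem t_mul_e (T : RightCells l) : r.t l T * (r.e l).1 = r.t l T := (r.tL T).mul_right

/-- The product `t_T h` as an element of the left cell. -/
def leftElt (p : RightCells l × HCell (r.e l)) : LCell (r.e l).1 :=
  ⟨r.t l p.1 * p.2.1, simL_mul (r.t_simL l p.1) p.2⟩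

theorem simR_leftElt (p : RightCells l × HCell (r.e l)) :
    simR (r.leftElt p).1 (r.t l p.1) :=
  simR_of_leR (leR_mul _ _) ((r.leftElt p).2.trans (r.t_simL l p.1).symm).simJ.1

/-- `T` is the right cell of `t_T h`, and `h` is recovered from an element `u` with `u t_T = e`. For
`x` in the left cell and in the right cell `T`, the element `u x` lies in `H(e)` by stability, and
`t_T (u x) = x`. -/
theorem leftElt_bijective : Function.Bijective (r.leftElt (l := l)) := by
  constructor
  · rintro ⟨T, h⟩ ⟨U, h'⟩ heq
    have h1 : T = U := r.eq_of_simR ((r.simR_leftElt (T, h)).symm.trans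
      (heq ▸ r.simR_leftElt (U, h')))
    subst h1
    obtain ⟨u, hu⟩ := r.exists_retract T
    have h2 : u * (r.t l T * h.1) = u * (r.t l T * h'.1) :=
      congrArg (fun z : LCell (r.e l).1 => u * z.1) heq
    rw [← mul_assoc, ← mul_assoc, hu, h.mul_left, h'.mul_left] at h2
    rw [Subtype.ext h2]
  · intro x
    obtain ⟨T, hT⟩ := r.exists_simR (l := l) (x := x.1)
      ((jcell_eq.mpr x.2.simJ).trans (r.jcell_e l))
    obtain ⟨u, hu⟩ := r.exists_retract T
    obtain ⟨c, hc⟩ := hT.2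
    have h1 : r.t l T * (u * x.1) = x.1 := by
      rw [hc, ← mul_assoc u, hu, ← mul_assoc, r.t_mul_e]
    refine ⟨(T, ⟨u * x.1, simH_of_leJ ⟨u * x.1, by rw [mul_assoc, x.mul_right]⟩
      ⟨c, by rw [hc, ← mul_assoc, hu]⟩ ?_⟩), Subtype.ext h1⟩
    exact leJ_trans ⟨r.t l T, 1, by rw [mul_one]; exact h1.symm⟩ x.2.simJ.1

omit [Finite S] in
include hmul in
theorem e_mul_star (B : RightCells l) : (r.e l).1 * star (r.t l B) = star (r.t l B) := by
  conv_lhs => rw [← r.star_e l, ← hmul, r.t_mul_e]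

omit [Finite S] in
include hmul in
theorem star_simR {x : S} (h : simL x (r.e l).1) : simR (star x) (r.e l).1 := by
  have := simL.map_star hmul h
  rwa [r.star_e] at this

omit [Finite S] in
include hmul in
theorem star_simL {x : S} (h : simR x (r.e l).1) : simL (star x) (r.e l).1 := by
  have := simR.map_star hmul h
  rwa [r.star_e] at this

/-- The product `h t_B^*` as an element of the right cell. -/
def rightElt (p : RightCells l × HCell (r.e l)) : RCell (r.e l).1 :=
  ⟨p.2.1 * star (r.t l p.1), simR_mul (r.star_simR hmul (r.t_simL l p.1)) p.2⟩

omit [Finite S] in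
include hinv in
theorem starH_starH (h : HCell (r.e l)) : r.starH l (r.starH l h) = h :=
  Subtype.ext (by rw [r.coe_starH, r.coe_starH, hinv])

include hinv in
-- The anti-involution exchanges the left and right cell of `e = e^*` and carries `h t_B^*` to `t_B
-- h^*`, which reduces the claim to the left cell.
theorem rightElt_bijective : Function.Bijective (r.rightElt hmul (l := l)) := by
  have key : ∀ p, star (r.rightElt hmul (l := l) p).1 = (r.leftElt (p.1, r.starH l p.2)).1 := by
    intro p
    change star (p.2.1 * star (r.t l p.1)) = r.t l p.1 * (r.starH l p.2).1
    rw [hmul, hinv, r.coe_starH]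
  constructor
  · intro p q hpq
    have h1 := r.leftElt_bijective.1 (Subtype.ext ((key p).symm.trans
      ((congrArg (fun z : RCell (r.e l).1 => star z.1) hpq).trans (key q))))
    rw [Prod.mk.injEq] at h1
    refine Prod.ext h1.1 ?_
    rw [← r.starH_starH hinv p.2, h1.2, r.starH_starH hinv]
  · intro x
    obtain ⟨⟨T, h⟩, hp⟩ := r.leftElt_bijective.2 ⟨star x.1, r.star_simL hmul x.2⟩
    refine ⟨(T, r.starH l h), Subtype.ext ?_⟩
    rw [← hinv (r.rightElt hmul _).1, key, r.starH_starH hinv, hp, hinv]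

/-- The elements `t_T h t_B^*`. -/
def elt (r : CellReps S star) (p : Σ l : JCell S, RightCells l × HCell (r.e l) × RightCells l) : S :=
  r.t p.1 p.2.1 * p.2.2.1.1 * star (r.t p.1 p.2.2.2)

omit [Finite S] in
include hmul in
theorem exists_retract_elt (p : Σ l : JCell S, RightCells l × HCell (r.e l) × RightCells l) :
    ∃ u v, u * r.t p.1 p.2.1 = (r.e p.1).1 ∧ star (r.t p.1 p.2.2.2) * v = (r.e p.1).1 ∧
      u * r.elt p * v = p.2.2.1.1 := by
  obtain ⟨l, T, h, B⟩ := p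
  obtain ⟨u, hu⟩ := r.exists_retract T
  obtain ⟨v, hv⟩ := r.exists_retract B
  have hv' : star (r.t l B) * star v = (r.e l).1 := by rw [← hmul, hv, r.star_e]
  refine ⟨u, star v, hu, hv', ?_⟩
  change u * (r.t l T * h.1 * star (r.t l B)) * star v = h.1
  rw [mul_assoc, mul_assoc _ _ (star v), hv', ← mul_assoc, ← mul_assoc, hu, h.mul_left, h.mul_right]

omit [Finite S] in
include hmul in
-- Multiplication on both sides recovers `h`, so the product with `t_T` and `t_B^*` cannot have
-- moved to a higher cell.
theorem jcell_elt (p : Σ l : JCell S, RightCells l × HCell (r.e l) × RightCells l) :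
    jcell (r.elt p) = p.1 := by
  obtain ⟨u, v, -, -, h⟩ := r.exists_retract_elt hmul p
  rw [← r.jcell_e p.1, jcell_eq]
  refine ⟨leJ_trans ⟨u, v, h.symm⟩ p.2.2.1.2.1.simJ.1, ?_⟩
  exact leJ_trans (leJ_trans (r.t_simL p.1 p.2.1).simJ.2 (leR_mul _ p.2.2.1.1).leJ)
    (leR_mul _ _).leJ

include hmul hinv in
-- The cell, the right cell `T` of the element and the right cell `B` of its image under `star` are
-- determined by the element, and then `h` is recovered by cancelling `t_B^*` and `t_T`. Conversely
-- `h = u x v^*`, where `u t_T = e` and `v t_B = e`.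
theorem elt_bijective : Function.Bijective r.elt := by
  have hR : ∀ p, simR (r.elt p) (r.t p.1 p.2.1) := by
    intro p
    refine simR_of_leR ⟨p.2.2.1.1 * star (r.t p.1 p.2.2.2), mul_assoc _ _ _⟩ ?_
    rw [← jcell_le, r.jcell_elt hmul, jcell_eq.mpr (r.t_simL p.1 p.2.1).simJ, r.jcell_e]
  have hL : ∀ p, simR (star (r.elt p)) (r.t p.1 p.2.2.2) := by
    intro p
    have h1 : simL (r.elt p) (star (r.t p.1 p.2.2.2)) := by
      refine simL_of_leL (leL_mul _ _) ?_
      rw [← jcell_le, r.jcell_elt hmul, jcell_eq.mpr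
        (r.star_simR hmul (r.t_simL p.1 p.2.2.2)).simJ, r.jcell_e]
    have := simL.map_star hmul h1
    rwa [hinv] at this
  constructor
  · intro p q hpq
    have h1 : p.1 = q.1 := by rw [← r.jcell_elt hmul p, hpq, r.jcell_elt hmul q]
    have h2 := hR p
    have h3 := hL p
    obtain ⟨l, T, h, B⟩ := p
    obtain ⟨l', T', h', B'⟩ := q
    obtain rfl : l = l' := h1
    obtain rfl : T = T' := r.eq_of_simR (h2.symm.trans (hpq ▸ hR _))
    obtain rfl : B = B' := r.eq_of_simR (h3.symm.trans (hpq ▸ hL _))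
    obtain ⟨u, hu⟩ := r.exists_retract T
    obtain ⟨v, hv⟩ := r.exists_retract B
    have h4 : (r.leftElt (T, h)).1 = (r.leftElt (T, h')).1 := by
      have hv' : star (r.t l B) * star v = (r.e l).1 := by rw [← hmul, hv, r.star_e]
      have := congrArg (· * star v) hpq
      simp only [elt, mul_assoc, hv', h.mul_right, h'.mul_right] at this
      exact this
    have h5 := r.leftElt_bijective.1 (Subtype.ext h4)
    rw [Prod.mk.injEq] at h5
    rw [h5.2]
  · intro x
    obtain ⟨l, hl⟩ : ∃ l, l = jcell x := ⟨_, rfl⟩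
    obtain ⟨T, hT⟩ := r.exists_simR hl.symm
    have hxe : simJ x (r.e l).1 := jcell_eq.mp (hl.symm.trans (r.jcell_e l).symm)
    have hx' : jcell (star x) = l := by
      rw [← r.jcell_e l, jcell_eq, ← r.star_e]
      exact simJ.map_star hmul hxe
    obtain ⟨B, hB⟩ := r.exists_simR hx'
    obtain ⟨u, hu⟩ := r.exists_retract T
    obtain ⟨v, hv⟩ := r.exists_retract B
    have hv' : star (r.t l B) * star v = (r.e l).1 := by rw [← hmul, hv, r.star_e]
    obtain ⟨c, hc⟩ := hT.2
    obtain ⟨d, hd⟩ := hB.2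
    have hd' : x = star d * star (r.t l B) := by rw [← hmul, ← hd, hinv]
    have h1 : r.t l T * (u * x) = x := by
      rw [hc, ← mul_assoc u, hu, ← mul_assoc, r.t_mul_e]
    have h2 : x * star v * star (r.t l B) = x := by
      rw [hd', mul_assoc (star d), hv', mul_assoc, r.e_mul_star hmul]
    have h3 : r.t l T * (u * x * star v) * star (r.t l B) = x := by
      rw [← mul_assoc, h1, h2]
    refine ⟨⟨l, T, ⟨u * x * star v, simH_of_leJ ⟨u * star d, ?_⟩ ⟨c * star v, ?_⟩ ?_⟩, B⟩, h3⟩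
    · rw [hd', mul_assoc, mul_assoc (star d), hv', mul_assoc]
    · rw [hc, ← mul_assoc, hu, mul_assoc]
    · exact leJ_trans ⟨_, _, h3.symm⟩ hxe.1

end CellReps

end CellReps

end Motz

namespace Motz

/-! ### The sandwich cellular structure of a monoid algebra -/

section SandwichMonoid

open scoped TensorProduct Classical

variable {K : Type u} [Field K]

section LinExt

variable {M : Type} [Monoid M] {V : Type u} [AddCommGroup V] [Module K V]

theorem linExt_of (f : M → V) (a : M) : linExt (K := K) f (MonoidAlgebra.of K M a) = f a := by
  have : MonoidAlgebra.of K M a = MonoidAlgebra.basis M K a := by simp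
  rw [this]
  exact Module.Basis.constr_basis _ _ _ _

theorem linExt_mul {f : M → Module.End K V} (hf : ∀ a b, f (a * b) = f a * f b)
    (x y : MonoidAlgebra K M) : linExt f (x * y) = linExt f x * linExt f y := by
  induction x using MonoidAlgebra.induction_on with
  | of s =>
    induction y using MonoidAlgebra.induction_on with
    | of t => rw [← map_mul, linExt_of, linExt_of, linExt_of, hf]
    | add a b ha hb => rw [mul_add, map_add, map_add, ha, hb, mul_add]
    | smul c a ha => rw [mul_smul_comm, map_smul, map_smul, ha, mul_smul_comm]
  | add a b ha hb => rw [add_mul, map_add, map_add, ha, hb, add_mul]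
  | smul c a ha => rw [smul_mul_assoc, map_smul, map_smul, ha, smul_mul_assoc]

theorem linExt_mul_rev {f : M → Module.End K V} (hf : ∀ a b, f (a * b) = f b * f a)
    (x y : MonoidAlgebra K M) : linExt f (x * y) = linExt f y * linExt f x := by
  induction x using MonoidAlgebra.induction_on with
  | of s =>
    induction y using MonoidAlgebra.induction_on with
    | of t => rw [← map_mul, linExt_of, linExt_of, linExt_of, hf]
    | add a b ha hb => rw [mul_add, map_add, map_add, ha, hb, add_mul]
    | smul c a ha => rw [mul_smul_comm, map_smul, map_smul, ha, smul_mul_assoc]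
  | add a b ha hb => rw [add_mul, map_add, map_add, ha, hb, mul_add]
  | smul c a ha => rw [smul_mul_assoc, map_smul, map_smul, ha, mul_smul_comm]

theorem linExt_one {f : M → Module.End K V} (hf : f 1 = 1) :
    linExt f (1 : MonoidAlgebra K M) = 1 := by
  rw [← map_one (MonoidAlgebra.of K M), linExt_of, hf]

theorem linExt_comm {N : Type} [Monoid N] {f : M → Module.End K V} {g : N → Module.End K V}
    (h : ∀ a b, f a * g b = g b * f a) (x : MonoidAlgebra K M) (y : MonoidAlgebra K N) :
    linExt f x * linExt g y = linExt g y * linExt f x := by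
  induction x using MonoidAlgebra.induction_on with
  | of s =>
    induction y using MonoidAlgebra.induction_on with
    | of t => rw [linExt_of, linExt_of, h]
    | add a b ha hb => rw [map_add, mul_add, ha, hb, add_mul]
    | smul c a ha => rw [map_smul, mul_smul_comm, ha, smul_mul_assoc]
  | add a b ha hb => rw [map_add, mul_add, ← ha, ← hb, add_mul]
  | smul c a ha => rw [map_smul, mul_smul_comm, ← ha, smul_mul_assoc]

end LinExt

section Actions

variable {S : Type} [Monoid S] {e : Idem S}

theorem deltaRight_one : deltaRight K (1 : HCell e) = 1 := by
  refine Delta.hom_ext fun l => ?_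
  rw [deltaRight_single]
  exact congrArg (Delta.single K) (Subtype.ext l.mul_right)

theorem deltaRight_mul (h k : HCell e) : deltaRight K (h * k) = deltaRight K k * deltaRight K h := by
  refine Delta.hom_ext fun l => ?_
  rw [Module.End.mul_apply, deltaRight_single, deltaRight_single, deltaRight_single]
  exact congrArg (Delta.single K) (Subtype.ext (mul_assoc _ _ _).symm)

variable (K) in
/-- The basis vector of `∇_R` given by an element of `R`. -/
noncomputable def Nabla.single {x : S} (l : RCell x) : Nabla K x :=
  (Finsupp.single l (1 : K) : RCell x →₀ K)

theorem Nabla.hom_ext {x : S} {X : Type*} [AddCommGroup X] [Module K X] {f g : Nabla K x →ₗ[K] X}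
    (h : ∀ l, f (Nabla.single K l) = g (Nabla.single K l)) : f = g :=
  Finsupp.lhom_ext' (M := K) (α := RCell x) fun l => LinearMap.ext_ring (h l)

theorem Nabla.exists_lift {x : S} {X : Type*} [AddCommGroup X] [Module K X] (F : RCell x → X) :
    ∃ f : Nabla K x →ₗ[K] X, ∀ l, f (Nabla.single K l) = F l :=
  ⟨Finsupp.linearCombination K F, fun _ =>
    (Finsupp.linearCombination_single _ _ _).trans (one_smul _ _)⟩

theorem nablaRight_single (x s : S) (l : RCell x) : nablaRight K x s (Nabla.single K l) =
    if h : simR (l.1 * s) x then Nabla.single K ⟨l.1 * s, h⟩ else 0 :=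
  (Finsupp.linearCombination_single (α := RCell x) (M := RCell x →₀ K) K (1 : K) l).trans
    (one_smul K _)

theorem nablaLeft_single (h : HCell e) (l : RCell e.1) :
    nablaLeft K h (Nabla.single K l) = Nabla.single K ⟨h.1 * l.1, simR_mul l.2 h⟩ :=
  Finsupp.mapDomain_single

theorem nablaLeft_one : nablaLeft K (1 : HCell e) = 1 := by
  refine Nabla.hom_ext fun l => ?_
  rw [nablaLeft_single]
  exact congrArg (Nabla.single K) (Subtype.ext l.mul_left)

theorem nablaLeft_mul (h k : HCell e) : nablaLeft K (h * k) = nablaLeft K h * nablaLeft K k := by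
  refine Nabla.hom_ext fun l => ?_
  rw [Module.End.mul_apply, nablaLeft_single, nablaLeft_single, nablaLeft_single]
  exact congrArg (Nabla.single K) (Subtype.ext (mul_assoc _ _ _))

theorem nablaRight_one (x : S) : nablaRight K x 1 = 1 := by
  refine Nabla.hom_ext fun l => ?_
  rw [nablaRight_single, dif_pos (by rw [mul_one]; exact l.2)]
  exact congrArg (Nabla.single K) (Subtype.ext (mul_one _))

theorem nablaRight_mul (x s t : S) :
    nablaRight K x (s * t) = nablaRight K x t * nablaRight K x s := by
  refine Nabla.hom_ext fun l => ?_
  rw [Module.End.mul_apply, nablaRight_single, nablaRight_single]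
  by_cases h : simR (l.1 * s) x
  · rw [dif_pos h, nablaRight_single]
    simp only [mul_assoc]
  · rw [dif_neg h, map_zero, dif_neg]
    intro h'
    rw [← mul_assoc] at h'
    exact h ⟨leR_trans (leR_mul _ t) h'.1, leR_trans l.2.2 (leR_mul _ s)⟩

/-- Left multiplication by `H(e)` preserves membership of `l * s` in the right cell of `e`. -/
theorem simR_mul_iff (s : S) (l : RCell e.1) (h : HCell e) :
    simR (h.1 * l.1 * s) e.1 ↔ simR (l.1 * s) e.1 := by
  constructor
  · rintro ⟨⟨c, hc⟩, -⟩
    obtain ⟨⟨d, hd⟩, -⟩ := h.2.1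
    have h1 : l.1 * s * c = d * e.1 := by
      calc l.1 * s * c = e.1 * l.1 * s * c := by rw [l.mul_left]
        _ = d * h.1 * l.1 * s * c := congrArg (fun z => z * l.1 * s * c) hd
        _ = d * (h.1 * l.1 * s * c) := by simp only [mul_assoc]
        _ = d * e.1 := by rw [← hc]
    refine ⟨⟨c * h.1, ?_⟩, ⟨l.1 * s, ?_⟩⟩
    · rw [← mul_assoc, h1, mul_assoc, h.mul_left, ← hd]
    · rw [← mul_assoc, l.mul_left]
  · intro hs
    rw [mul_assoc]
    exact simR_mul hs h

theorem nablaRight_nablaLeft (s : S) (h : HCell e) :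
    nablaRight K e.1 s * nablaLeft K h = nablaLeft K h * nablaRight K e.1 s := by
  refine Nabla.hom_ext fun l => ?_
  rw [Module.End.mul_apply, Module.End.mul_apply, nablaLeft_single, nablaRight_single,
    nablaRight_single]
  by_cases hl : simR (l.1 * s) e.1
  · rw [dif_pos hl, dif_pos ((simR_mul_iff s l h).mpr hl), nablaLeft_single]
    simp only [mul_assoc]
  · rw [dif_neg hl, dif_neg fun h' => hl ((simR_mul_iff s l h).mp h'), map_zero]

end Actions

section Free

variable {T H L : Type} [Monoid H]

/-- A set with a free right action of `H` gives a free module. -/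
theorem bijective_sum_of_bijective (m : T × H → L) (hm : Function.Bijective m) {V : Type u}
    [AddCommGroup V] [Module K V] (φ : V ≃ₗ[K] (L →₀ K)) (act : H → V →ₗ[K] V) (v : T → V)
    (hact : ∀ T h, φ (act h (v T)) = Finsupp.single (m (T, h)) 1) :
    Function.Bijective fun f : T →₀ MonoidAlgebra K H =>
      f.sum fun i h => (linExt act : MonoidAlgebra K H →ₗ[K] Module.End K V) h (v i) := by
  -- Functions from `T` to the algebra of `H` are functions on `T × H`, hence on `L` by `m`; the sum
  -- in question is this identification.
  let Φ : (T →₀ MonoidAlgebra K H) ≃ₗ[K] V :=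
    (Finsupp.mapRange.linearEquiv (MonoidAlgebra.coeffLinearEquiv K)).trans
      ((Finsupp.curryLinearEquiv K).symm.trans
        ((Finsupp.domLCongr (Equiv.ofBijective m hm)).trans φ.symm))
  have h1 : ∀ f, (f.sum fun i h => (linExt act : MonoidAlgebra K H →ₗ[K] Module.End K V) h (v i)) =
      Φ f := by
    intro f
    induction f using Finsupp.induction_linear with
    | zero => rw [Finsupp.sum_zero_index, map_zero]
    | add f g hf hg =>
      rw [Finsupp.sum_add_index' (by simp) (by simp), hf, hg, map_add]
    | single t a =>
      rw [Finsupp.sum_single_index (by simp)]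
      induction a using MonoidAlgebra.induction_on with
      | of h =>
        rw [linExt_of, ← φ.symm_apply_apply (act h (v t)), hact]
        refine congrArg φ.symm ?_
        have h2 : Finsupp.mapRange.linearEquiv (α := T) (MonoidAlgebra.coeffLinearEquiv K (M := H) (S := K))
            (Finsupp.single t (MonoidAlgebra.of K H h)) = Finsupp.single t (Finsupp.single h 1) := by
          rw [Finsupp.mapRange.linearEquiv_apply]
          exact Finsupp.mapRange_single
        change _ = Finsupp.domLCongr (Equiv.ofBijective m hm) ((Finsupp.curryLinearEquiv K).symm
          (Finsupp.mapRange.linearEquiv (MonoidAlgebra.coeffLinearEquiv K) _))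
        rw [h2]
        simp
      | add a b ha hb => rw [map_add, LinearMap.add_apply, ha, hb, ← map_add, Finsupp.single_add]
      | smul c a ha =>
        rw [map_smul, LinearMap.smul_apply, ha, ← map_smul, Finsupp.smul_single]
  simp only [h1]
  exact Φ.bijective

end Free

end SandwichMonoid

end Motz

namespace Motz

/-! ### Multiplication modulo higher cells and the tensor product of the two cell representations -/

section SandwichMonoid

open scoped TensorProduct Classical

variable {K : Type u} [Field K] {S : Type} [Monoid S]

variable (K) in
/-- The span of the elements in `J`-cells above `l`. -/
noncomputable def gtSpan (l : JCell S) : Submodule K (MonoidAlgebra K S) :=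
  Submodule.span K {a | ∃ s, l < jcell s ∧ a = MonoidAlgebra.of K S s}

theorem of_mem_gtSpan {l : JCell S} {s : S} (h : l < jcell s) :
    MonoidAlgebra.of K S s ∈ gtSpan K l := Submodule.subset_span ⟨s, h, rfl⟩

theorem gtSpan_mul_mem (l : JCell S) (x : MonoidAlgebra K S) {a : MonoidAlgebra K S}
    (ha : a ∈ gtSpan K l) : x * a ∈ gtSpan K l := by
  induction ha using Submodule.span_induction with
  | mem a ha =>
    obtain ⟨s, hs, rfl⟩ := ha
    induction x using MonoidAlgebra.induction_on with
    | of t => rw [← map_mul]; exact of_mem_gtSpan (hs.trans_le (jcell_le.mpr (leL_mul t s).leJ))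
    | add a b ha hb => rw [add_mul]; exact add_mem ha hb
    | smul c a ha => rw [smul_mul_assoc]; exact Submodule.smul_mem _ _ ha
  | zero => rw [mul_zero]; exact zero_mem _
  | add a b _ _ ha hb => rw [mul_add]; exact add_mem ha hb
  | smul c a _ ha => rw [mul_smul_comm]; exact Submodule.smul_mem _ _ ha

theorem gtSpan_mem_mul (l : JCell S) (x : MonoidAlgebra K S) {a : MonoidAlgebra K S}
    (ha : a ∈ gtSpan K l) : a * x ∈ gtSpan K l := by
  induction ha using Submodule.span_induction with
  | mem a ha =>
    obtain ⟨s, hs, rfl⟩ := ha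
    induction x using MonoidAlgebra.induction_on with
    | of t => rw [← map_mul]; exact of_mem_gtSpan (hs.trans_le (jcell_le.mpr (leR_mul s t).leJ))
    | add a b ha hb => rw [mul_add]; exact add_mem ha hb
    | smul c a ha => rw [mul_smul_comm]; exact Submodule.smul_mem _ _ ha
  | zero => rw [zero_mul]; exact zero_mem _
  | add a b _ _ ha hb => rw [add_mul]; exact add_mem ha hb
  | smul c a _ ha => rw [smul_mul_assoc]; exact Submodule.smul_mem _ _ ha

variable [Finite S] {star : S → S}
  (hmul : ∀ a b, star (a * b) = star b * star a) (hinv : ∀ a, star (star a) = a)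
  (r : CellReps S star) {l : JCell S}

/-- By stability, left multiplication that stays in the `J`-cell stays in the left cell; leaving the
left cell therefore means moving strictly up. -/
theorem lt_jcell_of_not_simL {e l s : S} (hl : simL l e) (h : ¬ simL (s * l) e) :
    jcell e < jcell (s * l) := by
  refine (lt_jcell_iff rfl (leJ_trans hl.simJ.2 (leL_mul s l).leJ)).mpr fun h' => h ?_
  exact (simL_of_leL (leL_mul s l) (h'.symm.trans hl.symm.simJ).1).trans hl

theorem lt_jcell_of_not_simR {e l s : S} (hl : simR l e) (h : ¬ simR (l * s) e) :
    jcell e < jcell (l * s) := by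
  refine (lt_jcell_iff rfl (leJ_trans hl.simJ.2 (leR_mul l s).leJ)).mpr fun h' => h ?_
  exact (simR_of_leR (leR_mul l s) (h'.symm.trans hl.symm.simJ).1).trans hl

/-- For a monoid element `s`, either `s t_T = t_U a` with a unique pair `(U, a)`, or `s t_T` lies in
a higher cell. Neither alternative involves `h` or `B`, which gives the required independence. -/
theorem exists_left_mul (T : RightCells l) (x : MonoidAlgebra K S) :
    ∃ ρ : RightCells l →₀ MonoidAlgebra K (HCell (r.e l)), ∀ (h : HCell (r.e l)) (B : RightCells l),
      x * MonoidAlgebra.of K S (r.t l T * h.1 * star (r.t l B)) -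
        ρ.sum (fun U a => linExt (K := K) (fun h : HCell (r.e l) =>
          MonoidAlgebra.of K S (r.t l U * h.1 * star (r.t l B))) (a * MonoidAlgebra.of K _ h)) ∈
        gtSpan K l := by
  induction x using MonoidAlgebra.induction_on with
  | of s =>
    by_cases hs : simL (s * r.t l T) (r.e l).1
    · obtain ⟨⟨U, a⟩, hU⟩ := r.leftElt_bijective.2 ⟨_, hs⟩
      have hU' : r.t l U * a.1 = s * r.t l T := congrArg Subtype.val hU
      refine ⟨Finsupp.single U (MonoidAlgebra.of K _ a), fun h B => ?_⟩
      rw [Finsupp.sum_single_index (by rw [zero_mul, map_zero]), ← map_mul, ← map_mul, linExt_of,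
        HCell.coe_mul, ← mul_assoc, ← mul_assoc, ← mul_assoc, hU', sub_self]
      exact zero_mem _
    · refine ⟨0, fun h B => ?_⟩
      rw [Finsupp.sum_zero_index, sub_zero, ← map_mul, ← mul_assoc, ← mul_assoc]
      have h1 := lt_jcell_of_not_simL (r.t_simL l T) hs
      rw [r.jcell_e] at h1
      rw [mul_assoc]
      exact of_mem_gtSpan (h1.trans_le (jcell_le.mpr (leR_mul _ _).leJ))
  | add a b ha hb =>
    obtain ⟨ρ, hρ⟩ := ha
    obtain ⟨σ, hσ⟩ := hb
    refine ⟨ρ + σ, fun h B => ?_⟩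
    rw [Finsupp.sum_add_index' (by simp) (by simp [add_mul]), add_mul, add_sub_add_comm]
    exact add_mem (hρ h B) (hσ h B)
  | smul c a ha =>
    obtain ⟨ρ, hρ⟩ := ha
    refine ⟨c • ρ, fun h B => ?_⟩
    rw [Finsupp.sum_smul_index' (by simp), smul_mul_assoc]
    simp only [smul_mul_assoc, map_smul]
    rw [← Finsupp.smul_sum, ← smul_sub]
    exact Submodule.smul_mem _ _ (hρ h B)

include hmul hinv in
theorem exists_right_mul (B : RightCells l) (x : MonoidAlgebra K S) :
    ∃ ρ : RightCells l →₀ MonoidAlgebra K (HCell (r.e l)), ∀ (h : HCell (r.e l)) (T : RightCells l),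
      MonoidAlgebra.of K S (r.t l T * h.1 * star (r.t l B)) * x -
        ρ.sum (fun U a => linExt (K := K) (fun h : HCell (r.e l) =>
          MonoidAlgebra.of K S (r.t l T * h.1 * star (r.t l U))) (MonoidAlgebra.of K _ h * a)) ∈
        gtSpan K l := by
  induction x using MonoidAlgebra.induction_on with
  | of s =>
    by_cases hs : simR (star (r.t l B) * s) (r.e l).1
    · obtain ⟨⟨U, a⟩, hU⟩ := (r.rightElt_bijective hmul hinv).2 ⟨_, hs⟩
      have hU' : a.1 * star (r.t l U) = star (r.t l B) * s := congrArg Subtype.val hU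
      refine ⟨Finsupp.single U (MonoidAlgebra.of K _ a), fun h T => ?_⟩
      rw [Finsupp.sum_single_index (by rw [mul_zero, map_zero]), ← map_mul, ← map_mul, linExt_of,
        HCell.coe_mul, mul_assoc, mul_assoc, mul_assoc (r.t l T), mul_assoc h.1, hU', sub_self]
      exact zero_mem _
    · refine ⟨0, fun h T => ?_⟩
      rw [Finsupp.sum_zero_index, sub_zero, ← map_mul, mul_assoc]
      have h1 := lt_jcell_of_not_simR (r.star_simR hmul (r.t_simL l B)) hs
      rw [r.jcell_e] at h1
      exact of_mem_gtSpan (h1.trans_le (jcell_le.mpr (leL_mul _ _).leJ))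
  | add a b ha hb =>
    obtain ⟨ρ, hρ⟩ := ha
    obtain ⟨σ, hσ⟩ := hb
    refine ⟨ρ + σ, fun h B => ?_⟩
    rw [Finsupp.sum_add_index' (by simp) (by simp [mul_add]), mul_add, add_sub_add_comm]
    exact add_mem (hρ h B) (hσ h B)
  | smul c a ha =>
    obtain ⟨ρ, hρ⟩ := ha
    refine ⟨c • ρ, fun h B => ?_⟩
    rw [Finsupp.sum_smul_index' (by simp), mul_smul_comm]
    simp only [mul_smul_comm, map_smul]
    rw [← Finsupp.smul_sum, ← smul_sub]
    exact Submodule.smul_mem _ _ (hρ h B)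

/-- The relations of the tensor product over the algebra of `H(e)`. -/
noncomputable def tensorBalance (K : Type u) [Field K] (e : Idem S) :
    Submodule K (Delta K e.1 ⊗[K] Nabla K e.1) :=
  Submodule.span K {t | ∃ h d v,
    t = (linExt (fun h => deltaRight K (e := e) h) : MonoidAlgebra K (HCell e) →ₗ[K] _) h d ⊗ₜ[K] v -
      d ⊗ₜ[K] (linExt (fun h => nablaLeft K (e := e) h) : MonoidAlgebra K (HCell e) →ₗ[K] _) h v}

omit [Finite S] in
variable (K) in
-- The multiplication of the left cell with the right cell, modulo higher cells; it will induce the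
-- isomorphism with the cell algebra.
theorem exists_tensor_hom (l : JCell S) (e : S) :
    ∃ F : Delta K e ⊗[K] Nabla K e →ₗ[K] MonoidAlgebra K S ⧸ gtSpan K l,
      ∀ a b, F (Delta.single K a ⊗ₜ[K] Nabla.single K b) =
        (gtSpan K l).mkQ (MonoidAlgebra.of K S (a.1 * b.1)) := by
  choose G hG using fun a : LCell e => Nabla.exists_lift (K := K) (x := e) fun b =>
    (gtSpan K l).mkQ (MonoidAlgebra.of K S (a.1 * b.1))
  obtain ⟨F, hF⟩ := Delta.exists_lift (K := K) (x := e) G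
  refine ⟨TensorProduct.lift F, fun a b => ?_⟩
  rw [TensorProduct.lift.tmul, hF, hG]

section TensorHom

variable {F : Delta K (r.e l).1 ⊗[K] Nabla K (r.e l).1 →ₗ[K] MonoidAlgebra K S ⧸ gtSpan K l}
  (hF : ∀ a b, F (Delta.single K a ⊗ₜ[K] Nabla.single K b) =
    (gtSpan K l).mkQ (MonoidAlgebra.of K S (a.1 * b.1)))
include hF

omit [Finite S] in
theorem tensorBalance_le_ker : tensorBalance K (r.e l) ≤ LinearMap.ker F := by
  refine Submodule.span_le.mpr ?_
  rintro _ ⟨h, d, v, rfl⟩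
  rw [SetLike.mem_coe, LinearMap.mem_ker, map_sub, sub_eq_zero]
  induction h using MonoidAlgebra.induction_on with
  | of h =>
    rw [linExt_of, linExt_of]
    have : F ∘ₗ TensorProduct.map (deltaRight K h) LinearMap.id =
        F ∘ₗ TensorProduct.map LinearMap.id (nablaLeft K h) := by
      refine TensorProduct.ext (Delta.hom_ext fun a => Nabla.hom_ext fun b => ?_)
      change F (deltaRight K h (Delta.single K a) ⊗ₜ[K] Nabla.single K b) =
        F (Delta.single K a ⊗ₜ[K] nablaLeft K h (Nabla.single K b))
      rw [deltaRight_single, nablaLeft_single, hF, hF]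
      simp only [mul_assoc]
    exact LinearMap.congr_fun this (d ⊗ₜ[K] v)
  | add a b ha hb =>
    rw [map_add, map_add, LinearMap.add_apply, LinearMap.add_apply, TensorProduct.add_tmul,
      TensorProduct.tmul_add, map_add, map_add, ha, hb]
  | smul c a ha =>
    rw [map_smul, map_smul, LinearMap.smul_apply, LinearMap.smul_apply, ← TensorProduct.smul_tmul',
      TensorProduct.tmul_smul, map_smul, map_smul, ha]

/-- When `s a` leaves the left cell, the action gives zero on one side, and on the other `s a b`
lies in a strictly higher cell and vanishes in the quotient. -/
theorem tensorHom_left (x y : MonoidAlgebra K S) (d : Delta K (r.e l).1) (v : Nabla K (r.e l).1)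
    (hy : (gtSpan K l).mkQ y = F (d ⊗ₜ[K] v)) :
    (gtSpan K l).mkQ (x * y) =
      F ((linExt (fun s => deltaLeft K (r.e l).1 s) : MonoidAlgebra K S →ₗ[K] _) x d ⊗ₜ[K] v) := by
  induction x using MonoidAlgebra.induction_on with
  | of s =>
    let Λ : MonoidAlgebra K S ⧸ gtSpan K l →ₗ[K] MonoidAlgebra K S ⧸ gtSpan K l :=
      Submodule.mapQ _ _ (LinearMap.mulLeft K (MonoidAlgebra.of K S s))
        fun a ha => gtSpan_mul_mem l _ ha
    have h1 : (gtSpan K l).mkQ (MonoidAlgebra.of K S s * y) = Λ ((gtSpan K l).mkQ y) := rfl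
    rw [h1, hy, linExt_of]
    have : Λ ∘ₗ F = F ∘ₗ TensorProduct.map (deltaLeft K (r.e l).1 s) LinearMap.id := by
      refine TensorProduct.ext (Delta.hom_ext fun a => Nabla.hom_ext fun b => ?_)
      change Λ (F (Delta.single K a ⊗ₜ[K] Nabla.single K b)) =
        F (deltaLeft K (r.e l).1 s (Delta.single K a) ⊗ₜ[K] Nabla.single K b)
      rw [deltaLeft_single, hF]
      change (gtSpan K l).mkQ (MonoidAlgebra.of K S s * MonoidAlgebra.of K S (a.1 * b.1)) = _
      rw [← map_mul, ← mul_assoc]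
      by_cases hs : simL (s * a.1) (r.e l).1
      · rw [dif_pos hs, hF]
      · rw [dif_neg hs, TensorProduct.zero_tmul, map_zero]
        have h2 := lt_jcell_of_not_simL a.2 hs
        rw [r.jcell_e] at h2
        exact (Submodule.Quotient.mk_eq_zero _).mpr
          (of_mem_gtSpan (h2.trans_le (jcell_le.mpr (leR_mul _ _).leJ)))
    exact LinearMap.congr_fun this (d ⊗ₜ[K] v)
  | add a b ha hb =>
    rw [add_mul, map_add, ha, hb, map_add, LinearMap.add_apply, TensorProduct.add_tmul, map_add]
  | smul c a ha =>
    rw [smul_mul_assoc, map_smul, ha, map_smul, LinearMap.smul_apply, ← TensorProduct.smul_tmul',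
      map_smul]

theorem tensorHom_right (x y : MonoidAlgebra K S) (d : Delta K (r.e l).1) (v : Nabla K (r.e l).1)
    (hy : (gtSpan K l).mkQ y = F (d ⊗ₜ[K] v)) :
    (gtSpan K l).mkQ (y * x) =
      F (d ⊗ₜ[K] (linExt (fun s => nablaRight K (r.e l).1 s) : MonoidAlgebra K S →ₗ[K] _) x v) := by
  induction x using MonoidAlgebra.induction_on with
  | of s =>
    let Λ : MonoidAlgebra K S ⧸ gtSpan K l →ₗ[K] MonoidAlgebra K S ⧸ gtSpan K l :=
      Submodule.mapQ _ _ (LinearMap.mulRight K (MonoidAlgebra.of K S s))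
        fun a ha => gtSpan_mem_mul l _ ha
    have h1 : (gtSpan K l).mkQ (y * MonoidAlgebra.of K S s) = Λ ((gtSpan K l).mkQ y) := rfl
    rw [h1, hy, linExt_of]
    have : Λ ∘ₗ F = F ∘ₗ TensorProduct.map LinearMap.id (nablaRight K (r.e l).1 s) := by
      refine TensorProduct.ext (Delta.hom_ext fun a => Nabla.hom_ext fun b => ?_)
      change Λ (F (Delta.single K a ⊗ₜ[K] Nabla.single K b)) =
        F (Delta.single K a ⊗ₜ[K] nablaRight K (r.e l).1 s (Nabla.single K b))
      rw [nablaRight_single, hF]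
      change (gtSpan K l).mkQ (MonoidAlgebra.of K S (a.1 * b.1) * MonoidAlgebra.of K S s) = _
      rw [← map_mul, mul_assoc]
      by_cases hs : simR (b.1 * s) (r.e l).1
      · rw [dif_pos hs, hF]
      · rw [dif_neg hs, TensorProduct.tmul_zero, map_zero]
        have h2 := lt_jcell_of_not_simR b.2 hs
        rw [r.jcell_e] at h2
        exact (Submodule.Quotient.mk_eq_zero _).mpr
          (of_mem_gtSpan (h2.trans_le (jcell_le.mpr (leL_mul _ _).leJ)))
    exact LinearMap.congr_fun this (d ⊗ₜ[K] v)
  | add a b ha hb =>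
    rw [mul_add, map_add, ha, hb, map_add, LinearMap.add_apply, TensorProduct.tmul_add, map_add]
  | smul c a ha =>
    rw [mul_smul_comm, map_smul, ha, map_smul, LinearMap.smul_apply, TensorProduct.tmul_smul,
      map_smul]

include hmul hinv in
-- A left inverse modulo the balancing relations sends `t_T h t_B^*` to `t_T h ⊗ t_B^*` and the
-- elements of all other cells to zero.
theorem ker_le_tensorBalance : LinearMap.ker F ≤ tensorBalance K (r.e l) := by
  let β := Equiv.ofBijective r.elt (r.elt_bijective hmul hinv)
  let Q := tensorBalance K (r.e l)
  let g : (Σ l : JCell S, RightCells l × HCell (r.e l) × RightCells l) →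
      Delta K (r.e l).1 ⊗[K] Nabla K (r.e l).1 := fun p =>
    if h : p.1 = l then
      Delta.single K (r.leftElt (h ▸ (p.2.1, p.2.2.1))) ⊗ₜ[K]
        Nabla.single K (r.rightElt hmul (h ▸ (p.2.2.2, (1 : HCell (r.e p.1)))))
    else 0
  have hg : ∀ T h B, g ⟨l, T, h, B⟩ = Delta.single K (r.leftElt (T, h)) ⊗ₜ[K]
      Nabla.single K (r.rightElt hmul (B, 1)) := fun T h B => dif_pos rfl
  let G₀ : MonoidAlgebra K S →ₗ[K] (Delta K (r.e l).1 ⊗[K] Nabla K (r.e l).1) ⧸ Q :=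
    linExt fun s => Q.mkQ (g (β.symm s))
  have hG₀ : ∀ s, G₀ (MonoidAlgebra.of K S s) = Q.mkQ (g (β.symm s)) := linExt_of _
  let G := (gtSpan K l).liftQ G₀ (Submodule.span_le.mpr (by
    rintro _ ⟨s, hs, rfl⟩
    rw [SetLike.mem_coe, LinearMap.mem_ker, hG₀]
    have h1 : jcell s = (β.symm s).1 := by
      rw [← r.jcell_elt hmul]
      exact congrArg jcell (β.apply_symm_apply s).symm
    have h2 : g (β.symm s) = 0 := dif_neg fun h => (h1 ▸ hs).ne h.symm
    rw [h2, map_zero]))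
  have hGF : G ∘ₗ F = Q.mkQ := by
    refine TensorProduct.ext (Delta.hom_ext fun a => Nabla.hom_ext fun b => ?_)
    change G (F (Delta.single K a ⊗ₜ[K] Nabla.single K b)) =
      Q.mkQ (Delta.single K a ⊗ₜ[K] Nabla.single K b)
    obtain ⟨⟨T, h⟩, rfl⟩ := r.leftElt_bijective.2 a
    obtain ⟨⟨B, k⟩, rfl⟩ := (r.rightElt_bijective hmul hinv).2 b
    rw [hF]
    change G₀ (MonoidAlgebra.of K S _) = _
    have h1 : β.symm ((r.leftElt (T, h)).1 * (r.rightElt hmul (B, k)).1) = ⟨l, T, h * k, B⟩ := by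
      rw [Equiv.symm_apply_eq]
      change r.t l T * h.1 * (k.1 * star (r.t l B)) = r.t l T * (h * k).1 * star (r.t l B)
      rw [HCell.coe_mul]
      simp only [mul_assoc]
    rw [hG₀, h1, hg]
    -- Moving `k` across the tensor sign turns `t_T h ⊗ k t_B^*` into `t_T h k ⊗ t_B^*`, the value
    -- of the left inverse.
    refine (Submodule.Quotient.eq _).mpr (Submodule.subset_span ⟨MonoidAlgebra.of K _ k,
      Delta.single K (r.leftElt (T, h)), Nabla.single K (r.rightElt hmul (B, 1)), ?_⟩)
    rw [linExt_of, linExt_of, deltaRight_single, nablaLeft_single]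
    have h2 : (⟨(r.leftElt (T, h)).1 * k.1, simL_mul (r.leftElt (T, h)).2 k⟩ : LCell (r.e l).1) =
        r.leftElt (T, h * k) := Subtype.ext (mul_assoc _ _ _)
    have h3 : (⟨k.1 * (r.rightElt hmul (B, 1)).1, simR_mul (r.rightElt hmul (B, 1)).2 k⟩ :
        RCell (r.e l).1) = r.rightElt hmul (B, k) := by
      refine Subtype.ext ((mul_assoc _ _ _).symm.trans ?_)
      exact congrArg (· * star (r.t l B)) (HCell.mul_right k)
    rw [h2, h3]
  intro t ht
  have h1 := LinearMap.congr_fun hGF t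
  rw [LinearMap.comp_apply, LinearMap.mem_ker.mp ht, map_zero] at h1
  exact (Submodule.Quotient.mk_eq_zero _).mp h1.symm

end TensorHom

end SandwichMonoid

end Motz

namespace Motz

/-! ### Verification of the sandwich cellular axioms for a finite monoid with anti-involution -/

section MonoidDatum

open scoped TensorProduct Classical

variable {K : Type u} [Field K] {S : Type} [Monoid S] [Finite S] {star : S → S}
  (hmul : ∀ a b, star (a * b) = star b * star a) (hinv : ∀ a, star (star a) = a)
  (r : CellReps S star)

omit [Finite S] in
include hmul in
theorem linExt_star_mul (x y : MonoidAlgebra K S) :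
    linExt (fun s => MonoidAlgebra.of K S (star s)) (x * y) =
      linExt (fun s => MonoidAlgebra.of K S (star s)) y *
        linExt (fun s => MonoidAlgebra.of K S (star s)) x := by
  induction x using MonoidAlgebra.induction_on with
  | of s =>
    induction y using MonoidAlgebra.induction_on with
    | of t => rw [← map_mul, linExt_of, linExt_of, linExt_of, hmul, map_mul]
    | add a b ha hb => rw [mul_add, map_add, map_add, ha, hb, add_mul]
    | smul c a ha => rw [mul_smul_comm, map_smul, map_smul, ha, smul_mul_assoc]
  | add a b ha hb => rw [add_mul, map_add, map_add, ha, hb, mul_add]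
  | smul c a ha => rw [smul_mul_assoc, map_smul, map_smul, ha, mul_smul_comm]

omit [Finite S] in
include hinv in
theorem linExt_star_star (x : MonoidAlgebra K S) :
    linExt (fun s => MonoidAlgebra.of K S (star s))
      (linExt (fun s => MonoidAlgebra.of K S (star s)) x) = x := by
  induction x using MonoidAlgebra.induction_on with
  | of s => rw [linExt_of, linExt_of, hinv]
  | add a b ha hb => rw [map_add, map_add, ha, hb]
  | smul c a ha => rw [map_smul, map_smul, ha]

omit [Finite S] in
include hmul hinv in
theorem CellReps.star_elt {l : JCell S} (T : RightCells l) (h : HCell (r.e l))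
    (B : RightCells l) : star (r.t l T * h.1 * star (r.t l B)) =
      r.t l B * (r.starH l h).1 * star (r.t l T) := by
  rw [hmul, hmul, hinv, r.coe_starH, mul_assoc]

omit [Finite S] in
theorem monoidDatum_basisElt (i : Σ l : JCell S, RightCells l × HCell (r.e l) × RightCells l) :
    (monoidDatum K star r).basisElt i = MonoidAlgebra.of K S (r.elt i) := rfl

include hmul hinv in
theorem range_basisElt : Set.range (monoidDatum K star r).basisElt =
    Set.range (MonoidAlgebra.of K S) := by
  have h : (monoidDatum K star r).basisElt = MonoidAlgebra.of K S ∘ r.elt :=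
    funext (monoidDatum_basisElt r)
  exact (congrArg Set.range h).trans ((r.elt_bijective hmul hinv).2.range_comp _)

include hmul hinv

theorem monoidDatum_gtIdeal (l : JCell S) :
    (monoidDatum K star r).gtIdeal l = gtSpan K l := by
  refine congrArg (Submodule.span K) (Set.ext fun a => ⟨?_, ?_⟩)
  · rintro ⟨p, hp, T, h, B, rfl⟩
    exact ⟨_, lt_of_lt_of_eq hp (r.jcell_elt hmul ⟨p, T, h, B⟩).symm, rfl⟩
  · rintro ⟨s, hs, rfl⟩
    obtain ⟨⟨p, T, h, B⟩, rfl⟩ := (r.elt_bijective hmul hinv).2 s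
    exact ⟨p, lt_of_lt_of_eq hs (r.jcell_elt hmul ⟨p, T, h, B⟩), T, h, B, rfl⟩

/-- Products of the two enumerated cells are again of the form `t_T (h k) t_B^*`, and every basis
element of the cell arises with `k = 1`; those of higher cells are zero in the quotient. -/
theorem range_tensorHom {l : JCell S}
    {F : Delta K (r.e l).1 ⊗[K] Nabla K (r.e l).1 →ₗ[K] MonoidAlgebra K S ⧸ gtSpan K l}
    (hF : ∀ a b, F (Delta.single K a ⊗ₜ[K] Nabla.single K b) =
      (gtSpan K l).mkQ (MonoidAlgebra.of K S (a.1 * b.1))) :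
    LinearMap.range F = ((monoidDatum K star r).geIdeal l).map (gtSpan K l).mkQ := by
  refine le_antisymm ?_ (Submodule.map_le_iff_le_comap.mpr (Submodule.span_le.mpr ?_))
  · have h : (((monoidDatum K star r).geIdeal l).map (gtSpan K l).mkQ).mkQ ∘ₗ F = 0 := by
      refine TensorProduct.ext (Delta.hom_ext fun a => Nabla.hom_ext fun b => ?_)
      change Submodule.mkQ _ (F (Delta.single K a ⊗ₜ[K] Nabla.single K b)) = 0
      obtain ⟨⟨T, h⟩, rfl⟩ := r.leftElt_bijective.2 a
      obtain ⟨⟨B, k⟩, rfl⟩ := (r.rightElt_bijective hmul hinv).2 b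
      rw [hF]
      refine (Submodule.Quotient.mk_eq_zero _).mpr (Submodule.mem_map_of_mem
        (Submodule.subset_span ⟨l, le_rfl, T, h * k, B, ?_⟩))
      refine congrArg (MonoidAlgebra.of K S) ?_
      change r.t l T * h.1 * (k.1 * star (r.t l B)) = r.t l T * (h.1 * k.1) * star (r.t l B)
      simp only [mul_assoc]
    rw [← LinearMap.range_le_ker_iff, Submodule.ker_mkQ] at h
    exact h
  · rintro _ ⟨p, hp, T, h, B, rfl⟩
    rcases hp.eq_or_lt with hp | hp
    · obtain rfl : l = p := hp
      refine ⟨Delta.single K (r.leftElt (T, h)) ⊗ₜ[K] Nabla.single K (r.rightElt hmul (B, 1)), ?_⟩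
      rw [hF]
      refine congrArg (fun z => (gtSpan K l).mkQ (MonoidAlgebra.of K S z)) ?_
      exact congrArg (r.t l T * h.1 * ·) (r.e_mul_star hmul B)
    · refine ⟨0, ?_⟩
      rw [map_zero]
      refine ((Submodule.Quotient.mk_eq_zero _).mpr ?_).symm
      exact of_mem_gtSpan (lt_of_lt_of_eq hp (r.jcell_elt hmul ⟨p, T, h, B⟩).symm)

theorem exists_cell_iso (l : JCell S) :
    ∃ ψ : ((Delta K (r.e l).1 ⊗[K] Nabla K (r.e l).1) ⧸ tensorBalance K (r.e l)) ≃ₗ[K]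
        ((monoidDatum K star r).geIdeal l).map (gtSpan K l).mkQ,
      ∀ (d : Delta K (r.e l).1) (v : Nabla K (r.e l).1) (x y : MonoidAlgebra K S),
        (gtSpan K l).mkQ y = ψ ((tensorBalance K (r.e l)).mkQ (d ⊗ₜ[K] v)) →
          (gtSpan K l).mkQ (x * y) = ψ ((tensorBalance K (r.e l)).mkQ
            ((linExt fun s => deltaLeft K (r.e l).1 s : MonoidAlgebra K S →ₗ[K] _) x d ⊗ₜ[K] v)) ∧
          (gtSpan K l).mkQ (y * x) = ψ ((tensorBalance K (r.e l)).mkQ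
            (d ⊗ₜ[K] (linExt fun s => nablaRight K (r.e l).1 s : MonoidAlgebra K S →ₗ[K] _) x v)) := by
  obtain ⟨F, hF⟩ := exists_tensor_hom K l (r.e l).1
  let F' := (tensorBalance K (r.e l)).liftQ F (tensorBalance_le_ker r hF)
  have hinj : Function.Injective F' := by
    rw [← LinearMap.ker_eq_bot]
    exact Submodule.ker_liftQ_eq_bot _ _ _ (ker_le_tensorBalance hmul hinv r hF)
  have hrange : LinearMap.range F' = ((monoidDatum K star r).geIdeal l).map (gtSpan K l).mkQ :=
    (Submodule.range_liftQ _ _ _).trans (range_tensorHom hmul hinv r hF)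
  refine ⟨(LinearEquiv.ofInjective F' hinj).trans (LinearEquiv.ofEq _ _ hrange),
    fun d v x y hy => ⟨tensorHom_left r hF x y d v hy, tensorHom_right r hF x y d v hy⟩⟩

theorem monoidDatum_isInvolutiveSandwichCellular :
    (monoidDatum K star r).IsInvolutiveSandwichCellular where
  finite_T l := by
    change Finite (RightCells l)
    infer_instance
  linearIndependent := by
    have h : ∀ s, MonoidAlgebra.basis S K s = MonoidAlgebra.of K S s := by simp
    have h1 := (MonoidAlgebra.basis S K).linearIndependent.comp _ (r.elt_bijective hmul hinv).1
    rw [show MonoidAlgebra.basis S K ∘ r.elt = MonoidAlgebra.of K S ∘ r.elt from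
      funext fun i => h _] at h1
    exact h1
  span_eq_top := by
    have h : (MonoidAlgebra.of K S : S → MonoidAlgebra K S) = MonoidAlgebra.basis S K := by
      funext s
      simp
    rw [range_basisElt hmul hinv, h]
    exact (MonoidAlgebra.basis S K).span_eq
  left_mul l T x := by
    obtain ⟨ρ, hρ⟩ := exists_left_mul r T x
    have hb : ∀ h, MonoidAlgebra.of K (HCell (r.e l)) h = MonoidAlgebra.basis _ K h := by simp
    simp only [hb] at hρ
    refine ⟨ρ, fun h B => (SetLike.ext_iff.mp (monoidDatum_gtIdeal hmul hinv r l) _).mpr ?_⟩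
    exact hρ h B
  right_mul l B x := by
    obtain ⟨ρ, hρ⟩ := exists_right_mul hmul hinv r B x
    have hb : ∀ h, MonoidAlgebra.of K (HCell (r.e l)) h = MonoidAlgebra.basis _ K h := by simp
    simp only [hb] at hρ
    refine ⟨ρ, fun h T => (SetLike.ext_iff.mp (monoidDatum_gtIdeal hmul hinv r l) _).mpr ?_⟩
    exact hρ h T
  ΔL_one l := linExt_one (map_one (deltaLeft K (r.e l).1))
  ΔL_mul l := linExt_mul (map_mul (deltaLeft K (r.e l).1))
  ΔR_one l := linExt_one deltaRight_one
  ΔR_mul l := linExt_mul_rev deltaRight_mul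
  Δ_comm l := linExt_comm fun s h => LinearMap.ext fun d => deltaLeft_deltaRight K s h d
  NL_one l := linExt_one nablaLeft_one
  NL_mul l := linExt_mul nablaLeft_mul
  NR_one l := linExt_one (nablaRight_one _)
  NR_mul l := linExt_mul_rev (nablaRight_mul _)
  N_comm l := linExt_comm nablaRight_nablaLeft
  Δ_free l := ⟨RightCells l, fun T => Delta.single K (r.tL T),
    bijective_sum_of_bijective r.leftElt r.leftElt_bijective (V := Delta K (r.e l).1)
      (LinearEquiv.refl K (LCell (r.e l).1 →₀ K)) (fun h => deltaRight K h) _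
      fun T h => deltaRight_single h (r.tL T)⟩
  N_free l := ⟨RightCells l, fun B => Nabla.single K (r.rightElt hmul (B, 1)),
    bijective_sum_of_bijective (r.rightElt hmul) (r.rightElt_bijective hmul hinv)
      (V := Nabla K (r.e l).1) (LinearEquiv.refl K (RCell (r.e l).1 →₀ K))
      (fun h => nablaLeft K h) _ fun B h => by
        refine (nablaLeft_single h (r.rightElt hmul (B, 1))).trans
          (congrArg (Nabla.single K) (Subtype.ext ?_))
        exact (mul_assoc _ _ _).symm.trans
          (congrArg (· * star (r.t l B)) (HCell.mul_right h))⟩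
  cell_iso l := by
    have h := exists_cell_iso (K := K) hmul hinv r l
    rw [← monoidDatum_gtIdeal hmul hinv r l] at h
    exact h
  starA_one := by
    have h1 : star 1 = 1 := by
      have := hmul 1 (star 1)
      rw [one_mul, hinv, one_mul] at this
      exact this.symm
    refine (linExt_of (K := K) (fun s => MonoidAlgebra.of K S (star s)) 1).trans ?_
    rw [h1, map_one]
  starA_mul := linExt_star_mul hmul
  starA_starA := linExt_star_star hinv
  starI_starI l h := r.starH_starH hinv h
  starA_basis l T h B := by
    have h1 : (monoidDatum K star r).starA ((monoidDatum K star r).C l T h B) =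
        (monoidDatum K star r).C l B ((monoidDatum K star r).starI l h) T := by
      refine (linExt_of (K := K) (fun s => MonoidAlgebra.of K S (star s)) _).trans ?_
      exact congrArg (MonoidAlgebra.of K S) (r.star_elt hmul hinv T h B)
    rw [h1, sub_self]
    exact zero_mem _

end MonoidDatum

end Motz

namespace Motz

/-! ### Reflection and cell representatives in the cyclic Motzkin monoid -/

section MotzkinSandwich

variable {m n : ℕ}

theorem CDiagram.flip_mul (a b : CyclicMotzkin m n) : (a * b).flip = b.flip * a.flip := by
  refine CDiagram.ext (Diagram.flip_mul _ _) ?_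
  change a.count + b.count + ((internal a.skeleton.rel b.skeleton.rel : ℕ) : ZMod m) =
    b.count + a.count + ((internal b.skeleton.flip.rel a.skeleton.flip.rel : ℕ) : ZMod m)
  rw [add_comm a.count]
  exact congrArg (fun k : ℕ => b.count + a.count + (k : ZMod m)) (internal_swap _ _).symm

theorem CDiagram.flip_flip (a : CyclicMotzkin m n) : a.flip.flip = a :=
  CDiagram.ext a.skeleton.flip_flip rfl

/-- Each `J`-cell contains a symmetric idempotent over some `a * a.flip`. The representative of a
right cell joins the upper half of that right cell to the lower half of the idempotent, which is
possible because the numbers of through strands agree. -/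
theorem nonempty_cellReps [NeZero m] : Nonempty (CellReps (CyclicMotzkin m n) CDiagram.flip) := by
  have h1 : ∀ l : JCell (CyclicMotzkin m n), ∃ e : Idem (CyclicMotzkin m n),
      jcell e.1 = l ∧ e.1.flip = e.1 := by
    intro l
    obtain ⟨a, rfl⟩ := jcell_surjective l
    obtain ⟨e, -, he, hea⟩ := exists_idem_over (m := m) a.skeleton
    exact ⟨e, jcell_eq.mpr (simJ_iff_through.mpr hea), he⟩
  choose e he he' using h1
  have h2 : ∀ (l : JCell (CyclicMotzkin m n)) (R : RightCells l),
      ∃ t, t ∈ R.1 ∧ simL t (e l).1 := by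
    rintro l ⟨R, x, hx, rfl⟩
    have hxe : x.skeleton.upper.thru.card = (e l).1.skeleton.lower.thru.card := by
      rw [← Diagram.through_eq, Diagram.card_lower]
      exact simJ_iff_through.mp (jcell_eq.mp (hx.trans (he l).symm))
    refine ⟨⟨x.skeleton.upper.join (e l).1.skeleton.lower hxe, 0⟩, ?_, ?_⟩
    · exact simR_iff.mpr (Diagram.simR_iff.mpr (Half.join_upper _ _ _))
    · exact simL_iff.mpr (Diagram.simL_iff.mpr (Half.join_lower _ _ _))
  choose t ht ht' using h2
  exact ⟨{
    e := e
    jcell_e := he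
    -- Membership in `H(e)` depends only on the skeleton, and the skeleton of `e` is fixed by
    -- reflection.
    starH := fun l h => ⟨h.1.flip, simH_iff.mpr
      ((congrArg Diagram.flip (simH_iff.mp h.2)).trans (congrArg CDiagram.skeleton (he' l)))⟩
    coe_starH := fun _ _ => rfl
    star_e := he'
    t := t
    t_mem := ht
    t_simL := ht' }⟩

end MotzkinSandwich

end Motz

theorem mainTheorem12 (m n : ℕ) [NeZero m] (K : Type u) [Field K] :
    -- (a) the cell structure is that of the Motzkin monoid, with `H`-cells inflated to size `m`
    (∀ x y : CyclicMotzkin m n,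
      (leL x y ↔ leL x.skeleton y.skeleton) ∧ (leR x y ↔ leR x.skeleton y.skeleton) ∧
      (leJ x y ↔ leJ x.skeleton y.skeleton)) ∧
    (∀ x : CyclicMotzkin m n,
      Nat.card {y : CyclicMotzkin m n // simH y x} =
        m * Nat.card {y : Diagram n // simH y x.skeleton} ∧
      Nat.card {y : CyclicMotzkin m n // simH y x} = m ∧
      ((∃ y, simH y x ∧ IsIdempotentElem y) ↔
        ∃ y, simH y x.skeleton ∧ IsIdempotentElem y)) ∧
    -- the groups `H(e)` are cyclic of order `m`, generated by the internal components
    (∃ φ : ∀ e : Idem (CyclicMotzkin m n), Multiplicative (ZMod m) ≃* HCell e,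
      (∀ e g, (φ e g : CyclicMotzkin m n) = ⟨1, g.toAdd⟩ * e.1) ∧
      -- (b) the classification of the simple representations
      (∀ x y : CyclicMotzkin m n, leJ x y ↔ y.through ≤ x.through) ∧
      (∀ x : CyclicMotzkin m n, x.through ≤ n) ∧
      (∀ j ≤ n, ∃ e : Idem (CyclicMotzkin m n), e.1.through = j) ∧
      (∀ (e : Idem (CyclicMotzkin m n)) (W : Type u) [AddCommGroup W] [Module K W]
        (σ : Representation K (Multiplicative (ZMod m)) W), σ.IsIrreducible →
          IsSimpleModule (MonoidAlgebra K (CyclicMotzkin m n)) (simpleRep K (φ e) σ) ∧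
          ∀ J, IsApex K (simpleRep K (φ e) σ) J ↔ J = jcell e.1) ∧
      (∀ (e e' : Idem (CyclicMotzkin m n)) (W W' : Type u) [AddCommGroup W] [Module K W]
        [AddCommGroup W'] [Module K W'] (σ : Representation K (Multiplicative (ZMod m)) W)
        (σ' : Representation K (Multiplicative (ZMod m)) W'), σ.IsIrreducible → σ'.IsIrreducible →
          (Nonempty (simpleRep K (φ e) σ ≃ₗ[MonoidAlgebra K (CyclicMotzkin m n)]
              simpleRep K (φ e') σ') ↔
            e.1.through = e'.1.through ∧ Nonempty (σ.Equiv σ'))) ∧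
      (∀ (V : Type u) [AddCommGroup V] [Module (MonoidAlgebra K (CyclicMotzkin m n)) V],
        IsSimpleModule (MonoidAlgebra K (CyclicMotzkin m n)) V →
          ∃ (e : Idem (CyclicMotzkin m n)) (W : Type u) (_ : AddCommGroup W) (_ : Module K W)
            (σ : Representation K (Multiplicative (ZMod m)) W), σ.IsIrreducible ∧
              Nonempty (V ≃ₗ[MonoidAlgebra K (CyclicMotzkin m n)] simpleRep K (φ e) σ)) ∧
      -- (e) comparison with the simple representations of the Motzkin algebra
      ((∃ ω : K, IsPrimitiveRoot ω m) → ∀ ζ : K, ζ ^ m = 1 →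
        (∀ x : Diagram n, IsSimpleModule (MotzkinAlgebra K ζ n) (MotzkinSimple K ζ x)) ∧
        ∀ (e : Idem (CyclicMotzkin m n)) (x : Diagram n), x.through = e.1.through →
          ∀ (W : Type u) [AddCommGroup W] [Module K W]
            (σ : Representation K (Multiplicative (ZMod m)) W),
            Module.finrank K W = 1 → (∀ w, σ (Multiplicative.ofAdd 1) w = ζ • w) →
              Module.finrank K (simpleRep K (φ e) σ) =
                Module.finrank K (MotzkinSimple K ζ x))) ∧
    -- (c) well-connectedness and the representation gap of the truncations
    ((m : K) ≠ 0 → ∀ k ≤ n,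
      (n ≤ 1 ∨ 3 ≤ n ∧ 2 ≤ k → WellConnected (truncation m n k)) ∧
      (n ≤ 1 ∧ 2 ≤ m ∨ n = 2 ∧ 1 ≤ k ∨ 3 ≤ n ∧ 2 ≤ k →
        IsLeast (nontrivialSimpleDims K (truncation m n k)) (gap K (truncation m n k)))) ∧
    -- (d) the involutive sandwich cellular structure on the monoid algebra
    (Nonempty (CellReps (CyclicMotzkin m n) CDiagram.flip) ∧
      ∀ r : CellReps (CyclicMotzkin m n) CDiagram.flip,
        (monoidDatum K CDiagram.flip r).IsInvolutiveSandwichCellular ∧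
        Set.range (monoidDatum K CDiagram.flip r).basisElt =
          Set.range (MonoidAlgebra.of K (CyclicMotzkin m n))) := by
  refine ⟨fun x y => ⟨leL_iff, leR_iff, leJ_iff_skeleton⟩, fun x => ⟨?_, card_simH x,
    exists_idempotent_iff x⟩, ⟨cyclicHCell, fun e g => rfl, fun x y => leJ_iff_through,
      fun x => x.skeleton.through_le, fun j hj => exists_idem_through hj, ?_, ?_, ?_, ?_⟩,
    fun hm k hk => ⟨?_, isLeast_gap_truncation hm hk⟩, nonempty_cellReps, fun r => ⟨?_, ?_⟩⟩
  · rw [card_simH, card_diagram_simH, mul_one]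
  · intro e W _ _ σ hσ
    exact ⟨simpleRep_isSimpleModule _ σ hσ, isApex_simpleRep_iff _ σ hσ⟩
  · intro e e' W W' _ _ _ _ σ σ' hσ hσ'
    exact ⟨fun ⟨f⟩ => simpleRep_equiv_forward e e' σ σ' hσ hσ' f,
      fun ⟨h, ⟨θ⟩⟩ => simpleRep_equiv_backward e e' σ σ' hσ hσ' h θ⟩
  · intro V _ _ hV
    exact exists_simpleRep_equiv V
  · intro _ ζ hζ
    exact ⟨isSimpleModule_motzkinSimple hζ, fun e x hxe W _ _ σ hW hσ =>
      finrank_simpleRep_eq_motzkinSimple hζ x e hxe σ hW hσ⟩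
  · rintro (hn | ⟨hn, hk2⟩)
    · exact wellConnected_of_le_one hn
    · exact wellConnected_of_three_le hn hk2
  · exact monoidDatum_isInvolutiveSandwichCellular CDiagram.flip_mul CDiagram.flip_flip r
  · exact range_basisElt CDiagram.flip_mul CDiagram.flip_flip r
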